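/- Let $X$ be a topological space, $\mathcal{O}$ a sheaf of commutative rings on $X$, and $\mathcal{A}$, $\mathcal{B}$ sheaves of (not necessarily commutative) $\mathcal{O}$-algebras on $X$, that is, sheaves of rings endowed with a morphism from $\mathcal{O}$ with central image. An $\mathcal{O}$-stack is a stack of categories on $X$ whose sheaves of morphisms over each open $U$ are $\mathcal{O}|_U$-modules, compatibly with restriction, and whose composition is $\mathcal{O}$-bilinear. An $\mathcal{O}$-functor is a functor of stacks that is $\mathcal{O}$-linear on morphisms; functors of stacks, transformations and equivalences are those of the underlying prestacks (i.e. families of functors, natural transformations and equivalences over the open subsets, compatible with restriction up to coherent isomorphism). A functor of stacks $\varphi\colon\mathfrak{S}\to\mathfrak{S}'$ admits a right adjoint if there are a functor of stacks $\psi\colon\mathfrak{S}'\to\mathfrak{S}$ and an isomorphism $\mathcal{H}om(\varphi(\cdot),\cdot)\simeq\mathcal{H}om(\cdot,\psi(\cdot))$, natural and compatible with restriction to open subsets. An $\mathcal{O}$-equivalence is an $\mathcal{O}$-functor that is an equivalence. For a sheaf of $\mathcal{O}$-algebras $\mathcal{R}$, let $\mathfrak{Mod}(\mathcal{R})$ be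 the $\mathcal{O}$-stack $U\mapsto \mathrm{Mod}(\mathcal{R}|_U)$ of left $\mathcal{R}$-modules. For $\mathcal{O}$-stacks $\mathfrak{S},\mathfrak{S}'$, let $\mathfrak{Hom}^{\mathrm{rad}}_{\mathcal{O}}(\mathfrak{S},\mathfrak{S}')$ be the $\mathcal{O}$-stack whose objects over an open $U\subset X$ are the $\mathcal{O}|_U$-functors $\mathfrak{S}|_U\to\mathfrak{S}'|_U$ that admit a right adjoint, and whose morphisms are all transformations between them. **Proposition.** For every open $U\subset X$ and every left $(\mathcal{A}\otimes_{\mathcal{O}}\mathcal{B}^{\mathrm{op}})|_U$-module $\mathcal{L}$, the functor $\mathcal{L}\otimes_{\mathcal{B}}(\cdot)\colon \mathfrak{Mod}(\mathcal{B})|_U\to\mathfrak{Mod}(\mathcal{A})|_U$ is an $\mathcal{O}|_U$-functor that admits a right adjoint, and the functor $$\Phi\colon \mathfrak{Mod}(\mathcal{A}\otimes_{\mathcal{O}}\mathcal{B}^{\mathrm{op}})\longrightarrow \mathfrak{Hom}^{\mathrm{rad}}_{\mathcal{O}}\bigl(\mathfrak{Mod}(\mathcal{B}),\mathfrak{Mod}(\mathcal{A})\bigr),\qquad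 \mathcal{L}\longmapsto \mathcal{L}\otimes_{\mathcal{B}}(\cdot),$$ is an $\mathcal{O}$-equivalence. -/

import Mathlib

open CategoryTheory TopologicalSpace Opposite

universe v₁ v₂ v₃ w₁ w₂ w₃ u

set_option linter.checkUnivs false

namespace LinearStack

/-- A prestack on `X`: a category `P(U)` for each open `U`, restriction functors `P(U) → P(V)` for
`V ⊆ U`, and isomorphisms `(F|_V)|_W ≅ F|_W` and `F|_U ≅ F`, subject to the cocycle and unit
conditions. In other words, a pseudofunctor from the opposite of the poset of opens of `X` to
categories. A stack is a prestack satisfying descent. Functors of stacks, their transformations,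
their equivalences and their adjoints are those of the underlying prestacks. -/
structure Prestack (X : Type u) [TopologicalSpace X] where
  obj : Opens X → Type w₁
  [cat : ∀ U, Category.{v₁} (obj U)]
  res : ∀ {U V : Opens X}, V ≤ U → (obj U ⥤ obj V)
  resId : ∀ U : Opens X, res (le_refl U) ≅ 𝟭 (obj U)
  resComp : ∀ {U V W : Opens X} (h : V ≤ U) (k : W ≤ V),
    res h ⋙ res k ≅ res (k.trans h)
  resComp_assoc : ∀ {U V W Y : Opens X} (h : V ≤ U) (k : W ≤ V) (l : Y ≤ W) (F : obj U),
    (res l).map ((resComp h k).hom.app F) ≫ (resComp (k.trans h) l).hom.app F =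
      (resComp k l).hom.app ((res h).obj F) ≫ (resComp h (l.trans k)).hom.app F
  resComp_id_left : ∀ {U V : Opens X} (h : V ≤ U) (F : obj U),
    (resComp (le_refl U) h).hom.app F = (res h).map ((resId U).hom.app F)
  resComp_id_right : ∀ {U V : Opens X} (h : V ≤ U) (F : obj U),
    (resComp h (le_refl V)).hom.app F = (resId V).hom.app ((res h).obj F)

attribute [instance] Prestack.cat

section

variable {X : Type u} [TopologicalSpace X]

/-- A functor of prestacks `P|_U → Q|_U` over the open subset `U`: functors `P(V) → Q(V)` for
`V ⊆ U` and isomorphisms `φ(F|_W) ≅ φ(F)|_W` compatible with the isomorphisms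
`(F|_W)|_Y ≅ F|_Y`. A functor `P → Q` is the case `U = X`. -/
structure FunctorOn (U : Opens X) (P : Prestack.{v₁, w₁} X) (Q : Prestack.{v₂, w₂} X) where
  app : ∀ V : Opens X, V ≤ U → (P.obj V ⥤ Q.obj V)
  iso : ∀ {V W : Opens X} (hV : V ≤ U) (k : W ≤ V),
    P.res k ⋙ app W (k.trans hV) ≅ app V hV ⋙ Q.res k
  iso_comp : ∀ {V W Y : Opens X} (hV : V ≤ U) (k : W ≤ V) (l : Y ≤ W) (F : P.obj V),
    (app Y (l.trans (k.trans hV))).map ((P.resComp k l).hom.app F) ≫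
        (iso hV (l.trans k)).hom.app F =
      (iso (k.trans hV) l).hom.app ((P.res k).obj F) ≫
        (Q.res l).map ((iso hV k).hom.app F) ≫ (Q.resComp k l).hom.app ((app V hV).obj F)

namespace FunctorOn

variable {U : Opens X} {P : Prestack.{v₁, w₁} X} {Q : Prestack.{v₂, w₂} X}
  {R : Prestack.{v₃, w₃} X}

/-- A transformation `φ ⇒ ψ`: a family of natural transformations compatible with the
restrictions. -/
@[ext]
structure Hom (φ ψ : FunctorOn U P Q) where
  app : ∀ (V : Opens X) (hV : V ≤ U), φ.app V hV ⟶ ψ.app V hV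
  naturality : ∀ {V W : Opens X} (hV : V ≤ U) (k : W ≤ V) (F : P.obj V),
    (app W (k.trans hV)).app ((P.res k).obj F) ≫ (ψ.iso hV k).hom.app F =
      (φ.iso hV k).hom.app F ≫ (Q.res k).map ((app V hV).app F)

instance : Category (FunctorOn U P Q) where
  Hom := Hom
  id φ := { app := fun V hV => 𝟙 _, naturality := by intros; simp }
  comp α β :=
    { app := fun V hV => α.app V hV ≫ β.app V hV
      naturality := by
        intro V W hV k F
        simp [β.naturality, reassoc_of% (α.naturality hV k F)] }

@[ext]
lemma hom_ext {φ ψ : FunctorOn U P Q} {α β : φ ⟶ ψ}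
    (h : ∀ (V : Opens X) (hV : V ≤ U) (F : P.obj V),
      (α.app V hV).app F = (β.app V hV).app F) : α = β := by
  apply Hom.ext
  funext V hV
  ext F
  exact h V hV F

@[simp]
lemma id_app (φ : FunctorOn U P Q) (V : Opens X) (hV : V ≤ U) :
    Hom.app (𝟙 φ) V hV = 𝟙 _ := rfl

@[simp]
lemma comp_app {φ ψ χ : FunctorOn U P Q} (α : φ ⟶ ψ) (β : ψ ⟶ χ) (V : Opens X) (hV : V ≤ U) :
    (α ≫ β).app V hV = α.app V hV ≫ β.app V hV := rfl

/-- The identity functor of `P|_U`. -/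
def id (U : Opens X) (P : Prestack.{v₁, w₁} X) : FunctorOn U P P where
  app V _ := 𝟭 _
  iso _ _ := Iso.refl _
  iso_comp := by intros; simp

/-- The composite of `φ : P|_U → Q|_U` and `ψ : Q|_U → R|_U`. -/
def comp (φ : FunctorOn U P Q) (ψ : FunctorOn U Q R) : FunctorOn U P R where
  app V hV := φ.app V hV ⋙ ψ.app V hV
  iso {V W} hV k :=
    (Functor.associator _ _ _).symm ≪≫
      Functor.isoWhiskerRight (φ.iso hV k) (ψ.app W (k.trans hV)) ≪≫
        Functor.associator _ _ _ ≪≫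
          Functor.isoWhiskerLeft (φ.app V hV) (ψ.iso hV k) ≪≫ (Functor.associator _ _ _).symm
  iso_comp := by
    intro V W Y hV k l F
    have h₁ := congrArg (ψ.app Y (l.trans (k.trans hV))).map (φ.iso_comp hV k l F)
    have h₂ := ψ.iso_comp hV k l ((φ.app V hV).obj F)
    have h₃ := (ψ.iso (k.trans hV) l).hom.naturality ((φ.iso hV k).hom.app F)
    simp only [Functor.map_comp, Functor.comp_map, Functor.comp_obj] at h₁ h₂ h₃
    simp [reassoc_of% h₁, h₂, reassoc_of% h₃]

/-- The restriction to `V ⊆ U` of a functor `P|_U → Q|_U`. -/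
def restrict {V : Opens X} (h : V ≤ U) (φ : FunctorOn U P Q) : FunctorOn V P Q where
  app W hW := φ.app W (hW.trans h)
  iso hW k := φ.iso (hW.trans h) k
  iso_comp hW k l F := φ.iso_comp (hW.trans h) k l F

/-- Restriction to `V ⊆ U` as a functor. -/
def restriction {V : Opens X} (h : V ≤ U) (P : Prestack.{v₁, w₁} X) (Q : Prestack.{v₂, w₂} X) :
    FunctorOn U P Q ⥤ FunctorOn V P Q where
  obj := restrict h
  map α :=
    { app := fun W hW => α.app W (hW.trans h)
      naturality := fun hW k F => α.naturality (hW.trans h) k F }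

/-- `ψ` is right adjoint to `φ`: bijections `Hom(φ(F), G) ≅ Hom(F, ψ(G))`, natural in `F` and `G`
and compatible with restriction to smaller open subsets, that is, an isomorphism between the
`Hom` sheaves `Hom(φ(·), ·)` and `Hom(·, ψ(·))`. -/
structure RightAdjunction (φ : FunctorOn U P Q) (ψ : FunctorOn U Q P) where
  adj : ∀ (V : Opens X) (hV : V ≤ U), φ.app V hV ⊣ ψ.app V hV
  res_homEquiv : ∀ {V W : Opens X} (hV : V ≤ U) (k : W ≤ V) (F : P.obj V) (G : Q.obj V)
    (f : (φ.app V hV).obj F ⟶ G),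
    (adj W (k.trans hV)).homEquiv ((P.res k).obj F) ((Q.res k).obj G)
        ((φ.iso hV k).hom.app F ≫ (Q.res k).map f) ≫ (ψ.iso hV k).hom.app G =
      (P.res k).map ((adj V hV).homEquiv F G f)

/-- `φ` admits a right adjoint, which is itself a functor of prestacks. -/
def HasRightAdjoint (φ : FunctorOn U P Q) : Prop :=
  ∃ ψ : FunctorOn U Q P, Nonempty (RightAdjunction φ ψ)

lemma HasRightAdjoint.restrict {φ : FunctorOn U P Q} (hφ : φ.HasRightAdjoint) {V : Opens X}
    (h : V ≤ U) : (φ.restrict h).HasRightAdjoint := by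
  obtain ⟨ψ, ⟨a⟩⟩ := hφ
  exact ⟨ψ.restrict h, ⟨{
    adj := fun W hW => a.adj W (hW.trans h)
    res_homEquiv := fun hW k F G f => a.res_homEquiv (hW.trans h) k F G f }⟩⟩

/-- `φ` is an equivalence: it admits a quasi-inverse functor of prestacks. -/
def IsEquivalence (φ : FunctorOn U P Q) : Prop :=
  ∃ ψ : FunctorOn U Q P, Nonempty (φ.comp ψ ≅ FunctorOn.id U P) ∧
    Nonempty (ψ.comp φ ≅ FunctorOn.id U Q)

end FunctorOn

end


section

variable {X : Type u} [TopologicalSpace X]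

/-- An `O`-prestack, for a sheaf of commutative rings `O`: each `P(U)` is an `O(U)`-linear
category, and the restriction of morphisms is compatible with the restriction of `O`. So the
presheaves `Hom(F, G)` are `O|_U`-modules and the composition is `O`-bilinear. An `O`-stack is a
stack whose underlying prestack has such a structure. -/
structure LinearPrestack (O : Sheaf (Opens.grothendieckTopology X) CommRingCat.{u}) extends
    Prestack.{v₁, w₁} X where
  [preadditive : ∀ U, Preadditive (obj U)]
  [linear : ∀ U, Linear (O.obj.obj (op U)) (obj U)]
  res_add : ∀ {U V : Opens X} (h : V ≤ U) {F G : obj U} (f g : F ⟶ G),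
    (res h).map (f + g) = (res h).map f + (res h).map g
  res_smul : ∀ {U V : Opens X} (h : V ≤ U) (r : O.obj.obj (op U)) {F G : obj U} (f : F ⟶ G),
    (res h).map (r • f) = O.obj.map (homOfLE h).op r • (res h).map f

attribute [instance] LinearPrestack.preadditive LinearPrestack.linear

variable {O : Sheaf (Opens.grothendieckTopology X) CommRingCat.{u}}

namespace FunctorOn

variable {U : Opens X}

/-- `φ` is an `O`-functor: its action on morphisms is `O`-linear. -/
structure IsLinear {P : LinearPrestack.{v₁, w₁} O} {Q : LinearPrestack.{v₂, w₂} O}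
    (φ : FunctorOn U P.toPrestack Q.toPrestack) : Prop where
  map_add : ∀ (V : Opens X) (hV : V ≤ U) {F G : P.obj V} (f g : F ⟶ G),
    (φ.app V hV).map (f + g) = (φ.app V hV).map f + (φ.app V hV).map g
  map_smul : ∀ (V : Opens X) (hV : V ≤ U) (r : O.obj.obj (op V)) {F G : P.obj V} (f : F ⟶ G),
    (φ.app V hV).map (r • f) = r • (φ.app V hV).map f

lemma IsLinear.restrict {P : LinearPrestack.{v₁, w₁} O} {Q : LinearPrestack.{v₂, w₂} O}
    {φ : FunctorOn U P.toPrestack Q.toPrestack} (hφ : φ.IsLinear) {V : Opens X} (h : V ≤ U) :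
    (φ.restrict h).IsLinear where
  map_add W hW := hφ.map_add W (hW.trans h)
  map_smul W hW := hφ.map_smul W (hW.trans h)

section homs

variable {P : Prestack.{v₁, w₁} X} {Q : LinearPrestack.{v₂, w₂} O}

variable {φ ψ : FunctorOn U P Q.toPrestack}

instance {U V : Opens X} (h : V ≤ U) : (Q.res h).Additive := ⟨Q.res_add h _ _⟩

instance : Zero (φ ⟶ ψ) where
  zero := { app := fun V hV => 0, naturality := by intros; simp }

instance : Add (φ ⟶ ψ) where
  add α β :=
    { app := fun V hV => α.app V hV + β.app V hV
      naturality := by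
        intro V W hV k F
        simp [α.naturality hV k F, β.naturality hV k F, Functor.map_add] }

instance : Neg (φ ⟶ ψ) where
  neg α :=
    { app := fun V hV => - α.app V hV
      naturality := by
        intro V W hV k F
        simp [α.naturality hV k F, Functor.map_neg] }

@[simp]
lemma zero_app (V : Opens X) (hV : V ≤ U) : (0 : φ ⟶ ψ).app V hV = 0 := rfl

@[simp]
lemma add_app (α β : φ ⟶ ψ) (V : Opens X) (hV : V ≤ U) :
    (α + β).app V hV = α.app V hV + β.app V hV := rfl

@[simp]
lemma neg_app (α : φ ⟶ ψ) (V : Opens X) (hV : V ≤ U) : (-α).app V hV = -α.app V hV := rfl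

instance : AddCommGroup (φ ⟶ ψ) where
  add_assoc _ _ _ := by ext; simp [add_assoc]
  zero_add _ := by ext; simp
  add_zero _ := by ext; simp
  neg_add_cancel _ := by ext; simp
  add_comm _ _ := by ext; simp [add_comm]
  nsmul := nsmulRec
  zsmul := zsmulRec

instance : Preadditive (FunctorOn U P Q.toPrestack) where
  add_comp := by intros; ext; simp
  comp_add := by intros; ext; simp

instance : SMul (O.obj.obj (op U)) (φ ⟶ ψ) where
  smul r α :=
    { app := fun V hV =>
        { app := fun F => O.obj.map (homOfLE hV).op r • (α.app V hV).app F
          naturality := by intros; simp }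
      naturality := by
        intro V W hV k F
        have : O.obj.map (homOfLE (k.trans hV)).op r =
            O.obj.map (homOfLE k).op (O.obj.map (homOfLE hV).op r) := by
          rw [← ConcreteCategory.comp_apply, ← O.obj.map_comp]
          rfl
        simp [Q.res_smul, α.naturality hV k F, this] }

@[simp]
lemma smul_app_app (r : O.obj.obj (op U)) (α : φ ⟶ ψ) (V : Opens X) (hV : V ≤ U) (F : P.obj V) :
    ((r • α).app V hV).app F = O.obj.map (homOfLE hV).op r • (α.app V hV).app F := rfl

instance : Module (O.obj.obj (op U)) (φ ⟶ ψ) where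
  one_smul α := by ext; simp
  mul_smul r s α := by ext; simp [mul_smul]
  smul_zero r := by ext; simp
  smul_add r α β := by ext; simp
  add_smul r s α := by ext; simp [add_smul]
  zero_smul α := by ext; simp

instance : Linear (O.obj.obj (op U)) (FunctorOn U P Q.toPrestack) where
  smul_comp := by intros; ext; simp
  comp_smul := by intros; ext; simp

end homs

end FunctorOn


/-- The `O`-prestack of functors from `P` to `Q`: over `U` it is the category of functors
`P|_U → Q|_U`. -/
def functorPrestack (P : LinearPrestack.{v₁, w₁} O) (Q : LinearPrestack.{v₂, w₂} O) :
    LinearPrestack.{max u w₁ v₂, max u w₁ v₁ w₂ v₂} O where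
  obj U := FunctorOn U P.toPrestack Q.toPrestack
  res h := FunctorOn.restriction h P.toPrestack Q.toPrestack
  resId _ := Iso.refl _
  resComp _ _ := Iso.refl _
  resComp_assoc _ _ _ _ := rfl
  resComp_id_left _ _ := rfl
  resComp_id_right _ _ := rfl
  res_add _ _ _ _ _ := rfl
  res_smul {U V} h r φ ψ f := by
    apply FunctorOn.hom_ext
    intro W hW F
    have : O.obj.map (homOfLE (hW.trans h)).op r =
        O.obj.map (homOfLE hW).op (O.obj.map (homOfLE h).op r) := by
      rw [← ConcreteCategory.comp_apply, ← O.obj.map_comp]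
      rfl
    exact congrArg (fun s => s • (f.app W (hW.trans h)).app F) this

/-- The full `O`-subprestack of `P` on the objects with a property that is stable under
restriction. -/
def LinearPrestack.full (P : LinearPrestack.{v₁, w₁} O) (p : ∀ U, ObjectProperty (P.obj U))
    (hp : ∀ {U V : Opens X} (h : V ≤ U) (F : P.obj U), p U F → p V ((P.res h).obj F)) :
    LinearPrestack.{v₁, w₁} O where
  obj U := (p U).FullSubcategory
  res {U V} h := (p V).lift ((p U).ι ⋙ P.res h) (fun F => hp h F.obj F.property)
  resId U := NatIso.ofComponents (fun F => (p U).isoMk ((P.resId U).app F.obj))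
    (by intros; ext; simp)
  resComp {U V W} h k := NatIso.ofComponents (fun F => (p W).isoMk ((P.resComp h k).app F.obj))
    (by intros; ext; exact (P.resComp h k).hom.naturality _)
  resComp_assoc h k l F := by ext; simpa using P.resComp_assoc h k l F.obj
  resComp_id_left h F := by ext; simpa using P.resComp_id_left h F.obj
  resComp_id_right h F := by ext; simpa using P.resComp_id_right h F.obj
  res_add h F G f g := by ext; exact P.res_add h f.hom g.hom
  res_smul h r F G f := by ext; exact P.res_smul h r f.hom

/-- The `O`-prestack `Hom_O^rad(P, Q)`: over `U` it is the category of the `O`-functors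
`P|_U → Q|_U` that admit a right adjoint, and all transformations between them. -/
def homRightAdjoint (P : LinearPrestack.{v₁, w₁} O) (Q : LinearPrestack.{v₂, w₂} O) :
    LinearPrestack.{max u w₁ v₂, max u w₁ v₁ w₂ v₂} O :=
  (functorPrestack P Q).full (fun _ φ => φ.IsLinear ∧ φ.HasRightAdjoint)
    (fun h _ hφ => ⟨hφ.1.restrict h, hφ.2.restrict h⟩)

namespace FunctorOn

/-- A functor with values in a full subprestack. -/
def liftFull {U : Opens X} {P : Prestack.{v₁, w₁} X} {Q : LinearPrestack.{v₂, w₂} O}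
    (φ : FunctorOn U P Q.toPrestack) (p : ∀ V, ObjectProperty (Q.obj V))
    (hp : ∀ {V W : Opens X} (h : W ≤ V) (F : Q.obj V), p V F → p W ((Q.res h).obj F))
    (hφ : ∀ (V : Opens X) (hV : V ≤ U) (F : P.obj V), p V ((φ.app V hV).obj F)) :
    FunctorOn U P (Q.full p hp).toPrestack where
  app V hV := (p V).lift (φ.app V hV) (hφ V hV)
  iso {V W} hV k := NatIso.ofComponents (fun F => (p W).isoMk ((φ.iso hV k).app F))
    (by intros; apply ObjectProperty.hom_ext; exact (φ.iso hV k).hom.naturality _)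
  iso_comp hV k l F := by apply ObjectProperty.hom_ext; exact φ.iso_comp hV k l F

/-- A functor with values in functors `P → Q`, seen as a functor with values in
`Hom_O^rad(P, Q)` when its values are `O`-functors that admit a right adjoint. -/
def toHomRightAdjoint {U : Opens X} {R : Prestack.{v₃, w₃} X} {P : LinearPrestack.{v₁, w₁} O}
    {Q : LinearPrestack.{v₂, w₂} O} (φ : FunctorOn U R (functorPrestack P Q).toPrestack)
    (h : ∀ (V : Opens X) (hV : V ≤ U) (F : R.obj V),
      FunctorOn.IsLinear ((φ.app V hV).obj F) ∧ FunctorOn.HasRightAdjoint ((φ.app V hV).obj F)) :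
    FunctorOn U R (homRightAdjoint P Q).toPrestack :=
  φ.liftFull (Q := functorPrestack P Q) (fun _ χ => χ.IsLinear ∧ χ.HasRightAdjoint)
    (fun k _ hχ => ⟨hχ.1.restrict k, hχ.2.restrict k⟩) h

end FunctorOn

/-- A sheaf of (not necessarily commutative) `O`-algebras: a sheaf of rings `A` with a morphism
`O → A` whose image is central. -/
structure SheafAlgebra (O : Sheaf (Opens.grothendieckTopology X) CommRingCat.{u}) where
  ring : Sheaf (Opens.grothendieckTopology X) RingCat.{u}
  structureMap : O.obj ⋙ forget₂ CommRingCat.{u} RingCat.{u} ⟶ ring.obj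
  central : ∀ (U : (Opens X)ᵒᵖ) (r : O.obj.obj U) (a : ring.obj.obj U),
    (structureMap.app U).hom r * a = a * (structureMap.app U).hom r

namespace SheafAlgebra

variable (A : SheafAlgebra O)

/-- The ring homomorphism `O(U) → A(U)`. -/
def unit (U : (Opens X)ᵒᵖ) : O.obj.obj U →+* A.ring.obj.obj U := (A.structureMap.app U).hom

lemma unit_map {U V : (Opens X)ᵒᵖ} (f : U ⟶ V) (r : O.obj.obj U) :
    A.unit V (O.obj.map f r) = A.ring.obj.map f (A.unit U r) :=
  ConcreteCategory.congr_hom (A.structureMap.naturality f) r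

lemma unit_comm (U : (Opens X)ᵒᵖ) (r : O.obj.obj U) (a : A.ring.obj.obj U) :
    A.unit U r * a = a * A.unit U r := A.central U r a

/-- The category `Mod(A|_U)` of left modules over the sheaf of rings `A|_U`. -/
abbrev Mod (U : Opens X) : Type (u + 1) := SheafOfModules.{u} (A.ring.over U)

variable {A} {U : Opens X}

/-- The image of `r ∈ O(U)` in `A(W)`, for `W ⊆ U`. -/
def scalar (A : SheafAlgebra O) {U : Opens X} (W : (Over U)ᵒᵖ) :
    O.obj.obj (op U) →+* (A.ring.over U).obj.obj W :=
  (A.unit (op W.unop.left)).comp (O.obj.map W.unop.hom.op).hom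

lemma scalar_map (r : O.obj.obj (op U)) {W W' : (Over U)ᵒᵖ} (g : W ⟶ W') :
    (A.ring.over U).obj.map g (A.scalar W r) = A.scalar W' r := by
  refine (A.unit_map g.unop.left.op _).symm.trans ?_
  rw [← ConcreteCategory.comp_apply, ← O.obj.map_comp]
  rfl

lemma scalar_comm (r : O.obj.obj (op U)) (W : (Over U)ᵒᵖ) (a : (A.ring.over U).obj.obj W) :
    A.scalar W r * a = a * A.scalar W r := A.central _ _ _

/-- The morphism `r • f`, i.e. `m ↦ r|_W • f(m)` on `W ⊆ U`. -/
noncomputable def smulHom (r : O.obj.obj (op U)) {M N : A.Mod U} (f : M ⟶ N) : M ⟶ N where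
  val := PresheafOfModules.homMk
    { app := fun W => AddCommGrpCat.ofHom
        (AddMonoidHom.mk' (fun m : M.val.obj W => A.scalar W r • f.val.app W m)
          (by intro a b; simp))
      naturality := by
        intro W W' g
        ext m
        change A.scalar W' r • f.val.app W' (M.val.map g m) =
          N.val.map g (A.scalar W r • f.val.app W m)
        rw [N.val.map_smul, scalar_map]
        exact congrArg (A.scalar W' r • ·) (PresheafOfModules.naturality_apply f.val g m) }
    (by
      intro W a m
      change A.scalar W r • f.val.app W (a • m) = a • A.scalar W r • f.val.app W m
      rw [map_smul, smul_smul, smul_smul, scalar_comm])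

lemma mod_hom_ext {M N : A.Mod U} {f g : M ⟶ N}
    (h : ∀ (W : (Over U)ᵒᵖ) (m : M.val.obj W), f.val.app W m = g.val.app W m) : f = g := by
  apply SheafOfModules.hom_ext
  apply PresheafOfModules.hom_ext
  intro W
  ext m
  exact h W m

noncomputable instance (M N : A.Mod U) : SMul (O.obj.obj (op U)) (M ⟶ N) := ⟨fun r f => smulHom r f⟩

lemma smul_apply (r : O.obj.obj (op U)) {M N : A.Mod U} (f : M ⟶ N) (W : (Over U)ᵒᵖ)
    (m : M.val.obj W) : (r • f).val.app W m = A.scalar W r • f.val.app W m := rfl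

noncomputable instance (M N : A.Mod U) : Module (O.obj.obj (op U)) (M ⟶ N) where
  one_smul f := by
    apply mod_hom_ext; intro W m; rw [smul_apply, map_one, one_smul]
  mul_smul r s f := by
    apply mod_hom_ext; intro W m; simp only [smul_apply, map_mul, mul_smul]
  smul_zero r := by
    apply mod_hom_ext; intro W m; exact smul_zero (A := N.val.obj W) (A.scalar W r)
  smul_add r f g := by
    apply mod_hom_ext; intro W m
    exact smul_add (A.scalar W r) (f.val.app W m) (g.val.app W m)
  add_smul r s f := by
    apply mod_hom_ext; intro W m
    refine (congrArg (· • f.val.app W m) (map_add (A.scalar W) r s)).trans ?_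
    exact add_smul (A.scalar W r) (A.scalar W s) (f.val.app W m)
  zero_smul f := by
    apply mod_hom_ext; intro W m
    refine (congrArg (· • f.val.app W m) (map_zero (A.scalar W))).trans ?_
    exact zero_smul _ (f.val.app W m)

noncomputable instance : Linear (O.obj.obj (op U)) (A.Mod U) where
  smul_comp M N K r f g := by
    apply mod_hom_ext; intro W m
    exact (g.val.app W).hom.map_smul (A.scalar W r) (f.val.app W m)
  comp_smul M N K f r g := rfl

variable (A)

/-- The `O`-stack of `A`-modules `U ↦ Mod(A|_U)`, with the natural restriction functors. -/
noncomputable def modPrestack : LinearPrestack.{u, u + 1} O where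
  obj U := A.Mod U
  res h := SheafOfModules.overMap A.ring (homOfLE h)
  resId U := NatIso.ofComponents
    (fun M => (SheafOfModules.fullyFaithfulForget _).preimageIso
      (PresheafOfModules.isoMk (fun W => Iso.refl _)))
  resComp h k := NatIso.ofComponents
    (fun M => (SheafOfModules.fullyFaithfulForget _).preimageIso
      (PresheafOfModules.isoMk (fun W => Iso.refl _)))
  resComp_assoc h k l M := by apply mod_hom_ext; intro W m; rfl
  resComp_id_left h M := by apply mod_hom_ext; intro W m; rfl
  resComp_id_right h M := by apply mod_hom_ext; intro W m; rfl
  res_add h F G f g := rfl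
  res_smul h r F G f := by
    apply mod_hom_ext; intro W m
    have : A.scalar ((Over.map (homOfLE h)).op.obj W) r =
        A.scalar W (O.obj.map (homOfLE h).op r) := by
      change A.unit _ _ = A.unit _ (O.obj.map W.unop.hom.op (O.obj.map (homOfLE h).op r))
      rw [← ConcreteCategory.comp_apply, ← O.obj.map_comp]
      rfl
    exact congrArg (· • f.val.app ((Over.map (homOfLE h)).op.obj W) m) this


variable {A}

noncomputable instance instAlgebra (U : (Opens X)ᵒᵖ) :
    Algebra (O.obj.obj U) (A.ring.obj.obj U) :=
  RingHom.toAlgebra' (A.unit U) (A.unit_comm U)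

lemma algebraMap_eq (U : (Opens X)ᵒᵖ) : algebraMap (O.obj.obj U) (A.ring.obj.obj U) = A.unit U := rfl

variable (A)

/-- The opposite algebra `Aᵒᵖ`. -/
def op : SheafAlgebra O where
  ring :=
    { obj :=
        { obj := fun U => RingCat.of (A.ring.obj.obj U)ᵐᵒᵖ
          map := fun f => RingCat.ofHom (RingHom.op (A.ring.obj.map f).hom)
          map_id := by intro U; ext x; simp
          map_comp := by intro U V W f g; ext x; simp }
      property := by
        rw [Presheaf.isSheaf_iff_isSheaf_forget _ _ (forget RingCat.{u})]
        refine (Presheaf.isSheaf_of_iso_iff (NatIso.ofComponents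
          (fun U => (MulOpposite.opEquiv (α := A.ring.obj.obj U)).symm.toIso)
          (by intros; rfl))).2
          ((Presheaf.isSheaf_iff_isSheaf_forget _ _ (forget RingCat.{u})).1 A.ring.property) }
  structureMap :=
    { app := fun U => RingCat.ofHom
        ((A.unit U).toOpposite (fun x y => by
          exact A.unit_comm U x _))
      naturality := by
        intro U V f
        ext r
        exact congrArg MulOpposite.op (A.unit_map f r) }
  central U r a := by
    apply MulOpposite.unop_injective
    exact (A.unit_comm U r a.unop).symm

end SheafAlgebra

section
open scoped TensorProduct
/-- The ring homomorphism `S ⊗_R T → S' ⊗_R' T'`, `s ⊗ t ↦ fS(s) ⊗ fT(t)`. -/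
noncomputable def tensorRingMap {R S T R' S' T' : Type*} [CommRing R] [Ring S] [Ring T] [Algebra R S]
    [Algebra R T] [CommRing R'] [Ring S'] [Ring T'] [Algebra R' S'] [Algebra R' T']
    (fR : R →+* R') (fS : S →+* S') (fT : T →+* T')
    (hS : ∀ r, fS (algebraMap R S r) = algebraMap R' S' (fR r))
    (hT : ∀ r, fT (algebraMap R T r) = algebraMap R' T' (fR r)) :
    S ⊗[R] T →+* S' ⊗[R'] T' :=
  letI : Algebra R (S' ⊗[R'] T') :=
    ((algebraMap R' (S' ⊗[R'] T')).comp fR).toAlgebra' (fun r x => Algebra.commutes (fR r) x)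
  (Algebra.TensorProduct.lift (R := R) (S := R) (A := S) (B := T) (C := S' ⊗[R'] T')
    { (Algebra.TensorProduct.includeLeftRingHom : S' →+* S' ⊗[R'] T').comp fS with
      commutes' := fun r => by
        change fS (algebraMap R S r) ⊗ₜ[R'] (1 : T') = algebraMap R' S' (fR r) ⊗ₜ[R'] (1 : T')
        rw [hS] }
    { (Algebra.TensorProduct.includeRight : T' →ₐ[R'] S' ⊗[R'] T').toRingHom.comp fT with
      commutes' := fun r => by
        change (1 : S') ⊗ₜ[R'] fT (algebraMap R T r) = algebraMap R' S' (fR r) ⊗ₜ[R'] (1 : T')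
        rw [hT, Algebra.TensorProduct.tmul_one_eq_one_tmul] }
    (fun x y => by
      change fS x ⊗ₜ[R'] (1 : T') * (1 : S') ⊗ₜ[R'] fT y =
        (1 : S') ⊗ₜ[R'] fT y * fS x ⊗ₜ[R'] (1 : T')
      simp)).toRingHom

@[simp]
lemma tensorRingMap_tmul {R S T R' S' T' : Type*} [CommRing R] [Ring S] [Ring T] [Algebra R S]
    [Algebra R T] [CommRing R'] [Ring S'] [Ring T'] [Algebra R' S'] [Algebra R' T']
    (fR : R →+* R') (fS : S →+* S') (fT : T →+* T')
    (hS : ∀ r, fS (algebraMap R S r) = algebraMap R' S' (fR r))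
    (hT : ∀ r, fT (algebraMap R T r) = algebraMap R' T' (fR r)) (s : S) (t : T) :
    tensorRingMap fR fS fT hS hT (s ⊗ₜ t) = fS s ⊗ₜ fT t := by
  change fS s ⊗ₜ[R'] (1 : T') * (1 : S') ⊗ₜ[R'] fT t = _
  simp
end

namespace SheafAlgebra
open scoped TensorProduct

variable (A B : SheafAlgebra O)

/-- The presheaf of rings `U ↦ A(U) ⊗_{O(U)} B(U)`. -/
noncomputable def tensorPresheaf : (Opens X)ᵒᵖ ⥤ RingCat.{u} where
  obj U := RingCat.of (A.ring.obj.obj U ⊗[O.obj.obj U] B.ring.obj.obj U)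
  map f := RingCat.ofHom (tensorRingMap (O.obj.map f).hom (A.ring.obj.map f).hom
    (B.ring.obj.map f).hom (fun r => (A.unit_map f r).symm) (fun r => (B.unit_map f r).symm))
  map_id U := by
    ext x
    · simp
    · simp
  map_comp f g := by
    ext x
    · simp
    · simp

lemma tensorPresheaf_map_tmul {U V : (Opens X)ᵒᵖ} (f : U ⟶ V) (a : A.ring.obj.obj U)
    (b : B.ring.obj.obj U) :
    (tensorPresheaf A B).map f (a ⊗ₜ[O.obj.obj U] b : A.ring.obj.obj U ⊗[O.obj.obj U] B.ring.obj.obj U) =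
      (A.ring.obj.map f a ⊗ₜ[O.obj.obj V] B.ring.obj.map f b :
        A.ring.obj.obj V ⊗[O.obj.obj V] B.ring.obj.obj V) :=
  tensorRingMap_tmul (O.obj.map f).hom (A.ring.obj.map f).hom (B.ring.obj.map f).hom
    (fun r => (A.unit_map f r).symm) (fun r => (B.unit_map f r).symm) a b

/-- The structure morphism of `A ⊗ B` at the level of presheaves. -/
noncomputable def tensorPresheafUnit :
    O.obj ⋙ forget₂ CommRingCat.{u} RingCat.{u} ⟶ tensorPresheaf A B where
  app U := RingCat.ofHom (algebraMap (O.obj.obj U)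
    (A.ring.obj.obj U ⊗[O.obj.obj U] B.ring.obj.obj U))
  naturality U V f := by
    ext r
    refine Eq.trans ?_ (tensorPresheaf_map_tmul A B f (A.unit U r) 1).symm
    rw [map_one]
    exact congrArg (· ⊗ₜ 1) (A.unit_map f r)

/-- The `O`-algebra `A ⊗_O B`: the sheaf associated with `U ↦ A(U) ⊗_{O(U)} B(U)`. -/
noncomputable def tensor : SheafAlgebra O where
  ring := (presheafToSheaf (Opens.grothendieckTopology X) RingCat.{u}).obj (tensorPresheaf A B)
  structureMap := tensorPresheafUnit A B ≫
    toSheafify (Opens.grothendieckTopology X) (tensorPresheaf A B)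
  central U r t := by
    let J := Opens.grothendieckTopology X
    let P := tensorPresheaf A B
    let η := toSheafify J P
    apply ((presheafToSheaf J RingCat.{u}).obj P).property.isSeparated _ _
      (Presheaf.imageSieve_mem J η t)
    rintro V f ⟨p, hp⟩
    rw [map_mul, map_mul]
    have h : ((presheafToSheaf J RingCat.{u}).obj P).obj.map f.op
        (((tensorPresheafUnit A B ≫ η).app U).hom r) =
        (η.app (Opposite.op V)).hom (((tensorPresheafUnit A B).app (Opposite.op V)).hom
          (O.obj.map f.op r)) :=
      (ConcreteCategory.congr_hom ((tensorPresheafUnit A B ≫ η).naturality f.op) r).symm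
    have hp' : ((presheafToSheaf J RingCat.{u}).obj P).obj.map f.op t =
      (η.app (Opposite.op V)).hom p := hp.symm
    have hc : ((tensorPresheafUnit A B).app (Opposite.op V)).hom (O.obj.map f.op r) * p =
        p * ((tensorPresheafUnit A B).app (Opposite.op V)).hom (O.obj.map f.op r) :=
      Algebra.commutes (R := O.obj.obj (Opposite.op V))
        (A := A.ring.obj.obj (Opposite.op V) ⊗[O.obj.obj (Opposite.op V)]
          B.ring.obj.obj (Opposite.op V)) _ _
    refine (congrArg₂ (· * ·) h hp').trans (Eq.trans ?_ (congrArg₂ (· * ·) hp' h).symm)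
    exact ((map_mul (η.app (Opposite.op V)).hom _ _).symm.trans
      (congrArg (η.app (Opposite.op V)).hom hc)).trans (map_mul (η.app (Opposite.op V)).hom _ _)

/-- The morphism `A → A ⊗ B`, `a ↦ a ⊗ 1`. -/
noncomputable def tensorLeft : A.ring ⟶ (tensor A B).ring where
  hom :=
    { app := fun U => RingCat.ofHom (Algebra.TensorProduct.includeLeftRingHom :
        A.ring.obj.obj U →+* A.ring.obj.obj U ⊗[O.obj.obj U] B.ring.obj.obj U)
      naturality := by
        intro U V f
        ext a
        refine Eq.trans ?_ (tensorPresheaf_map_tmul A B f a 1).symm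
        rw [map_one]
        rfl } ≫
      toSheafify (Opens.grothendieckTopology X) (tensorPresheaf A B)

/-- The morphism `B → A ⊗ B`, `b ↦ 1 ⊗ b`. -/
noncomputable def tensorRight : B.ring ⟶ (tensor A B).ring where
  hom :=
    { app := fun U => RingCat.ofHom (Algebra.TensorProduct.includeRight :
        B.ring.obj.obj U →ₐ[O.obj.obj U] A.ring.obj.obj U ⊗[O.obj.obj U] B.ring.obj.obj U).toRingHom
      naturality := by
        intro U V f
        ext b
        refine Eq.trans ?_ (tensorPresheaf_map_tmul A B f 1 b).symm
        rw [map_one]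
        rfl } ≫
      toSheafify (Opens.grothendieckTopology X) (tensorPresheaf A B)

lemma tensorLeft_tensorRight_comm (U : (Opens X)ᵒᵖ) (a : A.ring.obj.obj U) (b : B.ring.obj.obj U) :
    (tensorLeft A B).hom.app U a * (tensorRight A B).hom.app U b =
      (tensorRight A B).hom.app U b * (tensorLeft A B).hom.app U a := by
  let η := toSheafify (Opens.grothendieckTopology X) (tensorPresheaf A B)
  have hc : ((a ⊗ₜ[O.obj.obj U] 1 : A.ring.obj.obj U ⊗[O.obj.obj U] B.ring.obj.obj U)) * 1 ⊗ₜ b =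
      1 ⊗ₜ b * a ⊗ₜ 1 := by simp
  exact ((map_mul (η.app U).hom _ _).symm.trans
      (congrArg (η.app U).hom hc)).trans (map_mul (η.app U).hom _ _)

end SheafAlgebra

section BalancedTensor

open scoped TensorProduct

variable {T B : Type*} [Ring T] [Ring B] (g : Bᵐᵒᵖ →+* T)
  (L : Type*) [AddCommGroup L] [Module T L] (N : Type*) [AddCommGroup N] [Module B N]

/-- The subgroup of `L ⊗_ℤ N` generated by the elements `l b ⊗ n - l ⊗ b n`, where the right
action of `b` on `L` is the action of `g (op b)`. -/
def balancedRel : AddSubgroup (L ⊗[ℤ] N) :=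
  AddSubgroup.closure {x | ∃ (l : L) (b : B) (n : N),
    x = (g (MulOpposite.op b) • l) ⊗ₜ[ℤ] n - l ⊗ₜ[ℤ] (b • n)}

/-- The abelian group `L ⊗_B N`. -/
def BalancedTensor : Type _ := (L ⊗[ℤ] N) ⧸ balancedRel g L N

instance : AddCommGroup (BalancedTensor g L N) :=
  inferInstanceAs (AddCommGroup ((L ⊗[ℤ] N) ⧸ balancedRel g L N))

namespace BalancedTensor

variable {L N}

/-- The class of `l ⊗ n` in `L ⊗_B N`. -/
def tmul (l : L) (n : N) : BalancedTensor g L N := QuotientAddGroup.mk (l ⊗ₜ[ℤ] n)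

lemma tmul_balanced (l : L) (b : B) (n : N) :
    tmul g (g (MulOpposite.op b) • l) n = tmul g l (b • n) := by
  refine (QuotientAddGroup.eq_iff_sub_mem).2 ?_
  exact AddSubgroup.subset_closure ⟨l, b, n, rfl⟩

lemma zero_tmul (n : N) : tmul g (0 : L) n = 0 :=
  congrArg (QuotientAddGroup.mk (s := balancedRel g L N)) (TensorProduct.zero_tmul L n)

lemma tmul_zero (l : L) : tmul g l (0 : N) = 0 :=
  congrArg (QuotientAddGroup.mk (s := balancedRel g L N)) (TensorProduct.tmul_zero N l)

lemma add_tmul (l l' : L) (n : N) : tmul g (l + l') n = tmul g l n + tmul g l' n :=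
  congrArg (QuotientAddGroup.mk (s := balancedRel g L N)) (TensorProduct.add_tmul l l' n)

lemma tmul_add (l : L) (n n' : N) : tmul g l (n + n') = tmul g l n + tmul g l n' :=
  congrArg (QuotientAddGroup.mk (s := balancedRel g L N)) (TensorProduct.tmul_add l n n')

variable {g}

@[elab_as_elim]
lemma induction_on {p : BalancedTensor g L N → Prop} (x : BalancedTensor g L N)
    (zero : p 0) (tmul : ∀ l n, p (tmul g l n)) (add : ∀ x y, p x → p y → p (x + y)) : p x := by
  obtain ⟨x, rfl⟩ := QuotientAddGroup.mk_surjective x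
  induction x using TensorProduct.induction_on with
  | zero => exact zero
  | tmul l n => exact tmul l n
  | add x y hx hy => exact add _ _ hx hy

lemma addHom_ext {C : Type*} [AddZeroClass C] {φ ψ : BalancedTensor g L N →+ C}
    (h : ∀ l n, φ (tmul g l n) = ψ (tmul g l n)) : φ = ψ := by
  ext x
  induction x using BalancedTensor.induction_on with
  | zero => simp
  | tmul l n => exact h l n
  | add x y hx hy => rw [map_add, map_add, hx, hy]

/-- The map `l ⊗ n ↦ α l ⊗ β n`, for `α` and `β` compatible with the actions of `B`. -/
def map {T' B' : Type*} [Ring T'] [Ring B'] {g' : B'ᵐᵒᵖ →+* T'}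
    {L' : Type*} [AddCommGroup L'] [Module T' L'] {N' : Type*} [AddCommGroup N'] [Module B' N']
    (γ : B → B') (α : L →+ L') (β : N →+ N')
    (hα : ∀ b l, α (g (MulOpposite.op b) • l) = g' (MulOpposite.op (γ b)) • α l)
    (hβ : ∀ b n, β (b • n) = γ b • β n) :
    BalancedTensor g L N →+ BalancedTensor g' L' N' :=
  QuotientAddGroup.map _ _
    (TensorProduct.map α.toIntLinearMap β.toIntLinearMap).toAddMonoidHom (by
      refine (AddSubgroup.closure_le _).2 ?_
      rintro _ ⟨l, b, n, rfl⟩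
      refine AddSubgroup.subset_closure ⟨α l, γ b, β n, ?_⟩
      simp [hα, hβ])

@[simp]
lemma map_tmul {T' B' : Type*} [Ring T'] [Ring B'] {g' : B'ᵐᵒᵖ →+* T'}
    {L' : Type*} [AddCommGroup L'] [Module T' L'] {N' : Type*} [AddCommGroup N'] [Module B' N']
    (γ : B → B') (α : L →+ L') (β : N →+ N')
    (hα : ∀ b l, α (g (MulOpposite.op b) • l) = g' (MulOpposite.op (γ b)) • α l)
    (hβ : ∀ b n, β (b • n) = γ b • β n) (l : L) (n : N) :
    map (g' := g') γ α β hα hβ (tmul g l n) = tmul g' (α l) (β n) := rfl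

/-- The endomorphisms `l ⊗ n ↦ f(a) l ⊗ n` of `L ⊗_B N`. -/
def actionHom (g : Bᵐᵒᵖ →+* T) (N : Type*) [AddCommGroup N] [Module B N] {A : Type*} [Ring A]
    (f : A →+* T) (hfg : ∀ a b, f a * g b = g b * f a) :
    A →+* AddMonoid.End (BalancedTensor g L N) where
  toFun a := map (g' := g) _root_.id (DistribSMul.toAddMonoidHom L (f a)) (AddMonoidHom.id N)
    (fun b l => by simp [smul_smul, hfg]) (fun b n => rfl)
  map_one' := addHom_ext (fun l n => by
    change tmul g (f 1 • l) n = tmul g l n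
    rw [map_one, one_smul])
  map_mul' a b := addHom_ext (fun l n => by
    change tmul g (f (a * b) • l) n = tmul g (f a • f b • l) n
    rw [map_mul, mul_smul])
  map_zero' := addHom_ext (fun l n => by
    change tmul g (f 0 • l) n = 0
    rw [map_zero, zero_smul, zero_tmul])
  map_add' a b := addHom_ext (fun l n => by
    change tmul g (f (a + b) • l) n = tmul g (f a • l) n + tmul g (f b • l) n
    rw [map_add, add_smul, add_tmul])

/-- The left action of `A` on `L ⊗_B N`, when `L` is a left module over `T`, `f : A → T`
and the images of `f` and `g : Bᵒᵖ → T` commute: `a (l ⊗ n) = f(a) l ⊗ n`. -/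
@[reducible]
def module (g : Bᵐᵒᵖ →+* T) (L : Type*) [AddCommGroup L] [Module T L]
    (N : Type*) [AddCommGroup N] [Module B N] {A : Type*} [Ring A]
    (f : A →+* T) (hfg : ∀ a b, f a * g b = g b * f a) : Module A (BalancedTensor g L N) :=
  Module.compHom _ (actionHom g N f hfg : A →+* AddMonoid.End (BalancedTensor g L N))

end BalancedTensor

end BalancedTensor

namespace SheafAlgebra

variable {A B : SheafAlgebra O} {U : Opens X}

/-- The morphism `A(W) → (A ⊗ Bᵒᵖ)(W)`. -/
noncomputable def leftHom (A B : SheafAlgebra O) (W : (Over U)ᵒᵖ) :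
    (A.ring.over U).obj.obj W →+* ((A.tensor B.op).ring.over U).obj.obj W :=
  ((tensorLeft A B.op).hom.app (Opposite.op W.unop.left)).hom

/-- The morphism `B(W)ᵒᵖ → (A ⊗ Bᵒᵖ)(W)`. -/
noncomputable def rightHom (A B : SheafAlgebra O) (W : (Over U)ᵒᵖ) :
    ((B.ring.over U).obj.obj W)ᵐᵒᵖ →+* ((A.tensor B.op).ring.over U).obj.obj W :=
  ((tensorRight A B.op).hom.app (Opposite.op W.unop.left)).hom

lemma leftHom_rightHom_comm (W : (Over U)ᵒᵖ) (a : (A.ring.over U).obj.obj W)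
    (b : ((B.ring.over U).obj.obj W)ᵐᵒᵖ) :
    leftHom A B W a * rightHom A B W b = rightHom A B W b * leftHom A B W a :=
  tensorLeft_tensorRight_comm A B.op _ a b

lemma leftHom_map {W W' : (Over U)ᵒᵖ} (i : W ⟶ W') (a : (A.ring.over U).obj.obj W) :
    ((A.tensor B.op).ring.over U).obj.map i (leftHom A B W a) =
      leftHom A B W' ((A.ring.over U).obj.map i a) :=
  (ConcreteCategory.congr_hom ((tensorLeft A B.op).hom.naturality i.unop.left.op) a).symm

lemma rightHom_map {W W' : (Over U)ᵒᵖ} (i : W ⟶ W') (b : (B.ring.over U).obj.obj W) :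
    ((A.tensor B.op).ring.over U).obj.map i (rightHom A B W (MulOpposite.op b)) =
      rightHom A B W' (MulOpposite.op ((B.ring.over U).obj.map i b)) :=
  (ConcreteCategory.congr_hom ((tensorRight A B.op).hom.naturality i.unop.left.op)
    (MulOpposite.op b)).symm

/-- The abelian group `L(W) ⊗_{B(W)} N(W)`. -/
abbrev sectionTensor (L : (A.tensor B.op).Mod U) (N : B.Mod U) (W : (Over U)ᵒᵖ) : Type u :=
  BalancedTensor (rightHom A B W) (L.val.obj W) (N.val.obj W)

/-- The presheaf of abelian groups `W ↦ L(W) ⊗_{B(W)} N(W)`. -/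
noncomputable def presheafTensorAb (L : (A.tensor B.op).Mod U) (N : B.Mod U) :
    (Over U)ᵒᵖ ⥤ AddCommGrpCat.{u} where
  obj W := AddCommGrpCat.of (sectionTensor L N W)
  map {W W'} i := AddCommGrpCat.ofHom (BalancedTensor.map
    (L' := L.val.obj W') (N' := N.val.obj W') (g' := rightHom A B W')
    ((B.ring.over U).obj.map i).hom
    (L.val.presheaf.map i).hom (N.val.presheaf.map i).hom
    (fun b l => by
      refine (L.val.map_smul i _ l).trans ?_
      exact congrArg (· • (L.val.map i l : L.val.obj W')) (rightHom_map i b))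
    (fun b n => N.val.map_smul i b n))
  map_id W := by
    apply AddCommGrpCat.hom_ext
    refine BalancedTensor.addHom_ext (fun l n => ?_)
    exact congrArg₂ (BalancedTensor.tmul (rightHom A B W))
      (ConcreteCategory.congr_hom (L.val.presheaf.map_id W) l)
      (ConcreteCategory.congr_hom (N.val.presheaf.map_id W) n)
  map_comp {W W' W''} i j := by
    apply AddCommGrpCat.hom_ext
    refine BalancedTensor.addHom_ext (fun l n => ?_)
    exact congrArg₂ (BalancedTensor.tmul (rightHom A B W''))
      (ConcreteCategory.congr_hom (L.val.presheaf.map_comp i j) l)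
      (ConcreteCategory.congr_hom (N.val.presheaf.map_comp i j) n)

noncomputable instance (L : (A.tensor B.op).Mod U) (N : B.Mod U) (W : (Over U)ᵒᵖ) :
    Module ((A.ring.over U).obj.obj W) ((presheafTensorAb L N).obj W) :=
  BalancedTensor.module (rightHom A B W) (L.val.obj W) (N.val.obj W) (leftHom A B W)
    (leftHom_rightHom_comm W)

/-- The presheaf of `A|_U`-modules `W ↦ L(W) ⊗_{B(W)} N(W)`, where
`a (l ⊗ n) = ((a ⊗ 1) l) ⊗ n`. -/
noncomputable def presheafTensor (L : (A.tensor B.op).Mod U) (N : B.Mod U) :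
    PresheafOfModules.{u} (A.ring.over U).obj :=
  PresheafOfModules.ofPresheaf (presheafTensorAb L N) (by
    intro W W' i a (x : sectionTensor L N W)
    induction x using BalancedTensor.induction_on with
    | zero =>
      refine (congrArg _ (smul_zero (A := (presheafTensorAb L N).obj W) a)).trans ?_
      refine ((map_zero _).trans ?_).trans (congrArg _ (map_zero _)).symm
      exact (smul_zero (A := (presheafTensorAb L N).obj W') _).symm
    | tmul l n =>
      refine congrArg (BalancedTensor.tmul (rightHom A B W') · (N.val.map i n : N.val.obj W')) ?_
      refine (L.val.map_smul i (leftHom A B W a) l).trans ?_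
      exact congrArg (· • (L.val.map i l : L.val.obj W')) (leftHom_map i a)
    | add x y hx hy =>
      refine (congrArg _ (smul_add (A := (presheafTensorAb L N).obj W) a x y)).trans ?_
      refine ((map_add _ _ _).trans ?_).trans (congrArg _ (map_add _ _ _)).symm
      refine Eq.trans ?_ (smul_add (A := (presheafTensorAb L N).obj W') _ _ _).symm
      exact congrArg₂ (· + ·) hx hy)

/-- The sheaf of `A|_U`-modules `L ⊗_B N` associated with `W ↦ L(W) ⊗_{B(W)} N(W)`. -/
noncomputable def sheafTensor (L : (A.tensor B.op).Mod U) (N : B.Mod U) : A.Mod U :=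
  (PresheafOfModules.sheafification (𝟙 (A.ring.over U).obj)).obj (presheafTensor L N)

/-- The section `l ⊗ n` of `L ⊗_B N`. -/
noncomputable def tmul {L : (A.tensor B.op).Mod U} {N : B.Mod U} {W : (Over U)ᵒᵖ}
    (l : L.val.obj W) (n : N.val.obj W) : (sheafTensor L N).val.obj W :=
  (toSheafify ((Opens.grothendieckTopology X).over U) (presheafTensor L N).presheaf).app W
    (BalancedTensor.tmul (rightHom A B W) l n)

lemma map_tmul {L : (A.tensor B.op).Mod U} {N : B.Mod U} {W W' : (Over U)ᵒᵖ} (i : W ⟶ W')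
    (l : L.val.obj W) (n : N.val.obj W) :
    (sheafTensor L N).val.map i (tmul l n) =
      (tmul (L.val.map i l : L.val.obj W') (N.val.map i n : N.val.obj W') :
        (sheafTensor L N).val.obj W') :=
  (ConcreteCategory.congr_hom ((toSheafify ((Opens.grothendieckTopology X).over U)
    (presheafTensor L N).presheaf).naturality i)
    (BalancedTensor.tmul (rightHom A B W) l n : sectionTensor L N W)).symm

/-- The morphism `L ⊗_B N → M` induced by a morphism from the presheaf tensor product. -/
noncomputable def sheafTensorLift {L : (A.tensor B.op).Mod U} {N : B.Mod U} {M : A.Mod U}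
    (f : presheafTensor L N ⟶ M.val) : sheafTensor L N ⟶ M :=
  (PresheafOfModules.sheafificationHomEquiv (𝟙 (A.ring.over U).obj)).symm f

lemma sheafTensorLift_tmul {L : (A.tensor B.op).Mod U} {N : B.Mod U} {M : A.Mod U}
    (f : presheafTensor L N ⟶ M.val) {W : (Over U)ᵒᵖ} (l : L.val.obj W) (n : N.val.obj W) :
    (sheafTensorLift f).val.app W (tmul l n) =
      f.app W (BalancedTensor.tmul (rightHom A B W) l n : sectionTensor L N W) := by
  have h := PresheafOfModules.toPresheaf_map_sheafificationHomEquiv_def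
    (𝟙 (A.ring.over U).obj) (sheafTensorLift f)
  replace h := (congrArg (PresheafOfModules.toPresheaf _).map ((PresheafOfModules.sheafificationHomEquiv
    (𝟙 (A.ring.over U).obj)).apply_symm_apply f)).symm.trans h
  exact (ConcreteCategory.congr_hom (NatTrans.congr_app h W)
    (BalancedTensor.tmul (rightHom A B W) l n : sectionTensor L N W)).symm

lemma sheafTensor_hom_ext {L : (A.tensor B.op).Mod U} {N : B.Mod U} {M : A.Mod U}
    {f g : sheafTensor L N ⟶ M}
    (h : ∀ (W : (Over U)ᵒᵖ) (l : L.val.obj W) (n : N.val.obj W),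
      f.val.app W (tmul l n) = g.val.app W (tmul l n)) : f = g := by
  apply (PresheafOfModules.sheafificationHomEquiv (𝟙 (A.ring.over U).obj)).injective
  apply (PresheafOfModules.toPresheaf _).map_injective
  refine (PresheafOfModules.toPresheaf_map_sheafificationHomEquiv_def _ f).trans
    (Eq.trans ?_ (PresheafOfModules.toPresheaf_map_sheafificationHomEquiv_def _ g).symm)
  apply NatTrans.ext
  funext W
  apply AddCommGrpCat.hom_ext
  exact BalancedTensor.addHom_ext (fun l n => h W l n)

/-- The morphism `f ⊗ g` of presheaves. -/
noncomputable def presheafTensorMap {L L' : (A.tensor B.op).Mod U} {N N' : B.Mod U}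
    (f : L ⟶ L') (g : N ⟶ N') : presheafTensor L N ⟶ presheafTensor L' N' :=
  PresheafOfModules.homMk
    { app := fun W => AddCommGrpCat.ofHom (BalancedTensor.map (g' := rightHom A B W)
        (L' := L'.val.obj W) (N' := N'.val.obj W) _root_.id
        (f.val.app W).hom.toAddMonoidHom (g.val.app W).hom.toAddMonoidHom
        (fun b l => (f.val.app W).hom.map_smul _ l) (fun b n => (g.val.app W).hom.map_smul b n))
      naturality := by
        intro W W' i
        apply AddCommGrpCat.hom_ext
        refine BalancedTensor.addHom_ext (fun l n => ?_)
        exact congrArg₂ (BalancedTensor.tmul (rightHom A B W'))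
          (PresheafOfModules.naturality_apply f.val i l)
          (PresheafOfModules.naturality_apply g.val i n) }
    (by
      intro W a (x : sectionTensor L N W)
      induction x using BalancedTensor.induction_on with
      | zero =>
        refine (congrArg _ (smul_zero (A := (presheafTensorAb L N).obj W) a)).trans ?_
        refine ((map_zero _).trans ?_).trans (congrArg _ (map_zero _)).symm
        exact (smul_zero (A := (presheafTensorAb L' N').obj W) _).symm
      | tmul l n =>
        exact congrArg (BalancedTensor.tmul (rightHom A B W) · (g.val.app W n : N'.val.obj W))
          ((f.val.app W).hom.map_smul (leftHom A B W a) l)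
      | add x y hx hy =>
        refine (congrArg _ (smul_add (A := (presheafTensorAb L N).obj W) a x y)).trans ?_
        refine ((map_add _ _ _).trans ?_).trans (congrArg _ (map_add _ _ _)).symm
        refine Eq.trans ?_ (smul_add (A := (presheafTensorAb L' N').obj W) _ _ _).symm
        exact congrArg₂ (· + ·) hx hy)

/-- The morphism `f ⊗ g : L ⊗_B N ⟶ L' ⊗_B N'`. -/
noncomputable def sheafTensorMap {L L' : (A.tensor B.op).Mod U} {N N' : B.Mod U}
    (f : L ⟶ L') (g : N ⟶ N') : sheafTensor L N ⟶ sheafTensor L' N' :=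
  (PresheafOfModules.sheafification (𝟙 (A.ring.over U).obj)).map (presheafTensorMap f g)

lemma sheafTensorMap_tmul {L L' : (A.tensor B.op).Mod U} {N N' : B.Mod U}
    (f : L ⟶ L') (g : N ⟶ N') {W : (Over U)ᵒᵖ} (l : L.val.obj W) (n : N.val.obj W) :
    (sheafTensorMap f g).val.app W (tmul l n) = tmul (f.val.app W l) (g.val.app W n) :=
  (ConcreteCategory.congr_hom (NatTrans.congr_app (toSheafify_naturality
    ((Opens.grothendieckTopology X).over U)
    ((PresheafOfModules.toPresheaf _).map (presheafTensorMap f g))) W)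
    (BalancedTensor.tmul (rightHom A B W) l n : sectionTensor L N W)).symm

lemma sheafTensorMap_id (L : (A.tensor B.op).Mod U) (N : B.Mod U) :
    sheafTensorMap (𝟙 L) (𝟙 N) = 𝟙 _ :=
  sheafTensor_hom_ext (fun _ l n => sheafTensorMap_tmul _ _ l n)

lemma sheafTensorMap_comp {L L' L'' : (A.tensor B.op).Mod U} {N N' N'' : B.Mod U}
    (f : L ⟶ L') (f' : L' ⟶ L'') (g : N ⟶ N') (g' : N' ⟶ N'') :
    sheafTensorMap (f ≫ f') (g ≫ g') = sheafTensorMap f g ≫ sheafTensorMap f' g' :=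
  sheafTensor_hom_ext (fun W l n => by
    refine (sheafTensorMap_tmul _ _ l n).trans ?_
    refine Eq.trans ?_ (congrArg ((sheafTensorMap f' g').val.app W)
      (sheafTensorMap_tmul f g l n)).symm
    exact (sheafTensorMap_tmul f' g' _ _).symm)

/-- The functor `L ⊗_B (·)` from `B|_U`-modules to `A|_U`-modules. -/
noncomputable def tensorFunctor (L : (A.tensor B.op).Mod U) : B.Mod U ⥤ A.Mod U where
  obj N := sheafTensor L N
  map g := sheafTensorMap (𝟙 L) g
  map_id N := sheafTensorMap_id L N
  map_comp g g' := by rw [← sheafTensorMap_comp, Category.comp_id]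

/-- The restriction functor `Mod(A|_U) → Mod(A|_V)`. -/
noncomputable abbrev restrict (A : SheafAlgebra O) {U V : Opens X} (h : V ≤ U) :
    A.Mod U ⥤ A.Mod V := A.modPrestack.res h

/-- The canonical morphism from the presheaf tensor product to the sheaf `L ⊗_B N`. -/
noncomputable def presheafTensorUnit (L : (A.tensor B.op).Mod U) (N : B.Mod U) :
    presheafTensor L N ⟶ (sheafTensor L N).val :=
  PresheafOfModules.sheafificationHomEquiv (𝟙 (A.ring.over U).obj) (𝟙 (sheafTensor L N))

lemma presheafTensorUnit_tmul {L : (A.tensor B.op).Mod U} {N : B.Mod U} {W : (Over U)ᵒᵖ}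
    (l : L.val.obj W) (n : N.val.obj W) : (presheafTensorUnit L N).app W
    (BalancedTensor.tmul (rightHom A B W) l n : sectionTensor L N W) = tmul l n := rfl

/-- The canonical morphism from the presheaf tensor product of `L|_V` and `N|_V` to
`(L ⊗_B N)|_V`. -/
noncomputable def presheafTensorRestrict {V : Opens X} (h : V ≤ U) (L : (A.tensor B.op).Mod U)
    (N : B.Mod U) :
    presheafTensor (((A.tensor B.op).restrict h).obj L) ((B.restrict h).obj N) ⟶
      ((A.restrict h).obj (sheafTensor L N)).val :=
  PresheafOfModules.homMk
    { app := fun W =>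
        ((PresheafOfModules.toPresheaf _).map (presheafTensorUnit L N)).app
          ((Over.map (homOfLE h)).op.obj W)
      naturality := fun W W' i => by
        apply AddCommGrpCat.hom_ext
        refine BalancedTensor.addHom_ext (fun l n => ?_)
        exact (map_tmul ((Over.map (homOfLE h)).op.map i) (L := L) (N := N) l n).symm }
    (fun W a x => ((presheafTensorUnit L N).app ((Over.map (homOfLE h)).op.obj W)).hom.map_smul a x)

/-- The canonical morphism `L|_V ⊗_B N|_V ⟶ (L ⊗_B N)|_V`. -/
noncomputable def restrictTensorHom {V : Opens X} (h : V ≤ U) (L : (A.tensor B.op).Mod U)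
    (N : B.Mod U) :
    sheafTensor (((A.tensor B.op).restrict h).obj L) ((B.restrict h).obj N) ⟶
      (A.restrict h).obj (sheafTensor L N) :=
  sheafTensorLift (presheafTensorRestrict h L N)

lemma restrictTensorHom_tmul {V : Opens X} (h : V ≤ U) (L : (A.tensor B.op).Mod U)
    (N : B.Mod U) {W : (Over V)ᵒᵖ} (l : (((A.tensor B.op).restrict h).obj L).val.obj W)
    (n : ((B.restrict h).obj N).val.obj W) :
    (restrictTensorHom h L N).val.app W (tmul l n) =
      (tmul (W := (Over.map (homOfLE h)).op.obj W) l n :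
        (sheafTensor L N).val.obj ((Over.map (homOfLE h)).op.obj W)) :=
  sheafTensorLift_tmul (presheafTensorRestrict h L N) l n

lemma isIso_sheafTensorLift {L : (A.tensor B.op).Mod U} {N : B.Mod U} {M : A.Mod U}
    (f : presheafTensor L N ⟶ M.val)
    (hf : ((Opens.grothendieckTopology X).over U).W ((PresheafOfModules.toPresheaf _).map f)) :
    IsIso (sheafTensorLift f) := by
  have h := PresheafOfModules.toSheaf_map_sheafificationHomEquiv_symm
    (𝟙 (A.ring.over U).obj) (F := M) f
  have h1 : IsIso ((SheafOfModules.toSheaf _).map (sheafTensorLift f)) := by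
    refine (congrArg (fun x => IsIso x) h).mpr ?_
    have h2 := (GrothendieckTopology.W_iff _ _).1 hf
    refine (congrArg (fun x => IsIso x) (Adjunction.homEquiv_counit (sheafificationAdjunction
      ((Opens.grothendieckTopology X).over U) AddCommGrpCat.{u}) _ _ _)).mpr ?_
    exact IsIso.comp_isIso' h2 inferInstance
  exact isIso_of_reflects_iso _ (SheafOfModules.toSheaf _)

lemma isLocallyBijective_presheafTensorRestrict {V : Opens X} (h : V ≤ U)
    (L : (A.tensor B.op).Mod U) (N : B.Mod U) :
    Presheaf.IsLocallyInjective ((Opens.grothendieckTopology X).over V)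
      ((PresheafOfModules.toPresheaf _).map (presheafTensorRestrict h L N)) ∧
    Presheaf.IsLocallySurjective ((Opens.grothendieckTopology X).over V)
      ((PresheafOfModules.toPresheaf _).map (presheafTensorRestrict h L N)) := by
  let J := Opens.grothendieckTopology X
  let η := toSheafify (J.over U) (presheafTensor L N).presheaf
  have h1 := Presheaf.isLocallyInjective_whisker (J.over V) (J.over U) (Over.map (homOfLE h)) η
  have h2 := Presheaf.isLocallySurjective_whisker (J.over V) (J.over U) (Over.map (homOfLE h)) η
  let e : (presheafTensor (((A.tensor B.op).restrict h).obj L) ((B.restrict h).obj N)).presheaf ≅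
      (Over.map (homOfLE h)).op ⋙ (presheafTensor L N).presheaf :=
    NatIso.ofComponents (fun W => Iso.refl _) (fun i => by
      apply AddCommGrpCat.hom_ext
      exact BalancedTensor.addHom_ext (fun l n => rfl))
  have he : (PresheafOfModules.toPresheaf _).map (presheafTensorRestrict h L N) =
      e.hom ≫ Functor.whiskerLeft (Over.map (homOfLE h)).op η := by
    apply NatTrans.ext
    funext W
    apply AddCommGrpCat.hom_ext
    exact BalancedTensor.addHom_ext (fun l n => rfl)
  refine (congrArg (fun x => Presheaf.IsLocallyInjective ((Opens.grothendieckTopology X).over V) x ∧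
    Presheaf.IsLocallySurjective ((Opens.grothendieckTopology X).over V) x) he).mpr ?_
  have key : ∀ {F G : (Over V)ᵒᵖ ⥤ AddCommGrpCat.{u}} (a : F ≅ G) {K : (Over V)ᵒᵖ ⥤ AddCommGrpCat.{u}}
      (b : G ⟶ K), Presheaf.IsLocallyInjective (J.over V) b →
      Presheaf.IsLocallySurjective (J.over V) b →
      Presheaf.IsLocallyInjective (J.over V) (a.hom ≫ b) ∧
      Presheaf.IsLocallySurjective (J.over V) (a.hom ≫ b) :=
    fun a K b hb hb' => ⟨inferInstance, inferInstance⟩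
  exact key e _ h1 h2

instance isIso_restrictTensorHom {V : Opens X} (h : V ≤ U) (L : (A.tensor B.op).Mod U) (N : B.Mod U) :
    IsIso (restrictTensorHom h L N) := by
  apply isIso_sheafTensorLift
  rw [GrothendieckTopology.W_iff_isLocallyBijective]
  exact isLocallyBijective_presheafTensorRestrict h L N

/-- The isomorphism `f ⊗ g` for isomorphisms `f` and `g`. -/
noncomputable def sheafTensorMapIso {L L' : (A.tensor B.op).Mod U} {N N' : B.Mod U}
    (f : L ≅ L') (g : N ≅ N') : sheafTensor L N ≅ sheafTensor L' N' where
  hom := sheafTensorMap f.hom g.hom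
  inv := sheafTensorMap f.inv g.inv
  hom_inv_id := by
    rw [← sheafTensorMap_comp, f.hom_inv_id, g.hom_inv_id, sheafTensorMap_id]
  inv_hom_id := by
    rw [← sheafTensorMap_comp, f.inv_hom_id, g.inv_hom_id, sheafTensorMap_id]

/-- The canonical isomorphism `L|_W ⊗_B N|_W ≅ (L|_V ⊗_B N)|_W`, for `L` on `U` and `N` on
`V ⊆ U`. It maps `l ⊗ n` to `l ⊗ n`. -/
noncomputable def tensorRestrictIso {V W : Opens X} (hV : V ≤ U) (k : W ≤ V)
    (L : (A.tensor B.op).Mod U) (N : B.Mod V) :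
    sheafTensor (((A.tensor B.op).restrict (k.trans hV)).obj L) ((B.restrict k).obj N) ≅
      (A.restrict k).obj (sheafTensor (((A.tensor B.op).restrict hV).obj L) N) :=
  sheafTensorMapIso (((A.tensor B.op).modPrestack.resComp hV k).app L).symm (Iso.refl _) ≪≫
    asIso (restrictTensorHom k (((A.tensor B.op).restrict hV).obj L) N)

lemma tensorRestrictIso_tmul {V W : Opens X} (hV : V ≤ U) (k : W ≤ V)
    (L : (A.tensor B.op).Mod U) (N : B.Mod V) {Y : (Over W)ᵒᵖ}
    (l : (((A.tensor B.op).restrict (k.trans hV)).obj L).val.obj Y)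
    (n : ((B.restrict k).obj N).val.obj Y) :
    (tensorRestrictIso hV k L N).hom.val.app Y (tmul l n) =
      (tmul (L := ((A.tensor B.op).restrict hV).obj L) (W := (Over.map (homOfLE k)).op.obj Y) l n :
        (sheafTensor (((A.tensor B.op).restrict hV).obj L) N).val.obj
          ((Over.map (homOfLE k)).op.obj Y)) := by
  refine (congrArg ((restrictTensorHom k (((A.tensor B.op).restrict hV).obj L) N).val.app Y)
    (sheafTensorMap_tmul (((A.tensor B.op).modPrestack.resComp hV k).app L).inv
      (𝟙 ((B.restrict k).obj N)) l n)).trans ?_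
  exact restrictTensorHom_tmul k (((A.tensor B.op).restrict hV).obj L) N _ _

/-- The natural transformation `f ⊗ 1` of functors from `B|_U`-modules to `A|_U`-modules. -/
noncomputable def tensorFunctorMap {L L' : (A.tensor B.op).Mod U} (f : L ⟶ L') :
    tensorFunctor L ⟶ tensorFunctor L' where
  app N := sheafTensorMap f (𝟙 N)
  naturality N N' g := by
    refine (sheafTensorMap_comp (𝟙 L) f g (𝟙 N')).symm.trans ?_
    refine Eq.trans ?_ (sheafTensorMap_comp f (𝟙 L') (𝟙 N) g)
    rw [Category.comp_id, Category.comp_id, Category.id_comp, Category.id_comp]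

/-- The functor `L ⊗_B (·) : Mod(B)|_U → Mod(A)|_U`, for an `A ⊗ Bᵒᵖ`-module `L` on `U`. -/
noncomputable def tensorFunctorOn (L : (A.tensor B.op).Mod U) :
    FunctorOn U B.modPrestack.toPrestack A.modPrestack.toPrestack where
  app V hV := tensorFunctor (((A.tensor B.op).restrict hV).obj L)
  iso hV k := NatIso.ofComponents (fun N => tensorRestrictIso hV k L N) (fun {N N'} g => by
    apply sheafTensor_hom_ext
    intro Y l n
    have h1 : (sheafTensorMap (𝟙 (((A.tensor B.op).restrict (k.trans hV)).obj L))
        ((B.restrict k).map g)).val.app Y (tmul l n) =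
          tmul l (((B.restrict k).map g).val.app Y n) := sheafTensorMap_tmul _ _ l n
    refine (congrArg ((tensorRestrictIso hV k L N').hom.val.app Y) h1).trans ?_
    refine (tensorRestrictIso_tmul hV k L N' l _).trans ?_
    refine Eq.trans ?_ (congrArg (((A.restrict k).map (sheafTensorMap
      (𝟙 (((A.tensor B.op).restrict hV).obj L)) g)).val.app Y)
      (tensorRestrictIso_tmul hV k L N l n)).symm
    exact (sheafTensorMap_tmul (𝟙 (((A.tensor B.op).restrict hV).obj L)) g
      (W := (Over.map (homOfLE k)).op.obj Y) l n).symm)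
  iso_comp {V W Y} hV k l N := by
    apply sheafTensor_hom_ext
    intro Z x n
    refine (congrArg ((tensorRestrictIso hV (l.trans k) L N).hom.val.app Z)
      (sheafTensorMap_tmul (𝟙 (((A.tensor B.op).restrict (l.trans (k.trans hV))).obj L))
        ((B.modPrestack.resComp k l).hom.app N) x n)).trans ?_
    refine (tensorRestrictIso_tmul hV (l.trans k) L N _ _).trans ?_
    refine Eq.trans ?_ (congrArg (fun y => ((A.modPrestack.resComp k l).hom.app
      (sheafTensor (((A.tensor B.op).restrict hV).obj L) N)).val.app Z
        (((A.restrict l).map (tensorRestrictIso hV k L N).hom).val.app Z y))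
      (tensorRestrictIso_tmul (k.trans hV) l L ((B.restrict k).obj N) x n)).symm
    exact (tensorRestrictIso_tmul hV k L N (Y := (Over.map (homOfLE l)).op.obj Z) x n).symm

/-- The transformation `L ⊗_B (·) ⇒ L' ⊗_B (·)` induced by `f : L ⟶ L'`. -/
noncomputable def tensorFunctorOnMap {L L' : (A.tensor B.op).Mod U} (f : L ⟶ L') :
    tensorFunctorOn L ⟶ tensorFunctorOn L' where
  app V hV := tensorFunctorMap (((A.tensor B.op).restrict hV).map f)
  naturality {V W} hV k N := by
    apply sheafTensor_hom_ext
    intro Y l n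
    refine (congrArg ((tensorRestrictIso hV k L' N).hom.val.app Y)
      (sheafTensorMap_tmul (((A.tensor B.op).restrict (k.trans hV)).map f)
        (𝟙 ((B.restrict k).obj N)) l n)).trans ?_
    refine (tensorRestrictIso_tmul hV k L' N _ _).trans ?_
    refine Eq.trans ?_ (congrArg (((A.restrict k).map (sheafTensorMap
      (((A.tensor B.op).restrict hV).map f) (𝟙 N))).val.app Y)
      (tensorRestrictIso_tmul hV k L N l n)).symm
    exact (sheafTensorMap_tmul (((A.tensor B.op).restrict hV).map f) (𝟙 N)
      (W := (Over.map (homOfLE k)).op.obj Y) l n).symm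

/-- The functor `L ↦ L ⊗_B (·)` on `A ⊗ Bᵒᵖ`-modules over `U`. -/
noncomputable def tensorFunctorOnFunctor (A B : SheafAlgebra O) (U : Opens X) : (A.tensor B.op).Mod U ⥤
    FunctorOn U B.modPrestack.toPrestack A.modPrestack.toPrestack where
  obj := tensorFunctorOn
  map := tensorFunctorOnMap
  map_id L := FunctorOn.hom_ext (fun V hV N => by
    refine (congrArg (sheafTensorMap · (𝟙 N)) (((A.tensor B.op).restrict hV).map_id L)).trans ?_
    exact sheafTensorMap_id _ _)
  map_comp f g := FunctorOn.hom_ext (fun V hV N => by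
    refine (congrArg₂ sheafTensorMap (((A.tensor B.op).restrict hV).map_comp f g)
      (Category.comp_id (𝟙 N)).symm).trans ?_
    exact sheafTensorMap_comp _ _ _ _)

/-- The isomorphism `L|_V ⊗_B (·) ≅ (L ⊗_B (·))|_V` of functors `Mod(B)|_V → Mod(A)|_V`. -/
noncomputable def tensorFunctorOnRestrict {V : Opens X} (k : V ≤ U) (L : (A.tensor B.op).Mod U) :
    tensorFunctorOn (((A.tensor B.op).restrict k).obj L) ≅ (tensorFunctorOn L).restrict k where
  hom :=
    { app := fun W hW =>
        tensorFunctorMap (((A.tensor B.op).modPrestack.resComp k hW).hom.app L)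
      naturality := fun {W W'} hW l N => by
        apply sheafTensor_hom_ext
        intro Y x n
        refine (congrArg ((tensorRestrictIso (hW.trans k) l L N).hom.val.app Y)
          (sheafTensorMap_tmul (((A.tensor B.op).modPrestack.resComp k (l.trans hW)).hom.app L)
            (𝟙 ((B.restrict l).obj N)) x n)).trans ?_
        refine (tensorRestrictIso_tmul (hW.trans k) l L N _ _).trans ?_
        refine Eq.trans ?_ (congrArg (((A.restrict l).map (sheafTensorMap
          (((A.tensor B.op).modPrestack.resComp k hW).hom.app L) (𝟙 N))).val.app Y)
          (tensorRestrictIso_tmul hW l (((A.tensor B.op).restrict k).obj L) N x n)).symm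
        exact (sheafTensorMap_tmul (((A.tensor B.op).modPrestack.resComp k hW).hom.app L) (𝟙 N)
          (W := (Over.map (homOfLE l)).op.obj Y) x n).symm }
  inv :=
    { app := fun W hW =>
        tensorFunctorMap (((A.tensor B.op).modPrestack.resComp k hW).inv.app L)
      naturality := fun {W W'} hW l N => by
        apply sheafTensor_hom_ext
        intro Y x n
        refine (congrArg ((tensorRestrictIso hW l (((A.tensor B.op).restrict k).obj L) N).hom.val.app Y)
          (sheafTensorMap_tmul (((A.tensor B.op).modPrestack.resComp k (l.trans hW)).inv.app L)
            (𝟙 ((B.restrict l).obj N)) x n)).trans ?_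
        refine (tensorRestrictIso_tmul hW l (((A.tensor B.op).restrict k).obj L) N _ _).trans ?_
        refine Eq.trans ?_ (congrArg (((A.restrict l).map (sheafTensorMap
          (((A.tensor B.op).modPrestack.resComp k hW).inv.app L) (𝟙 N))).val.app Y)
          (tensorRestrictIso_tmul (hW.trans k) l L N x n)).symm
        exact (sheafTensorMap_tmul (((A.tensor B.op).modPrestack.resComp k hW).inv.app L) (𝟙 N)
          (W := (Over.map (homOfLE l)).op.obj Y) x n).symm }
  hom_inv_id := FunctorOn.hom_ext (fun W hW N =>
    (sheafTensorMapIso (((A.tensor B.op).modPrestack.resComp k hW).app L)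
      (Iso.refl N)).hom_inv_id)
  inv_hom_id := FunctorOn.hom_ext (fun W hW N =>
    (sheafTensorMapIso (((A.tensor B.op).modPrestack.resComp k hW).app L)
      (Iso.refl N)).inv_hom_id)

/-- The functor `L ↦ L ⊗_B (·)` from `Mod(A ⊗ Bᵒᵖ)` to the prestack of functors
`Mod(B) → Mod(A)`. -/
noncomputable def tensorPrestackFunctor (A B : SheafAlgebra O) : FunctorOn ⊤ (A.tensor B.op).modPrestack.toPrestack
    (functorPrestack B.modPrestack A.modPrestack).toPrestack where
  app V _ := tensorFunctorOnFunctor A B V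
  iso {V W} _ k := NatIso.ofComponents (fun L => tensorFunctorOnRestrict k L) (fun {L L'} f =>
    FunctorOn.hom_ext (fun Y hY N => by
      refine (sheafTensorMap_comp _ _ (𝟙 N) (𝟙 N)).symm.trans ?_
      refine Eq.trans ?_ (sheafTensorMap_comp _ _ (𝟙 N) (𝟙 N))
      exact congrArg (sheafTensorMap · (𝟙 N ≫ 𝟙 N))
        (((A.tensor B.op).modPrestack.resComp k hY).hom.naturality f)))
  iso_comp {V W Y} _ k l L := FunctorOn.hom_ext (fun Z hZ N => by
    apply sheafTensor_hom_ext
    intro T x n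
    refine (congrArg ((sheafTensorMap (((A.tensor B.op).modPrestack.resComp (l.trans k) hZ).hom.app L)
      (𝟙 N)).val.app T) (sheafTensorMap_tmul (((A.tensor B.op).restrict hZ).map
        (((A.tensor B.op).modPrestack.resComp k l).hom.app L)) (𝟙 N) x n)).trans ?_
    refine (sheafTensorMap_tmul _ (𝟙 N) _ _).trans ?_
    refine Eq.trans ?_ (congrArg ((sheafTensorMap
      (((A.tensor B.op).modPrestack.resComp k (hZ.trans l)).hom.app L) (𝟙 N)).val.app T)
      (sheafTensorMap_tmul (((A.tensor B.op).modPrestack.resComp l hZ).hom.app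
        (((A.tensor B.op).restrict k).obj L)) (𝟙 N) x n)).symm
    exact (sheafTensorMap_tmul _ (𝟙 N) _ _).symm)

end SheafAlgebra

end

end LinearStack

/-!
This is the Eilenberg–Watts theorem for stacks of modules.

Tensor products with bimodules are `O`-functors with right adjoints: the right adjoint of
`L ⊗_B (·)` is `Hom_A(L, ·)`, where `Hom_A(L, M)` is the sheaf of `A`-linear homomorphisms
(`homSheaf`), with the action of `B` induced by its right action on `L`. This gives
`hasRightAdjoint_tensorFunctorOn`.

The functor `Φ` is fully faithful (`fullyFaithfulTensorFunctorOn`). A section `n` of `N` over `Z` is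
the image of `1` under a morphism `B|_Z ⟶ N|_Z`. Hence a transformation
`L ⊗_B (·) ⇒ L' ⊗_B (·)`, which is natural and compatible with restriction, is determined by its
components at the modules `B|_Z` (`secMap_transApp`), and these amount to a morphism `L ⟶ L'` of
bimodules, because `L ⊗_B B ≅ L` (`isIso_tmulOne`).

It is essentially surjective. Let `φ` be an `O`-functor that admits a right adjoint. The right
multiplications of `B` make `φ(B)` a bimodule (`funModule`), and the image of the morphism
`B|_Z ⟶ N|_Z` of a section `n` of `N` is a map `φ(B)(Z) → φ(N)(Z)` (`funEval`). Together these maps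
give a transformation `θ : φ(B) ⊗_B (·) ⇒ φ` (`funTrans`), whose components at the modules `B|_Y`
are invertible. No presentation of `N` by free modules is needed to conclude: both sides have right
adjoints, the conjugate of `θ` is a transformation of the right adjoints, and it acts on sections
over `Y`, i.e. on morphisms from `B|_Y`, through the component of `θ` at `B|_Y`. So it is
invertible, and so is `θ` (`FunctorOn.isIso_of_isIso_app_of_detecting`).

Finally, a functor of prestacks whose components are fully faithful and essentially surjective has
a quasi-inverse (`FunctorOn.isEquivalence_of_fullyFaithful`).
-/

namespace LinearStack

/-! ### Functors of prestacks and their transformations -/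

section

variable {X : Type u} [TopologicalSpace X] {U : Opens X}
  {P : Prestack.{v₁, w₁} X} {Q : Prestack.{v₂, w₂} X}

namespace FunctorOn

lemma isIso_of_isIso_app {φ ψ : FunctorOn U P Q} (α : φ ⟶ ψ)
    (h : ∀ (V : Opens X) (hV : V ≤ U) (F : P.obj V), IsIso ((α.app V hV).app F)) : IsIso α := by
  have h' : ∀ (V : Opens X) (hV : V ≤ U), IsIso (α.app V hV) := fun V hV =>
    have := h V hV
    NatIso.isIso_of_isIso_app _
  let β : ψ ⟶ φ :=
    { app := fun V hV => inv (α.app V hV)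
      naturality := fun {V W} hV k F => by
        rw [NatIso.isIso_inv_app, NatIso.isIso_inv_app, IsIso.inv_comp_eq, ← Category.assoc,
          α.naturality hV k F, Category.assoc, ← Functor.map_comp, IsIso.hom_inv_id,
          (Q.res k).map_id]
        exact (Category.comp_id _).symm }
  refine ⟨β, hom_ext fun V hV F => ?_, hom_ext fun V hV F => ?_⟩
  · exact NatTrans.congr_app (IsIso.hom_inv_id (α.app V hV)) F
  · exact NatTrans.congr_app (IsIso.inv_hom_id (α.app V hV)) F

section QuasiInverse

variable (φ : FunctorOn U P Q) (hφ : ∀ V hV, (φ.app V hV).FullyFaithful)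
  {o : ∀ V, V ≤ U → Q.obj V → P.obj V} (ε : ∀ V hV G, (φ.app V hV).obj (o V hV G) ≅ G)

/-- A quasi-inverse of `φ`, when its components are fully faithful and every object `G` over `V`
is the image under `φ`, up to an isomorphism `ε`, of an object `o G` over `V`. The isomorphism
`o(G|_W) ≅ o(G)|_W` is the preimage of `φ(o(G|_W)) ≅ G|_W ≅ φ(o(G))|_W ≅ φ(o(G)|_W)`. -/
noncomputable def quasiInverse : FunctorOn U Q P where
  app V hV :=
    { obj := o V hV
      map := fun {G G'} g => (hφ V hV).preimage ((ε V hV G).hom ≫ g ≫ (ε V hV G').inv)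
      map_id := fun G => (hφ V hV).map_injective (by simp)
      map_comp := fun g g' => (hφ V hV).map_injective (by simp) }
  iso {V W} hV k := NatIso.ofComponents
    (fun G => (hφ W (k.trans hV)).preimageIso
      (ε W (k.trans hV) ((Q.res k).obj G) ≪≫ (Q.res k).mapIso (ε V hV G).symm ≪≫
          ((φ.iso hV k).app (o V hV G)).symm))
    (fun {G G'} g => (hφ W (k.trans hV)).map_injective (by
      have h := (φ.iso hV k).inv.naturality
        ((hφ V hV).preimage ((ε V hV G).hom ≫ g ≫ (ε V hV G').inv))
      simp only [Functor.comp_map, Functor.FullyFaithful.map_preimage, Functor.map_comp,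
        Category.assoc, Functor.comp_obj] at h
      simp [← h]))
  iso_comp {V W Y} hV k l G := (hφ Y (l.trans (k.trans hV))).map_injective (by
    have h₁ : (Q.res l).map ((φ.iso hV k).inv.app (o V hV G)) ≫
        (φ.iso (k.trans hV) l).inv.app ((P.res k).obj (o V hV G)) ≫
          (φ.app Y (l.trans (k.trans hV))).map ((P.resComp k l).hom.app (o V hV G)) =
        (Q.resComp k l).hom.app ((φ.app V hV).obj (o V hV G)) ≫
          (φ.iso hV (l.trans k)).inv.app (o V hV G) := by
      have h := φ.iso_comp hV k l (o V hV G)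
      have e₁ := Iso.inv_hom_id_app (φ.iso (k.trans hV) l) ((P.res k).obj (o V hV G))
      have e₂ := congrArg (Q.res l).map (Iso.inv_hom_id_app (φ.iso hV k) (o V hV G))
      rw [Functor.map_comp] at e₂
      rw [← cancel_mono ((φ.iso hV (l.trans k)).hom.app (o V hV G)), Category.assoc,
        Category.assoc, h, reassoc_of% e₁, reassoc_of% e₂, Category.assoc, Iso.inv_hom_id_app]
      simp
    have h₂ := (Q.resComp k l).hom.naturality (ε V hV G).inv
    have h₃ := (φ.iso (k.trans hV) l).inv.naturality ((hφ W (k.trans hV)).preimage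
      ((ε W (k.trans hV) ((Q.res k).obj G)).hom ≫ (Q.res k).map (ε V hV G).inv ≫
          (φ.iso hV k).inv.app (o V hV G)))
    simp only [Functor.comp_map, Functor.FullyFaithful.map_preimage, Functor.map_comp,
        Category.assoc, Functor.comp_obj] at h₂ h₃
    simp [← reassoc_of% h₃, ← reassoc_of% h₂, h₁])

/-- A functor of prestacks with fully faithful and essentially surjective components is an
equivalence. -/
lemma isEquivalence_of_fullyFaithful (φ : FunctorOn U P Q)
    (hφ : ∀ V hV, (φ.app V hV).FullyFaithful) {o : ∀ V, V ≤ U → Q.obj V → P.obj V}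
    (ε : ∀ V hV G, (φ.app V hV).obj (o V hV G) ≅ G) : φ.IsEquivalence := by
  refine ⟨quasiInverse φ hφ ε, ⟨?_⟩, ⟨?_⟩⟩
  · let α : φ.comp (quasiInverse φ hφ ε) ⟶ FunctorOn.id U P :=
      { app := fun V hV =>
          { app := fun F => (hφ V hV).preimage (ε V hV _).hom
            naturality := fun F G f => (hφ V hV).map_injective
              (by simp [quasiInverse, comp, FunctorOn.id]) }
        naturality := fun {V W} hV k F => (hφ W (k.trans hV)).map_injective (by
          have h := (φ.iso hV k).inv.naturality ((hφ V hV).preimage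
            (ε V hV ((φ.app V hV).obj F)).hom)
          simp only [Functor.comp_map, Functor.FullyFaithful.map_preimage] at h
          simp [quasiInverse, comp, FunctorOn.id, ← h]) }
    have : IsIso α := isIso_of_isIso_app α fun V hV F =>
      ((hφ V hV).preimageIso (ε V hV _)).isIso_hom
    exact asIso α
  · let α : (quasiInverse φ hφ ε).comp φ ⟶ FunctorOn.id U Q :=
      { app := fun V hV =>
          { app := fun F => (ε V hV _).hom
            naturality := fun F G f => by simp [quasiInverse, comp, FunctorOn.id] }
        naturality := fun {V W} hV k F => by
          simp [quasiInverse, comp, FunctorOn.id] }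
    have : IsIso α := isIso_of_isIso_app α fun V hV F => (ε V hV _).isIso_hom
    exact asIso α

end QuasiInverse

section Conjugate

variable {φ φ' : FunctorOn U P Q} {ψ ψ' : FunctorOn U Q P} (a : RightAdjunction φ ψ)
  (a' : RightAdjunction φ' ψ') (θ : φ' ⟶ φ)

/-- The compatibility of the adjunctions with restriction, in terms of the counits. -/
lemma RightAdjunction.map_iso_comp_res_counit {V W : Opens X} (hV : V ≤ U) (k : W ≤ V)
    (G : Q.obj V) :
    (φ.app W (k.trans hV)).map ((ψ.iso hV k).hom.app G) ≫
      (φ.iso hV k).hom.app ((ψ.app V hV).obj G) ≫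
        (Q.res k).map (((a.adj V hV).homEquiv _ G).symm (𝟙 _)) =
      ((a.adj W (k.trans hV)).homEquiv _ ((Q.res k).obj G)).symm (𝟙 _) := by
  have h := a.res_homEquiv hV k _ G (((a.adj V hV).homEquiv _ G).symm (𝟙 _))
  rw [Equiv.apply_symm_apply, (P.res k).map_id] at h
  rw [Equiv.eq_symm_apply]
  refine (Adjunction.homEquiv_naturality_left _ _ _).trans ?_
  rw [← cancel_mono ((ψ.iso hV k).hom.app G), Category.assoc]
  refine (congrArg ((ψ.iso hV k).hom.app G ≫ ·) h).trans ?_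
  exact (Category.comp_id _).trans (Category.id_comp _).symm

lemma comp_conjugateEquiv_app {C D : Type*} [Category C] [Category D] {L₁ L₂ : C ⥤ D}
    {R₁ R₂ : D ⥤ C} (adj₁ : L₁ ⊣ R₁) (adj₂ : L₂ ⊣ R₂) (α : L₂ ⟶ L₁) {F : C} {G : D}
    (e : F ⟶ R₁.obj G) :
    e ≫ (conjugateEquiv adj₁ adj₂ α).app G =
      adj₂.homEquiv F G (α.app F ≫ (adj₁.homEquiv F G).symm e) := by
  rw [← Equiv.symm_apply_eq, Adjunction.homEquiv_counit, Adjunction.homEquiv_counit,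
    Functor.map_comp, Category.assoc, conjugateEquiv_counit, α.naturality_assoc]

/-- The conjugate `ψ ⇒ ψ'` of a transformation `φ' ⇒ φ` is compatible with restriction. -/
lemma conjugateEquiv_res {V W : Opens X} (hV : V ≤ U) (k : W ≤ V) (G : Q.obj V) :
    (ψ.iso hV k).hom.app G ≫
        (P.res k).map ((conjugateEquiv (a.adj V hV) (a'.adj V hV) (θ.app V hV)).app G) =
      (conjugateEquiv (a.adj W (k.trans hV)) (a'.adj W (k.trans hV))
        (θ.app W (k.trans hV))).app ((Q.res k).obj G) ≫ (ψ'.iso hV k).hom.app G := by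
  have h := comp_conjugateEquiv_app (a.adj V hV) (a'.adj V hV) (θ.app V hV)
    (𝟙 ((ψ.app V hV).obj G))
  have h' := comp_conjugateEquiv_app (a.adj W (k.trans hV)) (a'.adj W (k.trans hV))
    (θ.app W (k.trans hV)) (𝟙 ((ψ.app W (k.trans hV)).obj ((Q.res k).obj G)))
  rw [Category.id_comp] at h h'
  have e₁ := θ.naturality hV k ((ψ.app V hV).obj G)
  have e₂ := (θ.app W (k.trans hV)).naturality ((ψ.iso hV k).hom.app G)
  have e₃ := a.map_iso_comp_res_counit hV k G
  simp only [Functor.comp_obj] at e₂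
  rw [h, h', ← a'.res_homEquiv hV k, ← Category.assoc]
  refine congrArg (· ≫ (ψ'.iso hV k).hom.app G)
    ((Adjunction.homEquiv_naturality_left _ _ _).symm.trans (congrArg _ ?_))
  rw [Functor.map_comp, ← reassoc_of% e₁, ← e₃]
  exact (reassoc_of% e₂) _

/-- A transformation between functors that admit right adjoints is invertible as soon as it is so
on a family of objects `E Y`, provided that the groups `Hom(E Y, F|_Y)` detect isomorphisms. The
reason is Yoneda's lemma: the conjugate transformation of the right adjoints acts on
`Hom(E Y, ψ(G)|_Y) ≅ Hom(φ(E Y), G|_Y)` by composition with `θ (E Y)`. -/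
lemma isIso_of_isIso_app_of_detecting (E : ∀ Y, Y ≤ U → P.obj Y)
    (hE : ∀ (V : Opens X) (hV : V ≤ U) (F G : P.obj V) (f : F ⟶ G),
      (∀ (Y : Opens X) (k : Y ≤ V), Function.Bijective
        (fun e : E Y (k.trans hV) ⟶ (P.res k).obj F => e ≫ (P.res k).map f)) → IsIso f)
    (hφ : φ.HasRightAdjoint) (hφ' : φ'.HasRightAdjoint)
    (hθ : ∀ (Y : Opens X) (hY : Y ≤ U), IsIso ((θ.app Y hY).app (E Y hY))) : IsIso θ := by
  obtain ⟨ψ, ⟨a⟩⟩ := hφ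
  obtain ⟨ψ', ⟨a'⟩⟩ := hφ'
  suffices h : ∀ (V : Opens X) (hV : V ≤ U), IsIso (θ.app V hV) from
    isIso_of_isIso_app θ fun V hV F => inferInstance
  intro V hV
  suffices h : IsIso (conjugateEquiv (a.adj V hV) (a'.adj V hV) (θ.app V hV)) from
    conjugateEquiv_of_iso (a.adj V hV) (a'.adj V hV) (θ.app V hV)
  have : ∀ G, IsIso ((conjugateEquiv (a.adj V hV) (a'.adj V hV) (θ.app V hV)).app G) := by
    intro G
    refine hE V hV _ _ _ fun Y k => ?_
    have hY := hθ Y (k.trans hV)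
    have e : (fun e : E Y (k.trans hV) ⟶ (P.res k).obj ((ψ.app V hV).obj G) =>
        e ≫ (P.res k).map ((conjugateEquiv (a.adj V hV) (a'.adj V hV) (θ.app V hV)).app G)) =
        ((ψ.iso hV k).app G).symm.homToEquiv.trans
        (((a.adj Y (k.trans hV)).homEquiv _ _).symm.trans
          ((asIso ((θ.app Y (k.trans hV)).app (E Y (k.trans hV)))).symm.homFromEquiv.trans
            (((a'.adj Y (k.trans hV)).homEquiv _ _).trans
              ((ψ'.iso hV k).app G).homToEquiv))) := by
      funext e
      have h₁ := comp_conjugateEquiv_app (a.adj Y (k.trans hV)) (a'.adj Y (k.trans hV))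
        (θ.app Y (k.trans hV)) (e ≫ (ψ.iso hV k).inv.app G)
      have h₂ := conjugateEquiv_res a a' θ hV k G
      have h₃ := Iso.inv_hom_id_app_assoc (ψ.iso hV k) G ((P.res k).map
        ((conjugateEquiv (a.adj V hV) (a'.adj V hV) (θ.app V hV)).app G))
      rw [h₂] at h₃
      refine (congrArg (e ≫ ·) h₃.symm).trans ?_
      simp only [← Category.assoc]
      exact congrArg (· ≫ (ψ'.iso hV k).hom.app G) h₁
    refine (congrArg Function.Bijective e).mpr ?_
    exact Equiv.bijective _
  exact NatIso.isIso_of_isIso_app _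

end Conjugate

end FunctorOn

end

namespace SheafAlgebra

variable {X : Type u} [TopologicalSpace X]
  {O : Sheaf (Opens.grothendieckTopology X) CommRingCat.{u}}

/-! ### Sections of sheaves of modules -/

section Sections

/-- The ring `A(Z)`. -/
abbrev on (A : SheafAlgebra O) (Z : Opens X) : Type u := A.ring.obj.obj (Opposite.op Z)

/-- The restriction `A(Z) → A(Y)`, for `Y ⊆ Z`. -/
def ringRes (A : SheafAlgebra O) {Y Z : Opens X} (k : Y ≤ Z) : A.on Z →+* A.on Y :=
  (A.ring.obj.map (homOfLE k).op).hom

variable {A : SheafAlgebra O} {V : Opens X}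

/-- The group `M(Z)` of sections over an open subset `Z ⊆ V` of a module `M` over `A|_V`. The
underlying presheaf of `M` is defined on the inclusions `Z ⊆ V`, and `M(Z)` is its value at such an
inclusion. -/
def Sec (M : A.Mod V) (Z : Opens X) (h : Z ≤ V) : Type u :=
  M.val.obj (Opposite.op (Over.mk (homOfLE h)))

variable {M N K : A.Mod V} {Z Y : Opens X} {h : Z ≤ V}

noncomputable instance : AddCommGroup (Sec M Z h) :=
  inferInstanceAs (AddCommGroup (M.val.obj (Opposite.op (Over.mk (homOfLE h)))))

noncomputable instance : Module (A.on Z) (Sec M Z h) :=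
  inferInstanceAs (Module ((A.ring.over V).obj.obj (Opposite.op (Over.mk (homOfLE h))))
    (M.val.obj (Opposite.op (Over.mk (homOfLE h)))))

/-- The restriction `M(Z) → M(Y)`, for `Y ⊆ Z`. -/
noncomputable def Sec.res (M : A.Mod V) {Z Y : Opens X} (h : Z ≤ V) (k : Y ≤ Z) :
    Sec M Z h →+ Sec M Y (k.trans h) :=
  (M.val.presheaf.map (Over.homMk (homOfLE k) : Over.mk (homOfLE (k.trans h)) ⟶
    Over.mk (homOfLE h)).op).hom

lemma Sec.res_smul (k : Y ≤ Z) (a : A.on Z) (m : Sec M Z h) :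
    Sec.res M h k (a • m) = A.ringRes k a • Sec.res M h k m :=
  M.val.map_smul (Over.homMk (homOfLE k) : Over.mk (homOfLE (k.trans h)) ⟶
    Over.mk (homOfLE h)).op a m

lemma Sec.res_res {T : Opens X} (k : Y ≤ Z) (l : T ≤ Y) (m : Sec M Z h) :
    Sec.res M (k.trans h) l (Sec.res M h k m) = Sec.res M h (l.trans k) m :=
  (ConcreteCategory.congr_hom (M.val.presheaf.map_comp
    (Over.homMk (homOfLE k) : Over.mk (homOfLE (k.trans h)) ⟶ Over.mk (homOfLE h)).op
    (Over.homMk (homOfLE l) : Over.mk (homOfLE (l.trans (k.trans h))) ⟶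
      Over.mk (homOfLE (k.trans h))).op) m).symm

lemma Sec.res_self (m : Sec M Z h) : Sec.res M h le_rfl m = m :=
  ConcreteCategory.congr_hom (M.val.presheaf.map_id (Opposite.op (Over.mk (homOfLE h)))) m

/-- The action of a morphism on sections. -/
noncomputable def secMap (f : M ⟶ N) (Z : Opens X) (h : Z ≤ V) : Sec M Z h →ₗ[A.on Z] Sec N Z h :=
  (f.val.app (Opposite.op (Over.mk (homOfLE h)))).hom

lemma secMap_res (f : M ⟶ N) (k : Y ≤ Z) (m : Sec M Z h) :
    secMap f Y (k.trans h) (Sec.res M h k m) = Sec.res N h k (secMap f Z h m) :=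
  PresheafOfModules.naturality_apply f.val (Over.homMk (homOfLE k) :
    Over.mk (homOfLE (k.trans h)) ⟶ Over.mk (homOfLE h)).op m

lemma secMap_comp (f : M ⟶ N) (g : N ⟶ K) (m : Sec M Z h) :
    secMap (f ≫ g) Z h m = secMap g Z h (secMap f Z h m) := rfl

lemma secMap_id (m : Sec M Z h) : secMap (𝟙 M) Z h m = m := rfl

lemma secMap_add (f g : M ⟶ N) (m : Sec M Z h) :
    secMap (f + g) Z h m = secMap f Z h m + secMap g Z h m := rfl

lemma secMap_smul (r : O.obj.obj (Opposite.op V)) (f : M ⟶ N) (m : Sec M Z h) :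
    secMap (r • f) Z h m = A.unit _ (O.obj.map (homOfLE h).op r) • secMap f Z h m := rfl

lemma hom_ext_sec {f g : M ⟶ N} (H : ∀ (Z : Opens X) (h : Z ≤ V) (m : Sec M Z h),
    secMap f Z h m = secMap g Z h m) : f = g :=
  mod_hom_ext fun W m => H W.unop.left (leOfHom W.unop.hom) m

/-- A morphism given by its action on sections. -/
noncomputable def homOfSec (f : ∀ (Z : Opens X) (h : Z ≤ V), Sec M Z h →ₗ[A.on Z] Sec N Z h)
    (hf : ∀ (Z Y : Opens X) (h : Z ≤ V) (k : Y ≤ Z) (m : Sec M Z h),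
      f Y (k.trans h) (Sec.res M h k m) = Sec.res N h k (f Z h m)) : M ⟶ N where
  val := PresheafOfModules.homMk
    { app := fun W => AddCommGrpCat.ofHom
        (f W.unop.left (leOfHom W.unop.hom)).toAddMonoidHom
      naturality := fun W W' i => by
        ext m
        exact hf W.unop.left W'.unop.left (leOfHom W.unop.hom) (leOfHom i.unop.left) m }
    (fun W a m => (f W.unop.left (leOfHom W.unop.hom)).map_smul a m)

lemma isIso_of_bijective_sec (f : M ⟶ N)
    (H : ∀ (Z : Opens X) (h : Z ≤ V), Function.Bijective (secMap f Z h)) : IsIso f := by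
  let e := fun Z h => LinearEquiv.ofBijective (secMap f Z h) (H Z h)
  refine ⟨homOfSec (fun Z h => (e Z h).symm.toLinearMap) (fun Z Y h k m => ?_),
    hom_ext_sec fun Z h m => (e Z h).symm_apply_apply m,
    hom_ext_sec fun Z h m => (e Z h).apply_symm_apply m⟩
  obtain ⟨m, rfl⟩ := (e Z h).surjective m
  refine (e Y (k.trans h)).injective ?_
  refine ((e Y (k.trans h)).apply_symm_apply _).trans ?_
  refine (secMap_res f k m).symm.trans ?_
  exact congrArg (fun x => secMap f Y (k.trans h) (Sec.res M h k x))
    ((e Z h).symm_apply_apply m).symm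

lemma bijective_sec_of_isIso (f : M ⟶ N) [IsIso f] (Z : Opens X) (h : Z ≤ V) :
    Function.Bijective (secMap f Z h) := by
  refine Function.bijective_iff_has_inverse.2 ⟨secMap (inv f) Z h, fun m => ?_, fun m => ?_⟩
  · rw [← secMap_comp, IsIso.hom_inv_id, secMap_id]
  · rw [← secMap_comp, IsIso.inv_hom_id, secMap_id]

variable {V' : Opens X} (k : V' ≤ V)

/-- The identification of the sections of `M` over `Z ⊆ V'` with those of `M|_{V'}`. -/
noncomputable def Sec.toRestrict (M : A.Mod V) (hZ : Z ≤ V') :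
    Sec M Z (hZ.trans k) ≃ₗ[A.on Z] Sec ((A.restrict k).obj M) Z hZ :=
  LinearEquiv.refl _ (Sec M Z (hZ.trans k))

lemma secMap_toRestrict (f : M ⟶ N) (hZ : Z ≤ V') (m : Sec M Z (hZ.trans k)) :
    secMap ((A.restrict k).map f) Z hZ (Sec.toRestrict k M hZ m) =
      Sec.toRestrict k N hZ (secMap f Z (hZ.trans k) m) := rfl

lemma Sec.res_toRestrict (hZ : Z ≤ V') (l : Y ≤ Z) (m : Sec M Z (hZ.trans k)) :
    Sec.res ((A.restrict k).obj M) hZ l (Sec.toRestrict k M hZ m) =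
      Sec.toRestrict k M (l.trans hZ) (Sec.res M (hZ.trans k) l m) := rfl

end Sections

/-! ### Free modules of rank one -/

section Unit

variable (A : SheafAlgebra O) (V : Opens X)

/-- The module `A|_V` over the sheaf of rings `A|_V`. -/
noncomputable def free : A.Mod V := SheafOfModules.unit (A.ring.over V)

variable {A V} {Z : Opens X} {h : Z ≤ V}

/-- A section of `A` as a section of the module `A|_V`. -/
def toFree (h : Z ≤ V) : A.on Z ≃ₗ[A.on Z] Sec (A.free V) Z h := LinearEquiv.refl _ _

lemma toFree_res {Y : Opens X} (k : Y ≤ Z) (a : A.on Z) :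
    Sec.res (A.free V) h k (toFree h a) = toFree (k.trans h) (A.ringRes k a) := rfl

variable {M N : A.Mod V}

/-- The morphism `A|_V ⟶ M`, `a ↦ a m`, for a section `m` of `M` on `V`. -/
noncomputable def freeHom (m : Sec M V le_rfl) : A.free V ⟶ M :=
  homOfSec (fun Z h => (LinearMap.toSpanSingleton (A.on Z) _ (Sec.res M le_rfl h m)).comp
      (toFree h).symm.toLinearMap)
    (fun Z Y h k a => by
      obtain ⟨a, rfl⟩ := (toFree h).surjective a
      change A.ringRes k a • Sec.res M le_rfl (k.trans h) m =
        Sec.res M h k (a • Sec.res M le_rfl h m)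
      rw [Sec.res_smul, Sec.res_res])

lemma secMap_freeHom (m : Sec M V le_rfl) (a : A.on Z) :
    secMap (freeHom m) Z h (toFree h a) = a • Sec.res M le_rfl h m := rfl

lemma secMap_freeHom_one (m : Sec M V le_rfl) :
    secMap (freeHom m) V le_rfl (toFree le_rfl 1) = m := by
  rw [secMap_freeHom, one_smul, Sec.res_self]

lemma free_hom_ext {f g : A.free V ⟶ M}
    (H : secMap f V le_rfl (toFree le_rfl 1) = secMap g V le_rfl (toFree le_rfl 1)) : f = g := by
  refine hom_ext_sec fun Z h a => ?_
  obtain ⟨a, rfl⟩ := (toFree h).surjective a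
  have e : toFree (A := A) h a = a • Sec.res (A.free V) le_rfl h (toFree le_rfl 1) := by
    rw [toFree_res, map_one, ← map_smul, smul_eq_mul, mul_one]
  rw [e, map_smul, map_smul, secMap_res, secMap_res, H]

/-- A morphism is invertible as soon as it induces bijections on the morphisms from the modules
`A|_Y`, because these are the sections over `Y`. -/
lemma isIso_of_free_bijective (f : M ⟶ N)
    (H : ∀ (Y : Opens X) (k : Y ≤ V), Function.Bijective
      (fun e : A.free Y ⟶ (A.restrict k).obj M => e ≫ (A.restrict k).map f)) : IsIso f := by
  refine isIso_of_bijective_sec f fun Y k => ⟨fun m m' hm => ?_, fun n => ?_⟩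
  · have h' := (H Y k).1 (a₁ := freeHom (Sec.toRestrict k M le_rfl m))
      (a₂ := freeHom (Sec.toRestrict k M le_rfl m')) (free_hom_ext (by
        rw [secMap_comp, secMap_comp, secMap_freeHom_one, secMap_freeHom_one, secMap_toRestrict,
          secMap_toRestrict, hm]))
    have h'' := congrArg (fun g => secMap g Y le_rfl (toFree le_rfl 1)) h'
    simpa only [secMap_freeHom_one, EmbeddingLike.apply_eq_iff_eq] using h''
  · obtain ⟨e, he⟩ := (H Y k).2 (freeHom (Sec.toRestrict k N le_rfl n))
    have h' := congrArg (fun g => secMap g Y le_rfl (toFree le_rfl 1)) he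
    obtain ⟨m, hm⟩ := (Sec.toRestrict k M le_rfl).surjective (secMap e Y le_rfl (toFree le_rfl 1))
    refine ⟨m, (Sec.toRestrict k N le_rfl).injective ?_⟩
    rw [secMap_freeHom_one, secMap_comp, ← hm, secMap_toRestrict] at h'
    exact h'

end Unit

end SheafAlgebra

/-! ### Tensor products of sheaves of modules -/

namespace BalancedTensor

open scoped TensorProduct

variable {T B : Type*} [Ring T] [Ring B] {g : Bᵐᵒᵖ →+* T}
  {L : Type*} [AddCommGroup L] [Module T L] {N : Type*} [AddCommGroup N] [Module B N]

/-- The map out of `L ⊗_B N` given by a balanced biadditive map. -/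
def lift {C : Type*} [AddCommGroup C] (f : L →+ N →+ C)
    (hf : ∀ l b n, f (g (MulOpposite.op b) • l) n = f l (b • n)) : BalancedTensor g L N →+ C :=
  QuotientAddGroup.lift _ (TensorProduct.liftAddHom f (fun r l n => by simp)) (by
    refine (AddSubgroup.closure_le _).2 ?_
    rintro _ ⟨l, b, n, rfl⟩
    change TensorProduct.liftAddHom f _ _ = 0
    rw [map_sub, TensorProduct.liftAddHom_tmul, TensorProduct.liftAddHom_tmul, hf, sub_self])

end BalancedTensor

namespace SheafAlgebra

variable {X : Type u} [TopologicalSpace X]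
  {O : Sheaf (Opens.grothendieckTopology X) CommRingCat.{u}}

section Bimodules

variable (A B : SheafAlgebra O)

/-- The morphism `A(Z) → (A ⊗ Bᵒᵖ)(Z)`. -/
noncomputable def leftRing (Z : Opens X) : A.on Z →+* (A.tensor B.op).on Z :=
  ((tensorLeft A B.op).hom.app (Opposite.op Z)).hom

/-- The morphism `B(Z)ᵒᵖ → (A ⊗ Bᵒᵖ)(Z)`. -/
noncomputable def rightRing (Z : Opens X) : (B.on Z)ᵐᵒᵖ →+* (A.tensor B.op).on Z :=
  ((tensorRight A B.op).hom.app (Opposite.op Z)).hom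

variable {A B} {Z Y : Opens X}

lemma leftRing_mul_rightRing (a : A.on Z) (b : (B.on Z)ᵐᵒᵖ) :
    leftRing A B Z a * rightRing A B Z b = rightRing A B Z b * leftRing A B Z a :=
  tensorLeft_tensorRight_comm A B.op _ a b

lemma ringRes_leftRing (k : Y ≤ Z) (a : A.on Z) :
    (A.tensor B.op).ringRes k (leftRing A B Z a) = leftRing A B Y (A.ringRes k a) :=
  (ConcreteCategory.congr_hom ((tensorLeft A B.op).hom.naturality (homOfLE k).op) a).symm

lemma ringRes_rightRing (k : Y ≤ Z) (b : B.on Z) :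
    (A.tensor B.op).ringRes k (rightRing A B Z (MulOpposite.op b)) =
      rightRing A B Y (MulOpposite.op (B.ringRes k b)) :=
  (ConcreteCategory.congr_hom ((tensorRight A B.op).hom.naturality (homOfLE k).op)
    (MulOpposite.op b)).symm

variable {V : Opens X} {L L' : (A.tensor B.op).Mod V} {N N' : B.Mod V} {M : A.Mod V} {h : Z ≤ V}

/-- The section `l ⊗ n` of `L ⊗_B N`, for sections `l` of `L` and `n` of `N` over `Z`. -/
noncomputable def secTmul (l : Sec L Z h) (n : Sec N Z h) : Sec (sheafTensor L N) Z h :=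
  tmul (W := Opposite.op (Over.mk (homOfLE h))) l n

section

variable {W : (Over V)ᵒᵖ}

lemma tmul_add_left (l l' : L.val.obj W) (n : N.val.obj W) :
    tmul (l + l') n = tmul l n + tmul l' n :=
  (congrArg ((presheafTensorUnit L N).app W)
    (BalancedTensor.add_tmul (rightHom A B W) l l' n)).trans (map_add _ _ _)

lemma tmul_add_right (l : L.val.obj W) (n n' : N.val.obj W) :
    tmul l (n + n') = tmul l n + tmul l n' :=
  (congrArg ((presheafTensorUnit L N).app W)
    (BalancedTensor.tmul_add (rightHom A B W) l n n')).trans (map_add _ _ _)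

lemma tmul_balanced (b : (B.ring.over V).obj.obj W) (l : L.val.obj W) (n : N.val.obj W) :
    tmul (rightHom A B W (MulOpposite.op b) • l) n = tmul l (b • n) :=
  congrArg ((presheafTensorUnit L N).app W)
    (BalancedTensor.tmul_balanced (rightHom A B W) l b n)

lemma smul_tmul (a : (A.ring.over V).obj.obj W) (l : L.val.obj W) (n : N.val.obj W) :
    a • tmul l n = tmul (leftHom A B W a • l) n :=
  (((presheafTensorUnit L N).app W).hom.map_smul a
    (BalancedTensor.tmul (rightHom A B W) l n : sectionTensor L N W)).symm

end

lemma secTmul_add_left (l l' : Sec L Z h) (n : Sec N Z h) :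
    secTmul (l + l') n = secTmul l n + secTmul l' n :=
  tmul_add_left (W := Opposite.op (Over.mk (homOfLE h))) l l' n

lemma secTmul_add_right (l : Sec L Z h) (n n' : Sec N Z h) :
    secTmul l (n + n') = secTmul l n + secTmul l n' :=
  tmul_add_right (W := Opposite.op (Over.mk (homOfLE h))) l n n'

lemma secTmul_balanced (b : B.on Z) (l : Sec L Z h) (n : Sec N Z h) :
    secTmul (rightRing A B Z (MulOpposite.op b) • l) n = secTmul l (b • n) :=
  tmul_balanced (W := Opposite.op (Over.mk (homOfLE h))) b l n

lemma smul_secTmul (a : A.on Z) (l : Sec L Z h) (n : Sec N Z h) :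
    a • secTmul l n = secTmul (leftRing A B Z a • l) n :=
  smul_tmul (W := Opposite.op (Over.mk (homOfLE h))) a l n

lemma res_secTmul (k : Y ≤ Z) (l : Sec L Z h) (n : Sec N Z h) :
    Sec.res (sheafTensor L N) h k (secTmul l n) = secTmul (Sec.res L h k l) (Sec.res N h k n) :=
  map_tmul (Over.homMk (homOfLE k) : Over.mk (homOfLE (k.trans h)) ⟶ Over.mk (homOfLE h)).op l n

lemma secMap_sheafTensorMap (f : L ⟶ L') (g : N ⟶ N') (l : Sec L Z h) (n : Sec N Z h) :
    secMap (sheafTensorMap f g) Z h (secTmul l n) = secTmul (secMap f Z h l) (secMap g Z h n) :=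
  sheafTensorMap_tmul f g l n

lemma sheafTensor_hom_ext_sec {f g : sheafTensor L N ⟶ M}
    (H : ∀ (Z : Opens X) (h : Z ≤ V) (l : Sec L Z h) (n : Sec N Z h),
      secMap f Z h (secTmul l n) = secMap g Z h (secTmul l n)) : f = g :=
  sheafTensor_hom_ext fun W l n => H W.unop.left (leOfHom W.unop.hom) l n

variable (L N M) in
/-- A family of `B`-balanced and `A`-linear biadditive maps `L(Z) × N(Z) → M(Z)`, compatible with
restriction. -/
structure BalancedMap where
  /-- The biadditive maps. -/
  toHom : ∀ (Z : Opens X) (h : Z ≤ V), Sec L Z h →+ Sec N Z h →+ Sec M Z h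
  balanced : ∀ (Z : Opens X) (h : Z ≤ V) (l : Sec L Z h) (b : B.on Z) (n : Sec N Z h),
    toHom Z h (rightRing A B Z (MulOpposite.op b) • l) n = toHom Z h l (b • n)
  smul : ∀ (Z : Opens X) (h : Z ≤ V) (a : A.on Z) (l : Sec L Z h) (n : Sec N Z h),
    toHom Z h (leftRing A B Z a • l) n = a • toHom Z h l n
  res : ∀ (Z Y : Opens X) (h : Z ≤ V) (k : Y ≤ Z) (l : Sec L Z h) (n : Sec N Z h),
    toHom Y (k.trans h) (Sec.res L h k l) (Sec.res N h k n) = Sec.res M h k (toHom Z h l n)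

/-- The morphism of presheaves induced by a balanced map. -/
noncomputable def BalancedMap.presheafLift (β : BalancedMap L N M) :
    presheafTensor L N ⟶ M.val :=
  PresheafOfModules.homMk
    { app := fun W => AddCommGrpCat.ofHom (BalancedTensor.lift (g := rightHom A B W)
        (L := L.val.obj W) (N := N.val.obj W) (C := M.val.obj W)
        (β.toHom W.unop.left (leOfHom W.unop.hom))
        (β.balanced W.unop.left (leOfHom W.unop.hom)))
      naturality := fun W W' i => by
        apply AddCommGrpCat.hom_ext
        exact BalancedTensor.addHom_ext fun l n =>
          β.res W.unop.left W'.unop.left (leOfHom W.unop.hom) (leOfHom i.unop.left) l n }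
    (fun W a (x : sectionTensor L N W) => by
      induction x using BalancedTensor.induction_on with
      | zero =>
        refine (congrArg _ (smul_zero (A := (presheafTensorAb L N).obj W) a)).trans ?_
        refine (map_zero _).trans ?_
        refine Eq.trans ?_ (congrArg (a • ·) (map_zero _).symm)
        exact (smul_zero (A := M.val.obj W) a).symm
      | tmul l n => exact β.smul W.unop.left (leOfHom W.unop.hom) a l n
      | add x y hx hy =>
        refine (congrArg _ (smul_add (A := (presheafTensorAb L N).obj W) a x y)).trans ?_
        refine (map_add _ _ _).trans ?_
        refine Eq.trans ?_ (congrArg (a • ·) (map_add _ _ _).symm)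
        refine Eq.trans ?_ (smul_add (A := M.val.obj W) a _ _).symm
        exact congrArg₂ (· + ·) hx hy)

/-- The morphism `L ⊗_B N ⟶ M` induced by a balanced map. -/
noncomputable def BalancedMap.lift (β : BalancedMap L N M) : sheafTensor L N ⟶ M :=
  sheafTensorLift β.presheafLift

lemma BalancedMap.secMap_lift (β : BalancedMap L N M) (l : Sec L Z h) (n : Sec N Z h) :
    secMap β.lift Z h (secTmul l n) = β.toHom Z h l n :=
  sheafTensorLift_tmul β.presheafLift l n

/-! ### The restriction of scalars along `A → A ⊗ Bᵒᵖ` -/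

/-- The `A`-module underlying an `A ⊗ Bᵒᵖ`-module. -/
noncomputable def restrictLeft (L : (A.tensor B.op).Mod V) : A.Mod V where
  val :=
    letI : ∀ W, Module ((A.ring.over V).obj.obj W) (L.val.presheaf.obj W) := fun W =>
      Module.compHom (L.val.obj W) (leftHom A B W)
    PresheafOfModules.ofPresheaf L.val.presheaf (fun W W' i a l => by
      refine (L.val.map_smul i (leftHom A B W a) l).trans ?_
      exact congrArg (· • (L.val.map i l : L.val.obj W')) (leftHom_map i a))
  isSheaf := L.isSheaf

/-- The identification of the sections of an `A ⊗ Bᵒᵖ`-module and of the underlying `A`-module. -/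
noncomputable def toRestrictLeft (L : (A.tensor B.op).Mod V) (Z : Opens X) (h : Z ≤ V) :
    Sec L Z h ≃+ Sec (restrictLeft L) Z h :=
  AddEquiv.refl (Sec L Z h)

lemma smul_toRestrictLeft (a : A.on Z) (l : Sec L Z h) :
    a • toRestrictLeft L Z h l = toRestrictLeft L Z h (leftRing A B Z a • l) := rfl

/-- The morphism `L ⟶ L ⊗_B B`, `l ↦ l ⊗ 1`. -/
noncomputable def tmulOne (L : (A.tensor B.op).Mod V) :
    restrictLeft L ⟶ sheafTensor L (B.free V) :=
  homOfSec (fun Z h =>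
    { toFun := fun l => secTmul ((toRestrictLeft L Z h).symm l) (toFree h 1)
      map_add' := fun l l' => by rw [map_add, secTmul_add_left]
      map_smul' := fun a l => by
        obtain ⟨l, rfl⟩ := (toRestrictLeft L Z h).surjective l
        rw [smul_toRestrictLeft, AddEquiv.symm_apply_apply, AddEquiv.symm_apply_apply,
          RingHom.id_apply, smul_secTmul] })
    (fun Z Y h k l => by
      obtain ⟨l, rfl⟩ := (toRestrictLeft L Z h).surjective l
      change secTmul (Sec.res L h k l) (toFree (k.trans h) 1) =
        Sec.res _ h k (secTmul l (toFree h 1))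
      rw [res_secTmul, toFree_res, map_one (B.ringRes k)])

lemma secMap_tmulOne (L : (A.tensor B.op).Mod V) (l : Sec L Z h) :
    secMap (tmulOne L) Z h (toRestrictLeft L Z h l) = secTmul l (toFree h 1) := rfl

/-- The right action `(l, b) ↦ l b` of `B` on the sections of an `A ⊗ Bᵒᵖ`-module. -/
noncomputable def rightAction (L : (A.tensor B.op).Mod V) (Z : Opens X) (h : Z ≤ V) :
    Sec L Z h →+ B.on Z →+ Sec L Z h :=
  AddMonoidHom.mk'
    (fun l => AddMonoidHom.mk' (fun b => rightRing A B Z (MulOpposite.op b) • l)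
      (fun b b' => by rw [MulOpposite.op_add, map_add, add_smul]))
    (fun l l' => AddMonoidHom.ext fun b => smul_add _ _ _)

lemma rightAction_apply (L : (A.tensor B.op).Mod V) (l : Sec L Z h) (b : B.on Z) :
    rightAction L Z h l b = rightRing A B Z (MulOpposite.op b) • l := rfl

lemma rightAction_mul (L : (A.tensor B.op).Mod V) (l : Sec L Z h) (b b' : B.on Z) :
    rightAction L Z h l (b * b') = rightAction L Z h (rightAction L Z h l b) b' := by
  rw [rightAction_apply, rightAction_apply, rightAction_apply, smul_smul, ← map_mul,
    MulOpposite.op_mul]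

lemma rightAction_one (L : (A.tensor B.op).Mod V) (l : Sec L Z h) :
    rightAction L Z h l 1 = l := by
  rw [rightAction_apply, MulOpposite.op_one, map_one, one_smul]

lemma rightAction_smul (L : (A.tensor B.op).Mod V) (a : A.on Z) (l : Sec L Z h) (b : B.on Z) :
    rightAction L Z h (leftRing A B Z a • l) b = leftRing A B Z a • rightAction L Z h l b := by
  rw [rightAction_apply, rightAction_apply, smul_smul, smul_smul, leftRing_mul_rightRing]

lemma res_rightAction (L : (A.tensor B.op).Mod V) (k : Y ≤ Z) (l : Sec L Z h) (b : B.on Z) :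
    Sec.res L h k (rightAction L Z h l b) =
      rightAction L Y (k.trans h) (Sec.res L h k l) (B.ringRes k b) := by
  rw [rightAction_apply, rightAction_apply, Sec.res_smul, ringRes_rightRing]

/-- The balanced map `L × B → L`, `(l, b) ↦ l b`. -/
noncomputable def balancedRightAction (L : (A.tensor B.op).Mod V) :
    BalancedMap L (B.free V) (restrictLeft L) where
  toHom Z h := AddMonoidHom.mk' (fun l => (toRestrictLeft L Z h).toAddMonoidHom.comp
      ((rightAction L Z h l).comp (toFree h).symm.toLinearMap.toAddMonoidHom))
    (fun l l' => by rw [map_add, AddMonoidHom.add_comp, AddMonoidHom.comp_add])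
  balanced Z h l b b' := by
    obtain ⟨b', rfl⟩ := (toFree h).surjective b'
    exact congrArg (toRestrictLeft L Z h) (rightAction_mul L l b b').symm
  smul Z h a l b :=
    congrArg (toRestrictLeft L Z h) (rightAction_smul L a l ((toFree h).symm b))
  res Z Y h k l b :=
    congrArg (toRestrictLeft L Y (k.trans h)) (res_rightAction L k l ((toFree h).symm b)).symm

lemma balancedRightAction_toHom (L : (A.tensor B.op).Mod V) (l : Sec L Z h) (b : B.on Z) :
    (balancedRightAction L).toHom Z h l (toFree h b) =
      toRestrictLeft L Z h (rightAction L Z h l b) := rfl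

/-- Every section of `L ⊗_B B` is uniquely of the form `l ⊗ 1`. -/
instance isIso_tmulOne (L : (A.tensor B.op).Mod V) : IsIso (tmulOne L) := by
  refine ⟨(balancedRightAction L).lift, hom_ext_sec fun Z h l => ?_,
    sheafTensor_hom_ext_sec fun Z h l b => ?_⟩
  · obtain ⟨l, rfl⟩ := (toRestrictLeft L Z h).surjective l
    rw [secMap_comp, secMap_tmulOne, BalancedMap.secMap_lift, balancedRightAction_toHom,
      rightAction_one, secMap_id]
  · obtain ⟨b, rfl⟩ := (toFree h).surjective b
    rw [secMap_comp, BalancedMap.secMap_lift, balancedRightAction_toHom, secMap_tmulOne,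
      rightAction_apply, secTmul_balanced, ← map_smul, smul_eq_mul, mul_one, secMap_id]

lemma bijective_secTmul_one (L : (A.tensor B.op).Mod V) (Z : Opens X) (h : Z ≤ V) :
    Function.Bijective (fun l : Sec L Z h => secTmul l (toFree (A := B) (V := V) h 1)) :=
  (bijective_sec_of_isIso (tmulOne L) Z h).comp (toRestrictLeft L Z h).bijective

end Bimodules

/-! ### Morphisms of bimodules -/

section

variable {A : SheafAlgebra O} {V Z Y : Opens X} {h : Z ≤ V}

/-- Sections that agree locally are equal. -/
lemma Sec.ext_of_sieve {M : A.Mod V} (S : Sieve Z) (hS : S ∈ Opens.grothendieckTopology X Z)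
    {m m' : Sec M Z h}
    (H : ∀ (Y : Opens X) (k : Y ≤ Z), S (homOfLE k) → Sec.res M h k m = Sec.res M h k m') :
    m = m' := by
  have hS' : (Sieve.overEquiv (Over.mk (homOfLE h))).symm S ∈
      (Opens.grothendieckTopology X).over V (Over.mk (homOfLE h)) := by
    rw [GrothendieckTopology.mem_over_iff]
    exact (congrArg (· ∈ Opens.grothendieckTopology X Z)
      ((Sieve.overEquiv (Over.mk (homOfLE h))).apply_symm_apply S)).mpr hS
  refine Presheaf.IsSheaf.isSeparated M.isSheaf _ _ hS' m m' ?_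
  intro T f hf
  exact H T.left (leOfHom f.left) ((Sieve.overEquiv_symm_iff S f).1 hf)

end

section

variable {A B : SheafAlgebra O} {Z Y : Opens X}

lemma leftRing_unit (r : O.obj.obj (Opposite.op Z)) :
    leftRing A B Z (A.unit _ r) = rightRing A B Z (MulOpposite.op (B.unit _ r)) := by
  refine congrArg ((toSheafify (Opens.grothendieckTopology X) (tensorPresheaf A B.op)).app
    (Opposite.op Z)).hom ?_
  exact Algebra.TensorProduct.tmul_one_eq_one_tmul r

/-- Every section of `A ⊗ Bᵒᵖ` is locally a sum of products `(a ⊗ 1) (1 ⊗ b)`. -/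
lemma tensor_induction {p : ∀ Y : Opens X, (A.tensor B.op).on Y → Prop} (t : (A.tensor B.op).on Z)
    (mul : ∀ Y a b, p Y (leftRing A B Y a * rightRing A B Y b))
    (add : ∀ Y s t, p Y s → p Y t → p Y (s + t)) :
    ∃ S ∈ Opens.grothendieckTopology X Z, ∀ (Y : Opens X) (k : Y ≤ Z), S (homOfLE k) →
      p Y ((A.tensor B.op).ringRes k t) := by
  let η := toSheafify (Opens.grothendieckTopology X) (tensorPresheaf A B.op)
  refine ⟨Presheaf.imageSieve η t, Presheaf.imageSieve_mem _ η t, ?_⟩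
  rintro Y k ⟨x, hx⟩
  change (η.app (Opposite.op Y)).hom x = (A.tensor B.op).ringRes k t at hx
  rw [← hx]
  clear hx
  have key : ∀ x : TensorProduct (O.obj.obj (Opposite.op Y)) (A.on Y) (B.op.on Y),
      p Y ((η.app (Opposite.op Y)).hom x) := by
    intro x
    induction x using TensorProduct.induction_on with
    | zero =>
      have := mul Y 0 0
      rw [map_zero, zero_mul] at this
      exact (congrArg (p Y) (map_zero (η.app (Opposite.op Y)).hom)).mpr this
    | tmul a b =>
      have hc : (a ⊗ₜ[O.obj.obj (Opposite.op Y)] (1 : B.op.on Y) :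
          TensorProduct (O.obj.obj (Opposite.op Y)) (A.on Y) (B.op.on Y)) * 1 ⊗ₜ b = a ⊗ₜ b := by
        rw [Algebra.TensorProduct.tmul_mul_tmul, one_mul, mul_one]
      refine (congrArg (p Y) ?_).mp (mul Y a b)
      refine (map_mul (η.app (Opposite.op Y)).hom _ _).symm.trans ?_
      exact congrArg (η.app (Opposite.op Y)).hom hc
    | add x y hx hy =>
      refine (congrArg (p Y) (map_add (η.app (Opposite.op Y)).hom x y)).mpr ?_
      exact add _ _ _ hx hy
  exact key x

variable {V : Opens X} {L L' : (A.tensor B.op).Mod V}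

/-- A family of additive maps that commute with restriction and are linear over `A` and `B` is
linear over `A ⊗ Bᵒᵖ`. -/
noncomputable def bimoduleHom (g : ∀ (Z : Opens X) (h : Z ≤ V), Sec L Z h →+ Sec L' Z h)
    (hl : ∀ Z h a l, g Z h (leftRing A B Z a • l) = leftRing A B Z a • g Z h l)
    (hr : ∀ Z h b l, g Z h (rightRing A B Z b • l) = rightRing A B Z b • g Z h l)
    (hres : ∀ (Z Y : Opens X) (h : Z ≤ V) (k : Y ≤ Z) (l : Sec L Z h),
      g Y (k.trans h) (Sec.res L h k l) = Sec.res L' h k (g Z h l)) : L ⟶ L' :=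
  homOfSec (fun Z h =>
    { g Z h with
      map_smul' := fun t l => by
        obtain ⟨S, hS, H⟩ := tensor_induction (p := fun Y t => ∀ (hY : Y ≤ V) (l : Sec L Y hY),
          g Y hY (t • l) = t • g Y hY l) t
          (fun Y a b hY l => by rw [mul_smul, mul_smul, hl, hr])
          (fun Y s t hs ht hY l => by rw [add_smul, add_smul, map_add, hs, ht])
        refine Sec.ext_of_sieve S hS fun Y k hk => ?_
        change Sec.res L' h k (g Z h (t • l)) = Sec.res L' h k (t • g Z h l)
        rw [← hres, Sec.res_smul, Sec.res_smul, ← hres]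
        exact H Y k hk (k.trans h) _ }) hres

end

/-! ### Full faithfulness -/

section

variable {A B : SheafAlgebra O} {U V W Z Y : Opens X}

lemma secMap_tensorRestrictIso (hV : V ≤ U) (k : W ≤ V) (hZ : Z ≤ W) (L : (A.tensor B.op).Mod U)
    (N : B.Mod V) (l : Sec L Z ((hZ.trans k).trans hV)) (n : Sec N Z (hZ.trans k)) :
    secMap (tensorRestrictIso hV k L N).hom Z hZ
      (secTmul (Sec.toRestrict (k.trans hV) L hZ l) (Sec.toRestrict k N hZ n)) =
    Sec.toRestrict k _ hZ (secTmul (Sec.toRestrict hV L (hZ.trans k) l) n) :=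
  tensorRestrictIso_tmul hV k L N (Y := Opposite.op (Over.mk (homOfLE hZ))) l n

section Linearity

variable {L L' : (A.tensor B.op).Mod V} {N N' : B.Mod V} {h : Z ≤ V}

lemma secTmul_unit_smul (r : O.obj.obj (Opposite.op Z)) (l : Sec L Z h) (n : Sec N Z h) :
    secTmul l (B.unit _ r • n) = A.unit _ r • secTmul l n := by
  rw [← secTmul_balanced, ← leftRing_unit, ← smul_secTmul]

lemma sheafTensorMap_add_right (f : L ⟶ L') (g g' : N ⟶ N') :
    sheafTensorMap f (g + g') = sheafTensorMap f g + sheafTensorMap f g' :=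
  sheafTensor_hom_ext_sec fun Z h l n => by
    rw [secMap_add, secMap_sheafTensorMap, secMap_sheafTensorMap, secMap_sheafTensorMap,
      secMap_add, secTmul_add_right]

lemma sheafTensorMap_add_left (f f' : L ⟶ L') (g : N ⟶ N') :
    sheafTensorMap (f + f') g = sheafTensorMap f g + sheafTensorMap f' g :=
  sheafTensor_hom_ext_sec fun Z h l n => by
    rw [secMap_add, secMap_sheafTensorMap, secMap_sheafTensorMap, secMap_sheafTensorMap,
      secMap_add, secTmul_add_left]

lemma sheafTensorMap_smul_right (r : O.obj.obj (Opposite.op V)) (f : L ⟶ L') (g : N ⟶ N') :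
    sheafTensorMap f (r • g) = r • sheafTensorMap f g :=
  sheafTensor_hom_ext_sec fun Z h l n => by
    rw [secMap_smul, secMap_sheafTensorMap, secMap_sheafTensorMap, secMap_smul, secTmul_unit_smul]

lemma unit_smul_secTmul (r : O.obj.obj (Opposite.op Z)) (l : Sec L Z h) (n : Sec N Z h) :
    secTmul ((A.tensor B.op).unit _ r • l) n = A.unit _ r • secTmul l n :=
  (smul_secTmul (A.unit _ r) l n).symm

lemma sheafTensorMap_smul_left (r : O.obj.obj (Opposite.op V)) (f : L ⟶ L') (g : N ⟶ N') :
    sheafTensorMap (r • f) g = r • sheafTensorMap f g :=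
  sheafTensor_hom_ext_sec fun Z h l n => by
    rw [secMap_smul, secMap_sheafTensorMap, secMap_sheafTensorMap, secMap_smul, unit_smul_secTmul]

/-- The functor `L ⊗_B (·)` is `O`-linear. -/
lemma isLinear_tensorFunctorOn (L : (A.tensor B.op).Mod U) : (tensorFunctorOn L).IsLinear where
  map_add _ _ _ _ g g' := sheafTensorMap_add_right (𝟙 _) g g'
  map_smul _ _ r _ _ g := sheafTensorMap_smul_right r (𝟙 _) g

/-- The functor `L ↦ L ⊗_B (·)` is `O`-linear. -/
lemma isLinear_tensorPrestackFunctor (A B : SheafAlgebra O)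
    (H : ∀ (U : Opens X) (_ : U ≤ ⊤) (L : (A.tensor B.op).Mod U),
      (tensorFunctorOn L).IsLinear ∧ (tensorFunctorOn L).HasRightAdjoint) :
    ((tensorPrestackFunctor A B).toHomRightAdjoint H).IsLinear where
  map_add _ _ _ _ f f' := ObjectProperty.hom_ext _ (FunctorOn.hom_ext fun _ hW N =>
    sheafTensorMap_add_left (((A.tensor B.op).restrict hW).map f)
      (((A.tensor B.op).restrict hW).map f') (𝟙 N))
  map_smul _ _ r _ _ f := ObjectProperty.hom_ext _ (FunctorOn.hom_ext fun _ hW N =>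
    (congrArg (sheafTensorMap · (𝟙 N)) ((A.tensor B.op).modPrestack.res_smul hW r f)).trans
      (sheafTensorMap_smul_left _ (((A.tensor B.op).restrict hW).map f) (𝟙 N)))

end Linearity

variable {L L' : (A.tensor B.op).Mod U}

/-- The component at `N` of a transformation `L ⊗_B (·) ⇒ L' ⊗_B (·)`. -/
noncomputable def transApp (α : tensorFunctorOn L ⟶ tensorFunctorOn L') (hV : V ≤ U) (N : B.Mod V) :
    sheafTensor (((A.tensor B.op).restrict hV).obj L) N ⟶
      sheafTensor (((A.tensor B.op).restrict hV).obj L') N :=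
  (α.app V hV).app N

variable (α : tensorFunctorOn L ⟶ tensorFunctorOn L')

lemma transApp_naturality (hV : V ≤ U) {N N' : B.Mod V} (g : N ⟶ N') :
    sheafTensorMap (𝟙 _) g ≫ transApp α hV N' = transApp α hV N ≫ sheafTensorMap (𝟙 _) g :=
  (α.app V hV).naturality g

lemma transApp_restrict (hV : V ≤ U) (k : W ≤ V) (N : B.Mod V) :
    transApp α (k.trans hV) ((B.restrict k).obj N) ≫ (tensorRestrictIso hV k L' N).hom =
      (tensorRestrictIso hV k L N).hom ≫ (A.restrict k).map (transApp α hV N) :=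
  α.naturality hV k N

/-- The bijection `l ↦ l ⊗ 1` from `L(Z)` to the sections of `L|_Z ⊗_B B|_Z` over `Z`. -/
noncomputable def tmulOneEquiv (L : (A.tensor B.op).Mod U) (Z : Opens X) (h : Z ≤ U) :
    Sec L Z h ≃+ Sec (sheafTensor (((A.tensor B.op).restrict h).obj L) (B.free Z)) Z le_rfl :=
  AddEquiv.ofBijective
    (AddMonoidHom.mk' (fun l => secTmul (Sec.toRestrict h L le_rfl l) (toFree le_rfl 1))
      (fun l l' => by rw [map_add, secTmul_add_left]))
    ((bijective_secTmul_one (((A.tensor B.op).restrict h).obj L) Z le_rfl).comp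
      (Sec.toRestrict h L le_rfl).bijective)

lemma tmulOneEquiv_apply (L : (A.tensor B.op).Mod U) (Z : Opens X) (h : Z ≤ U) (l : Sec L Z h) :
    tmulOneEquiv L Z h l = secTmul (Sec.toRestrict h L le_rfl l) (toFree le_rfl 1) := rfl

/-- The map `L(Z) → L'(Z)` induced by a transformation, which is obtained from its component at
`B|_Z` and the isomorphisms `L ⊗_B B ≅ L` and `L' ⊗_B B ≅ L'`. -/
noncomputable def transSec (Z : Opens X) (h : Z ≤ U) : Sec L Z h →+ Sec L' Z h :=
  ((tmulOneEquiv L' Z h).symm.toAddMonoidHom.comp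
    (secMap (transApp α h (B.free Z)) Z le_rfl).toAddMonoidHom).comp
      (tmulOneEquiv L Z h).toAddMonoidHom

/-- A transformation `L ⊗_B (·) ⇒ L' ⊗_B (·)` is determined by its components at the modules
`B|_Z`: it maps `l ⊗ n` to `l' ⊗ n`, where `l' ⊗ 1` is the image of `l ⊗ 1`, because `l ⊗ n` is the
image of `l ⊗ 1` by the morphism induced by `B|_Z ⟶ N|_Z`, `1 ↦ n`. -/
lemma secMap_transApp (hV : V ≤ U) (N : B.Mod V) (hZ : Z ≤ V) (l : Sec L Z (hZ.trans hV))
    (n : Sec N Z hZ) :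
    secMap (transApp α hV N) Z hZ (secTmul (Sec.toRestrict hV L hZ l) n) =
      secTmul (Sec.toRestrict hV L' hZ (transSec α Z (hZ.trans hV) l)) n := by
  have h₁ : secMap (transApp α (hZ.trans hV) (B.free Z)) Z le_rfl
      (secTmul (Sec.toRestrict (hZ.trans hV) L le_rfl l) (toFree le_rfl 1)) =
      secTmul (Sec.toRestrict (hZ.trans hV) L' le_rfl (transSec α Z (hZ.trans hV) l))
        (toFree le_rfl 1) :=
    ((tmulOneEquiv L' Z (hZ.trans hV)).apply_symm_apply _).symm
  let n' : Sec ((B.restrict hZ).obj N) Z le_rfl := Sec.toRestrict hZ N le_rfl n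
  have h₂ := congrArg (fun f => secMap f Z le_rfl
    (secTmul (Sec.toRestrict (hZ.trans hV) L le_rfl l) (toFree le_rfl 1)))
    (transApp_naturality α (hZ.trans hV) (freeHom n'))
  simp only [secMap_comp] at h₂
  rw [secMap_sheafTensorMap, h₁, secMap_sheafTensorMap, secMap_freeHom_one, secMap_id, secMap_id]
    at h₂
  have h₃ := congrArg (fun f => secMap f Z le_rfl
    (secTmul (Sec.toRestrict (hZ.trans hV) L le_rfl l) n')) (transApp_restrict α hV hZ N)
  simp only [secMap_comp] at h₃
  rw [secMap_tensorRestrictIso hV hZ le_rfl L N l n, secMap_toRestrict, h₂,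
    secMap_tensorRestrictIso hV hZ le_rfl L' N _ n] at h₃
  exact ((Sec.toRestrict hZ _ le_rfl).injective h₃).symm

lemma tmulOneEquiv_transSec (h : Z ≤ U) (l : Sec L Z h) :
    tmulOneEquiv L' Z h (transSec α Z h l) =
      secMap (transApp α h (B.free Z)) Z le_rfl (tmulOneEquiv L Z h l) :=
  (tmulOneEquiv L' Z h).apply_symm_apply _

lemma tmulOneEquiv_left (h : Z ≤ U) (a : A.on Z) (l : Sec L Z h) :
    tmulOneEquiv L Z h (leftRing A B Z a • l) = a • tmulOneEquiv L Z h l := by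
  rw [tmulOneEquiv_apply, map_smul, ← smul_secTmul, tmulOneEquiv_apply]

lemma tmulOneEquiv_right (h : Z ≤ U) (b : B.on Z) (l : Sec L Z h) :
    tmulOneEquiv L Z h (rightRing A B Z (MulOpposite.op b) • l) =
      secTmul (Sec.toRestrict h L le_rfl l) (toFree le_rfl b) := by
  rw [tmulOneEquiv_apply, map_smul, secTmul_balanced, ← map_smul, smul_eq_mul, mul_one]

/-- The morphism `L ⟶ L'` induced by a transformation `L ⊗_B (·) ⇒ L' ⊗_B (·)`. -/
noncomputable def homOfTrans : L ⟶ L' :=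
  bimoduleHom (transSec α)
    (fun Z h a l => by
      apply (tmulOneEquiv L' Z h).injective
      rw [tmulOneEquiv_transSec, tmulOneEquiv_left, tmulOneEquiv_left, map_smul,
        tmulOneEquiv_transSec])
    (fun Z h b l => by
      obtain ⟨b, rfl⟩ := MulOpposite.op_surjective b
      apply (tmulOneEquiv L' Z h).injective
      rw [tmulOneEquiv_transSec, tmulOneEquiv_right, tmulOneEquiv_right]
      exact secMap_transApp α h (B.free Z) le_rfl l (toFree le_rfl b))
    (fun Z Y h k l => by
      have h₁ := congrArg (Sec.res _ le_rfl k)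
        (secMap_transApp α h (B.free Z) le_rfl l (toFree le_rfl 1))
      rw [← secMap_res, res_secTmul, res_secTmul, Sec.res_toRestrict, Sec.res_toRestrict] at h₁
      have h₂ := secMap_transApp α h (B.free Z) k (Sec.res L h k l) (toFree k 1)
      have h₃ : Sec.res (B.free Z) le_rfl k (toFree le_rfl 1) = toFree k 1 :=
        (toFree_res k 1).trans (congrArg (toFree k) (map_one (B.ringRes k)))
      rw [h₃] at h₁
      have h₄ := (bijective_secTmul_one (((A.tensor B.op).restrict h).obj L') Y k).1
        (h₂.symm.trans h₁)
      exact (Sec.toRestrict h L' k).injective h₄)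

lemma tensorFunctorOnMap_homOfTrans : tensorFunctorOnMap (homOfTrans α) = α :=
  FunctorOn.hom_ext fun V hV N => sheafTensor_hom_ext_sec fun Z hZ l n => by
    obtain ⟨l, rfl⟩ := (Sec.toRestrict hV L hZ).surjective l
    refine Eq.trans ?_ (secMap_transApp α hV N hZ l n).symm
    exact secMap_sheafTensorMap _ (𝟙 N) _ n

lemma tensorFunctorOnMap_injective :
    Function.Injective (tensorFunctorOnMap : (L ⟶ L') → _) := by
  intro f f' hf
  refine hom_ext_sec fun Z h l => (tmulOneEquiv L' Z h).injective ?_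
  have h₁ : ∀ g : L ⟶ L', secMap (transApp (tensorFunctorOnMap g) h (B.free Z)) Z le_rfl
      (tmulOneEquiv L Z h l) = tmulOneEquiv L' Z h (secMap g Z h l) := fun g =>
    secMap_sheafTensorMap (((A.tensor B.op).restrict h).map g) (𝟙 _) _ _
  rw [← h₁, ← h₁, hf]

/-- The functor `L ↦ L ⊗_B (·)` over `U` is fully faithful. -/
noncomputable def fullyFaithfulTensorFunctorOn (A B : SheafAlgebra O) (U : Opens X) :
    (tensorFunctorOnFunctor A B U).FullyFaithful where
  preimage α := homOfTrans α
  map_preimage α := tensorFunctorOnMap_homOfTrans α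
  preimage_map _ := tensorFunctorOnMap_injective (tensorFunctorOnMap_homOfTrans _)

end

/-! ### The sheaf of `A`-linear homomorphisms -/

section

variable {A : SheafAlgebra O} {V Z : Opens X} {h : Z ≤ V}

/-- Compatible local sections can be glued. -/
lemma Sec.exists_glue (M : A.Mod V) (S : Sieve Z) (hS : S ∈ Opens.grothendieckTopology X Z)
    (m : ∀ (Y : Opens X) (k : Y ≤ Z), S (homOfLE k) → Sec M Y (k.trans h))
    (hm : ∀ (Y T : Opens X) (k : Y ≤ Z) (l : T ≤ Y) (hY : S (homOfLE k)),
      m T (l.trans k) (S.downward_closed hY (homOfLE l)) = Sec.res M (k.trans h) l (m Y k hY)) :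
    ∃ s : Sec M Z h, ∀ (Y : Opens X) (k : Y ≤ Z) (hY : S (homOfLE k)),
      Sec.res M h k s = m Y k hY := by
  have hS' : (Sieve.overEquiv (Over.mk (homOfLE h))).symm S ∈
      (Opens.grothendieckTopology X).over V (Over.mk (homOfLE h)) := by
    rw [GrothendieckTopology.mem_over_iff]
    exact (congrArg (· ∈ Opens.grothendieckTopology X Z)
      ((Sieve.overEquiv (Over.mk (homOfLE h))).apply_symm_apply S)).mpr hS
  have hM := (isSheaf_iff_isSheaf_of_type _ _).1
    ((Presheaf.isSheaf_iff_isSheaf_forget _ _ (forget AddCommGrpCat.{u})).1 M.isSheaf) _ hS'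
  let x : Presieve.FamilyOfElements (M.val.presheaf ⋙ forget AddCommGrpCat.{u})
      ((Sieve.overEquiv (Over.mk (homOfLE h))).symm S).arrows := fun T f hf =>
    m T.left (leOfHom f.left) ((Sieve.overEquiv_symm_iff S f).1 hf)
  have hx : x.Compatible := by
    rw [Presieve.compatible_iff_sieveCompatible]
    intro T T' f g hf
    exact hm T.left T'.left (leOfHom f.left) (leOfHom g.left) ((Sieve.overEquiv_symm_iff S f).1 hf)
  obtain ⟨s, hs, -⟩ := hM x hx
  exact ⟨s, fun Y k hY => hs (Over.homMk (homOfLE k) : Over.mk (homOfLE (k.trans h)) ⟶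
    Over.mk (homOfLE h)) ((Sieve.overEquiv_symm_iff S (Over.homMk (homOfLE k) :
      Over.mk (homOfLE (k.trans h)) ⟶ Over.mk (homOfLE h))).2 hY)⟩

end

section LocalHom

variable {A B : SheafAlgebra O} {V Z Y T : Opens X}

/-- The group of morphisms `L|_Z → M|_Z` of `A`-modules: families of `A`-linear maps
`L(Y) → M(Y)`, for `Y ⊆ Z`, that commute with restriction. -/
def localHom (L : (A.tensor B.op).Mod V) (M : A.Mod V) (Z : Opens X) (h : Z ≤ V) :
    AddSubgroup (∀ Y : {Y : Opens X // Y ≤ Z},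
      Sec L Y.1 (Y.2.trans h) →+ Sec M Y.1 (Y.2.trans h)) where
  carrier := {f |
    (∀ (Y : Opens X) (k : Y ≤ Z) (a : A.on Y) (l : Sec L Y (k.trans h)),
      f ⟨Y, k⟩ (leftRing A B Y a • l) = a • f ⟨Y, k⟩ l) ∧
    ∀ (Y T : Opens X) (k : Y ≤ Z) (j : T ≤ Y) (l : Sec L Y (k.trans h)),
      f ⟨T, j.trans k⟩ (Sec.res L (k.trans h) j l) = Sec.res M (k.trans h) j (f ⟨Y, k⟩ l)}
  zero_mem' := ⟨fun Y k a l => (smul_zero a).symm, fun Y T k j l => (map_zero _).symm⟩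
  add_mem' {f g} hf hg := ⟨fun Y k a l => by
      rw [Pi.add_apply, AddMonoidHom.add_apply, AddMonoidHom.add_apply, hf.1, hg.1, smul_add],
    fun Y T k j l => by
      rw [Pi.add_apply, Pi.add_apply, AddMonoidHom.add_apply, AddMonoidHom.add_apply, hf.2, hg.2,
        map_add]⟩
  neg_mem' {f} hf := ⟨fun Y k a l => by
      rw [Pi.neg_apply, AddMonoidHom.neg_apply, AddMonoidHom.neg_apply, hf.1, smul_neg],
    fun Y T k j l => by
      rw [Pi.neg_apply, Pi.neg_apply, AddMonoidHom.neg_apply, AddMonoidHom.neg_apply, hf.2,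
        map_neg]⟩

namespace localHom

variable {L : (A.tensor B.op).Mod V} {M M' : A.Mod V} {h : Z ≤ V}

/-- The value of a local homomorphism on the sections over `Y`. -/
def val (f : localHom L M Z h) (Y : Opens X) (k : Y ≤ Z) :
    Sec L Y (k.trans h) →+ Sec M Y (k.trans h) := f.1 ⟨Y, k⟩

lemma ext {f g : localHom L M Z h} (H : ∀ Y k l, val f Y k l = val g Y k l) : f = g :=
  Subtype.ext (funext fun Y => AddMonoidHom.ext fun l => H Y.1 Y.2 l)

lemma val_smul (f : localHom L M Z h) (k : Y ≤ Z) (a : A.on Y) (l : Sec L Y (k.trans h)) :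
    val f Y k (leftRing A B Y a • l) = a • val f Y k l := f.2.1 Y k a l

lemma val_res (f : localHom L M Z h) (k : Y ≤ Z) (j : T ≤ Y) (l : Sec L Y (k.trans h)) :
    val f T (j.trans k) (Sec.res L (k.trans h) j l) = Sec.res M (k.trans h) j (val f Y k l) :=
  f.2.2 Y T k j l

lemma ringRes_ringRes (b : B.on Z) (k : Y ≤ Z) (j : T ≤ Y) :
    B.ringRes j (B.ringRes k b) = B.ringRes (j.trans k) b :=
  (ConcreteCategory.congr_hom (B.ring.obj.map_comp (homOfLE k).op (homOfLE j).op) b).symm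

/-- The left action of `B`, given by `(b f)(l) = f(l b)`. -/
noncomputable instance : Module (B.on Z) (localHom L M Z h) where
  smul b f := ⟨fun Y => (val f Y.1 Y.2).comp (DistribSMul.toAddMonoidHom _
      (rightRing A B Y.1 (MulOpposite.op (B.ringRes Y.2 b)))),
    fun Y k a l => by
      refine Eq.trans (congrArg (val f Y k) ?_) (val_smul f k a _)
      exact (smul_smul _ _ l).trans ((congrArg (· • l) (leftRing_mul_rightRing a _).symm).trans
        (mul_smul _ _ l)),
    fun Y T k j l => by
      refine Eq.trans (congrArg (val f T (j.trans k)) ?_) (val_res f k j _)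
      refine Eq.trans ?_ (Sec.res_smul (M := L) j _ l).symm
      rw [ringRes_rightRing, ringRes_ringRes]
      rfl⟩
  one_smul f := ext fun Y k l => by
    change val f Y k (rightRing A B Y (MulOpposite.op (B.ringRes k 1)) • l) = val f Y k l
    rw [map_one, MulOpposite.op_one, map_one, one_smul]
  mul_smul b b' f := ext fun Y k l => by
    change val f Y k (rightRing A B Y (MulOpposite.op (B.ringRes k (b * b'))) • l) =
      val f Y k (rightRing A B Y (MulOpposite.op (B.ringRes k b')) •
        rightRing A B Y (MulOpposite.op (B.ringRes k b)) • l)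
    rw [map_mul, MulOpposite.op_mul, map_mul, mul_smul]
  smul_zero b := rfl
  smul_add b f g := rfl
  add_smul b b' f := ext fun Y k l => by
    change val f Y k (rightRing A B Y (MulOpposite.op (B.ringRes k (b + b'))) • l) =
      val f Y k (rightRing A B Y (MulOpposite.op (B.ringRes k b)) • l) +
        val f Y k (rightRing A B Y (MulOpposite.op (B.ringRes k b')) • l)
    rw [map_add, MulOpposite.op_add, map_add, add_smul, map_add]
  zero_smul f := ext fun Y k l => by
    change val f Y k (rightRing A B Y (MulOpposite.op (B.ringRes k 0)) • l) = 0
    rw [map_zero, MulOpposite.op_zero, map_zero, zero_smul, map_zero]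

lemma smul_val (b : B.on Z) (f : localHom L M Z h) (k : Y ≤ Z) (l : Sec L Y (k.trans h)) :
    val (b • f) Y k l = val f Y k (rightRing A B Y (MulOpposite.op (B.ringRes k b)) • l) := rfl

/-- The restriction of local homomorphisms. -/
def restr (h : Z ≤ V) (k : Y ≤ Z) : localHom L M Z h →+ localHom L M Y (k.trans h) where
  toFun f := ⟨fun T => val f T.1 (T.2.trans k),
    fun _ _ a l => val_smul f _ a l, fun _ _ _ j l => val_res f _ j l⟩
  map_zero' := rfl
  map_add' _ _ := rfl

lemma val_restr (f : localHom L M Z h) (k : Y ≤ Z) (j : T ≤ Y) (l : Sec L T (j.trans (k.trans h))) :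
    val (restr h k f) T j l = val f T (j.trans k) l := rfl

lemma restr_smul (k : Y ≤ Z) (b : B.on Z) (f : localHom L M Z h) :
    restr h k (b • f) = B.ringRes k b • restr h k f := ext fun T j l => by
  rw [val_restr, smul_val, smul_val, val_restr, ringRes_ringRes]

/-- Compatible local homomorphisms can be glued. -/
lemma exists_glue (S : Sieve Z) (hS : S ∈ Opens.grothendieckTopology X Z)
    (f : ∀ (Y : Opens X) (k : Y ≤ Z), S (homOfLE k) → localHom L M Y (k.trans h))
    (hf : ∀ (Y T : Opens X) (k : Y ≤ Z) (l : T ≤ Y) (hY : S (homOfLE k)),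
      f T (l.trans k) (S.downward_closed hY (homOfLE l)) = restr (k.trans h) l (f Y k hY)) :
    ∃ s : localHom L M Z h, ∀ (Y : Opens X) (k : Y ≤ Z) (hY : S (homOfLE k)),
      restr h k s = f Y k hY := by
  have hS' : ∀ (T : Opens X) (k : T ≤ Z), S.pullback (homOfLE k) ∈
      Opens.grothendieckTopology X T := fun T k =>
    (Opens.grothendieckTopology X).pullback_stable (homOfLE k) hS
  -- The value of the glued homomorphism at `l` is glued from the values of the `f Y` at the
  -- restrictions of `l`.
  have H : ∀ (T : Opens X) (k : T ≤ Z) (l : Sec L T (k.trans h)), ∃ m : Sec M T (k.trans h),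
      ∀ (Y : Opens X) (j : Y ≤ T) (hY : S (homOfLE (j.trans k))),
        Sec.res M (k.trans h) j m = val (f Y (j.trans k) hY) Y le_rfl (Sec.res L (k.trans h) j l) :=
    fun T k l => Sec.exists_glue M (S.pullback (homOfLE k)) (hS' T k)
      (fun Y j hY => val (f Y (j.trans k) hY) Y le_rfl (Sec.res L (k.trans h) j l))
      (fun Y Y' j i hY => by
        rw [← val_res _ le_rfl i, Sec.res_res, hf Y Y' (j.trans k) i hY, val_restr])
  choose s hs using H
  have huniq : ∀ (T : Opens X) (k : T ≤ Z) (m m' : Sec M T (k.trans h)),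
      (∀ (Y : Opens X) (j : Y ≤ T) (_ : S (homOfLE (j.trans k))),
        Sec.res M (k.trans h) j m = Sec.res M (k.trans h) j m') → m = m' := fun T k m m' hm =>
    Sec.ext_of_sieve (S.pullback (homOfLE k)) (hS' T k) hm
  have hadd : ∀ (T : Opens X) (k : T ≤ Z) (l l' : Sec L T (k.trans h)),
      s T k (l + l') = s T k l + s T k l' := fun T k l l' => huniq T k _ _ fun Y j hY => by
    rw [map_add, hs _ _ _ _ _ hY, hs _ _ _ _ _ hY, hs _ _ _ _ _ hY, map_add, map_add]
  have hsmul : ∀ (T : Opens X) (k : T ≤ Z) (a : A.on T) (l : Sec L T (k.trans h)),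
      s T k (leftRing A B T a • l) = a • s T k l := fun T k a l => huniq T k _ _ fun Y j hY => by
    rw [hs _ _ _ _ _ hY, Sec.res_smul, ringRes_leftRing, val_smul, Sec.res_smul,
      hs _ _ _ _ _ hY]
  have hres : ∀ (T T' : Opens X) (k : T ≤ Z) (i : T' ≤ T) (l : Sec L T (k.trans h)),
      s T' (i.trans k) (Sec.res L (k.trans h) i l) = Sec.res M (k.trans h) i (s T k l) :=
    fun T T' k i l => huniq T' (i.trans k) _ _ fun Y j hY => by
      rw [hs _ _ _ _ _ hY, Sec.res_res, Sec.res_res]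
      exact (hs T k l Y (j.trans i) hY).symm
  refine ⟨⟨fun T => AddMonoidHom.mk' (s T.1 T.2) (hadd T.1 T.2), hsmul, hres⟩, fun Y k hY => ?_⟩
  refine ext fun T j l => huniq T (j.trans k) _ _ fun Y' j' hY' => ?_
  refine (hs T (j.trans k) l Y' j' hY').trans ?_
  rw [← val_res, hf Y Y' k (j'.trans j) hY, val_restr]

/-- Local homomorphisms that agree locally are equal. -/
lemma ext_of_sieve (S : Sieve Z) (hS : S ∈ Opens.grothendieckTopology X Z)
    {f g : localHom L M Z h}
    (H : ∀ (Y : Opens X) (k : Y ≤ Z), S (homOfLE k) → restr h k f = restr h k g) : f = g :=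
  ext fun T k l => Sec.ext_of_sieve (S.pullback (homOfLE k))
    ((Opens.grothendieckTopology X).pullback_stable (homOfLE k) hS) fun Y j hY => by
      rw [← val_res, ← val_res]
      exact congrArg (fun s => val s Y le_rfl (Sec.res L (k.trans h) j l)) (H Y (j.trans k) hY)

end localHom

/-- The sheaf `Hom_A(L, M)`, which is a `B`-module through the right action of `B` on `L`. -/
noncomputable def homSheaf (L : (A.tensor B.op).Mod V) (M : A.Mod V) : B.Mod V where
  val :=
    letI F : (Over V)ᵒᵖ ⥤ AddCommGrpCat.{u} :=
      { obj := fun W => AddCommGrpCat.of (localHom L M W.unop.left (leOfHom W.unop.hom))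
        map := fun {W W'} i => AddCommGrpCat.ofHom
          (localHom.restr (leOfHom W.unop.hom) (leOfHom i.unop.left))
        map_id := fun _ => rfl
        map_comp := fun _ _ => rfl }
    letI : ∀ W, Module ((B.ring.over V).obj.obj W) (F.obj W) := fun W =>
      inferInstanceAs (Module (B.on W.unop.left) (localHom L M W.unop.left (leOfHom W.unop.hom)))
    PresheafOfModules.ofPresheaf F (fun W W' i b f =>
      localHom.restr_smul (leOfHom i.unop.left) b f)
  isSheaf := by
    rw [Presheaf.isSheaf_iff_isSheaf_forget _ _ (forget AddCommGrpCat.{u}),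
      isSheaf_iff_isSheaf_of_type]
    intro W S hS x hx
    rw [Presieve.compatible_iff_sieveCompatible] at hx
    have hS' := (GrothendieckTopology.mem_over_iff _ S).1 hS
    have hx' : ∀ (Y : Opens X) (k : Y ≤ W.left), Sieve.overEquiv W S (homOfLE k) →
        S (Over.homMk (homOfLE k) : Over.mk (homOfLE (k.trans (leOfHom W.hom))) ⟶ W) :=
      fun Y k hY => (Sieve.overEquiv_iff S (homOfLE k)).1 hY
    obtain ⟨s, hs⟩ := localHom.exists_glue (L := L) (M := M) (h := leOfHom W.hom)
      (Sieve.overEquiv W S) hS' (fun Y k hY => x _ (hx' Y k hY))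
      (fun Y T k l hY => hx _ (Over.homMk (homOfLE l)) (hx' Y k hY))
    refine ⟨s, fun T f hf => hs T.left (leOfHom f.left) ((Sieve.overEquiv_iff S f.left).2 hf),
      fun t ht => localHom.ext_of_sieve (Sieve.overEquiv W S) hS' fun Y k hY => ?_⟩
    exact (ht _ (hx' Y k hY)).trans (hs Y k hY).symm

section

variable {L : (A.tensor B.op).Mod V} {N N' : B.Mod V} {M M' : A.Mod V} {h : Z ≤ V}

/-- The identification of the sections of `Hom_A(L, M)` with the local homomorphisms. -/
noncomputable def toHomSheaf (L : (A.tensor B.op).Mod V) (M : A.Mod V) (h : Z ≤ V) :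
    localHom L M Z h ≃ₗ[B.on Z] Sec (homSheaf L M) Z h :=
  LinearEquiv.refl _ (localHom L M Z h)

/-- The morphism `Hom_A(L, M) ⟶ Hom_A(L, M')` given by the composition with `M ⟶ M'`. -/
noncomputable def homSheafMap (L : (A.tensor B.op).Mod V) (g : M ⟶ M') :
    homSheaf L M ⟶ homSheaf L M' :=
  homOfSec (fun Z h =>
    { toFun := fun f => toHomSheaf L M' h ⟨fun Y => (secMap g Y.1 (Y.2.trans h)).toAddMonoidHom.comp
          (((toHomSheaf L M h).symm f).1 Y),
        fun Y k a l => (congrArg (secMap g Y (k.trans h))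
            (localHom.val_smul ((toHomSheaf L M h).symm f) k a l)).trans (map_smul _ _ _),
        fun Y T k j l => (congrArg (secMap g T (j.trans (k.trans h)))
            (localHom.val_res ((toHomSheaf L M h).symm f) k j l)).trans (secMap_res _ _ _)⟩
      map_add' := fun f f' => by
        rw [← map_add]
        exact congrArg (toHomSheaf L M' h) (localHom.ext fun Y k l =>
          map_add (secMap g Y (k.trans h)) (localHom.val ((toHomSheaf L M h).symm f) Y k l)
            (localHom.val ((toHomSheaf L M h).symm f') Y k l))
      map_smul' := fun b f => by
        rw [RingHom.id_apply, ← map_smul]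
        exact congrArg (toHomSheaf L M' h) (localHom.ext fun Y k l => rfl) })
    (fun Z Y h k f => rfl)

/-- The value on a section of `L` of a section of `Hom_A(L, M)`. -/
noncomputable def homVal (f : Sec (homSheaf L M) Z h) (k : Y ≤ Z) :
    Sec L Y (k.trans h) →+ Sec M Y (k.trans h) :=
  localHom.val ((toHomSheaf L M h).symm f) Y k

lemma homSheaf_ext {f g : Sec (homSheaf L M) Z h}
    (H : ∀ (Y : Opens X) (k : Y ≤ Z) l, homVal f k l = homVal g k l) : f = g :=
  (toHomSheaf L M h).symm.injective (localHom.ext H)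

lemma homVal_add (f g : Sec (homSheaf L M) Z h) (k : Y ≤ Z) (l : Sec L Y (k.trans h)) :
    homVal (f + g) k l = homVal f k l + homVal g k l := rfl

lemma homVal_smul (b : B.on Z) (f : Sec (homSheaf L M) Z h) (k : Y ≤ Z)
    (l : Sec L Y (k.trans h)) : homVal (b • f) k l =
      homVal f k (rightRing A B Y (MulOpposite.op (B.ringRes k b)) • l) := rfl

lemma homVal_leftRing_smul (f : Sec (homSheaf L M) Z h) (k : Y ≤ Z) (a : A.on Y)
    (l : Sec L Y (k.trans h)) : homVal f k (leftRing A B Y a • l) = a • homVal f k l :=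
  localHom.val_smul ((toHomSheaf L M h).symm f) k a l

lemma homVal_res_right (f : Sec (homSheaf L M) Z h) (k : Y ≤ Z) (j : T ≤ Y)
    (l : Sec L Y (k.trans h)) :
    homVal f (j.trans k) (Sec.res L (k.trans h) j l) = Sec.res M (k.trans h) j (homVal f k l) :=
  localHom.val_res ((toHomSheaf L M h).symm f) k j l

lemma homVal_res (f : Sec (homSheaf L M) Z h) (k : Y ≤ Z) (j : T ≤ Y)
    (l : Sec L T (j.trans (k.trans h))) :
    homVal (Sec.res (homSheaf L M) h k f) j l = homVal f (j.trans k) l := rfl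

/-- The morphism `N ⟶ Hom_A(L, M)`, `n ↦ (l ↦ f(l ⊗ n))`. -/
noncomputable def curry (f : sheafTensor L N ⟶ M) : N ⟶ homSheaf L M :=
  homOfSec (fun Z h =>
    { toFun := fun n => toHomSheaf L M h ⟨fun Y => AddMonoidHom.mk'
          (fun l => secMap f Y.1 (Y.2.trans h) (secTmul l (Sec.res N h Y.2 n)))
          (fun l l' => by rw [secTmul_add_left, map_add]),
        fun Y k a l => by
          refine (congrArg (secMap f Y (k.trans h)) (smul_secTmul a l _).symm).trans ?_
          exact map_smul _ _ _,
        fun Y T k j l => by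
          refine Eq.trans ?_ (secMap_res f j _)
          refine congrArg (secMap f T (j.trans (k.trans h))) ?_
          rw [res_secTmul, Sec.res_res]⟩
      map_add' := fun n n' => homSheaf_ext fun Y k l => by
        change secMap f Y (k.trans h) (secTmul l (Sec.res N h k (n + n'))) =
          secMap f Y (k.trans h) (secTmul l (Sec.res N h k n)) +
            secMap f Y (k.trans h) (secTmul l (Sec.res N h k n'))
        rw [map_add, secTmul_add_right, map_add]
      map_smul' := fun b n => homSheaf_ext fun Y k l => by
        change secMap f Y (k.trans h) (secTmul l (Sec.res N h k (b • n))) =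
          secMap f Y (k.trans h) (secTmul (rightRing A B Y (MulOpposite.op (B.ringRes k b)) • l)
            (Sec.res N h k n))
        rw [Sec.res_smul, secTmul_balanced] })
    (fun Z Y h k n => homSheaf_ext fun T j l => by
      change secMap f T _ (secTmul l (Sec.res N _ j (Sec.res N h k n))) =
        secMap f T _ (secTmul l (Sec.res N h (j.trans k) n))
      rw [Sec.res_res])

lemma homVal_curry (f : sheafTensor L N ⟶ M) (n : Sec N Z h) (k : Y ≤ Z)
    (l : Sec L Y (k.trans h)) :
    homVal (secMap (curry f) Z h n) k l =
      secMap f Y (k.trans h) (secTmul l (Sec.res N h k n)) := rfl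

/-- The balanced map `(l, n) ↦ g(n)(l)`, for `g : N ⟶ Hom_A(L, M)`. -/
noncomputable def evalBalanced (g : N ⟶ homSheaf L M) : BalancedMap L N M where
  toHom Z h := AddMonoidHom.mk'
    (fun l => AddMonoidHom.mk' (fun n => homVal (secMap g Z h n) le_rfl l)
      (fun n n' => by rw [map_add, homVal_add]))
    (fun l l' => AddMonoidHom.ext fun n => map_add (homVal (secMap g Z h n) le_rfl) l l')
  balanced Z h l b n := by
    change homVal (secMap g Z h n) le_rfl (rightRing A B Z (MulOpposite.op b) • l) =
      homVal (secMap g Z h (b • n)) le_rfl l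
    rw [(secMap g Z h).map_smul, homVal_smul]
    have : B.ringRes le_rfl b = b :=
      ConcreteCategory.congr_hom (B.ring.obj.map_id (Opposite.op Z)) b
    rw [this]
  smul Z h a l n := homVal_leftRing_smul (secMap g Z h n) le_rfl a l
  res Z Y h k l n := by
    change homVal (secMap g Y (k.trans h) (Sec.res N h k n)) le_rfl (Sec.res L h k l) =
      Sec.res M h k (homVal (secMap g Z h n) le_rfl l)
    rw [secMap_res, homVal_res]
    exact homVal_res_right (secMap g Z h n) le_rfl k l

/-- The morphism `L ⊗_B N ⟶ M`, `l ⊗ n ↦ g(n)(l)`. -/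
noncomputable def uncurry (g : N ⟶ homSheaf L M) : sheafTensor L N ⟶ M := (evalBalanced g).lift

lemma secMap_uncurry (g : N ⟶ homSheaf L M) (l : Sec L Z h) (n : Sec N Z h) :
    secMap (uncurry g) Z h (secTmul l n) = homVal (secMap g Z h n) le_rfl l :=
  (evalBalanced g).secMap_lift l n

lemma uncurry_curry (f : sheafTensor L N ⟶ M) : uncurry (curry f) = f :=
  sheafTensor_hom_ext_sec fun Z h l n => by rw [secMap_uncurry, homVal_curry, Sec.res_self]

lemma curry_uncurry (g : N ⟶ homSheaf L M) : curry (uncurry g) = g :=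
  hom_ext_sec fun Z h n => homSheaf_ext fun Y k l => by
    rw [homVal_curry, secMap_uncurry, secMap_res, homVal_res]

lemma uncurry_comp (f : N ⟶ N') (g : N' ⟶ homSheaf L M) :
    uncurry (f ≫ g) = sheafTensorMap (𝟙 L) f ≫ uncurry g :=
  sheafTensor_hom_ext_sec fun Z h l n => by
    rw [secMap_uncurry, secMap_comp, secMap_comp, secMap_sheafTensorMap, secMap_uncurry, secMap_id]

/-- The functor `Hom_A(L, ·)`. -/
noncomputable def homFunctor (L : (A.tensor B.op).Mod V) : A.Mod V ⥤ B.Mod V where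
  obj := homSheaf L
  map := homSheafMap L

/-- The functor `L ⊗_B (·)` is left adjoint to `Hom_A(L, ·)`. -/
noncomputable def tensorHomAdjunction (L : (A.tensor B.op).Mod V) :
    tensorFunctor L ⊣ homFunctor L :=
  Adjunction.mkOfHomEquiv
    { homEquiv := fun N M =>
        { toFun := fun f => curry (L := L) (N := N) (M := M) f
          invFun := fun g => uncurry (L := L) (N := N) (M := M) g
          left_inv := uncurry_curry (L := L) (N := N) (M := M)
          right_inv := curry_uncurry (L := L) (N := N) (M := M) }
      homEquiv_naturality_left_symm := uncurry_comp
      homEquiv_naturality_right := fun _ _ => rfl }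

end

/-! ### The right adjoint of the tensor product, as a functor of stacks -/

section

variable {U W : Opens X}

/-- The identification of the sections of `L|_V` and of `L|_W` over an open subset of `W`. -/
noncomputable def Sec.restrictEquiv {R : SheafAlgebra O} (hV : V ≤ U) (k : W ≤ V) (L : R.Mod U)
    (h : Z ≤ W) : Sec ((R.restrict hV).obj L) Z (h.trans k) ≃ₗ[R.on Z]
      Sec ((R.restrict (k.trans hV)).obj L) Z h :=
  (Sec.toRestrict hV L (h.trans k)).symm.trans (Sec.toRestrict (k.trans hV) L h)

lemma Sec.res_restrictEquiv {R : SheafAlgebra O} (hV : V ≤ U) (k : W ≤ V) (L : R.Mod U)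
    (h : Z ≤ W) (j : Y ≤ Z) (l : Sec ((R.restrict hV).obj L) Z (h.trans k)) :
    Sec.res ((R.restrict (k.trans hV)).obj L) h j (Sec.restrictEquiv hV k L h l) =
      Sec.restrictEquiv hV k L (j.trans h) (Sec.res ((R.restrict hV).obj L) (h.trans k) j l) := rfl

/-- The identification of the local homomorphisms `L|_W → M|_W` and `L|_V → M` over an open
subset of `W`. -/
noncomputable def localHom.restrictEquiv (hV : V ≤ U) (k : W ≤ V) (L : (A.tensor B.op).Mod U)
    (M : A.Mod V) (h : Z ≤ W) :
    localHom (((A.tensor B.op).restrict (k.trans hV)).obj L) ((A.restrict k).obj M) Z h ≃ₗ[B.on Z]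
      localHom (((A.tensor B.op).restrict hV).obj L) M Z (h.trans k) where
  toFun f := ⟨fun Y => ((Sec.toRestrict k M (Y.2.trans h)).symm.toAddEquiv.toAddMonoidHom.comp
      (val f Y.1 Y.2)).comp (Sec.restrictEquiv hV k L (Y.2.trans h)).toAddEquiv.toAddMonoidHom,
    fun Y j a l => by
      change (Sec.toRestrict k M _).symm (val f Y j (Sec.restrictEquiv hV k L _ _)) =
        a • (Sec.toRestrict k M _).symm (val f Y j (Sec.restrictEquiv hV k L _ _))
      rw [LinearEquiv.map_smul, val_smul, LinearEquiv.map_smul],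
    fun Y T j i l => by
      change (Sec.toRestrict k M _).symm (val f T (i.trans j) (Sec.restrictEquiv hV k L _ _)) =
        Sec.res M _ i ((Sec.toRestrict k M _).symm (val f Y j (Sec.restrictEquiv hV k L _ l)))
      rw [← Sec.res_restrictEquiv, val_res]
      rfl⟩
  map_add' f g := rfl
  map_smul' b f := rfl
  invFun f := ⟨fun Y => ((Sec.toRestrict k M (Y.2.trans h)).toAddEquiv.toAddMonoidHom.comp
      (val f Y.1 Y.2)).comp (Sec.restrictEquiv hV k L (Y.2.trans h)).symm.toAddEquiv.toAddMonoidHom,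
    fun Y j a l => by
      change (Sec.toRestrict k M _) (val f Y j ((Sec.restrictEquiv hV k L _).symm _)) =
        a • (Sec.toRestrict k M _) (val f Y j ((Sec.restrictEquiv hV k L _).symm _))
      rw [LinearEquiv.map_smul, val_smul, LinearEquiv.map_smul],
    fun Y T j i l => by
      obtain ⟨l, rfl⟩ := (Sec.restrictEquiv hV k L (j.trans h)).surjective l
      change (Sec.toRestrict k M _) (val f T (i.trans j) ((Sec.restrictEquiv hV k L _).symm _)) =
        Sec.res _ _ i ((Sec.toRestrict k M _) (val f Y j ((Sec.restrictEquiv hV k L _).symm _)))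
      rw [Sec.res_restrictEquiv, LinearEquiv.symm_apply_apply, LinearEquiv.symm_apply_apply,
        Sec.res_toRestrict, ← val_res]⟩
  left_inv f := rfl
  right_inv f := rfl

/-- The identification of the sections of `Hom_A(L|_W, M|_W)` and of `Hom_A(L|_V, M)|_W`. -/
noncomputable def homSheafRestrictEquiv (hV : V ≤ U) (k : W ≤ V) (L : (A.tensor B.op).Mod U)
    (M : A.Mod V) (h : Z ≤ W) :
    Sec (homSheaf (((A.tensor B.op).restrict (k.trans hV)).obj L) ((A.restrict k).obj M)) Z h
      ≃ₗ[B.on Z]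
      Sec ((B.restrict k).obj (homSheaf (((A.tensor B.op).restrict hV).obj L) M)) Z h :=
  (toHomSheaf _ _ h).symm.trans ((localHom.restrictEquiv hV k L M h).trans
    ((toHomSheaf _ _ (h.trans k)).trans (Sec.toRestrict k _ h)))

/-- The morphism `Hom_A(L|_W, M|_W) ⟶ Hom_A(L|_V, M)|_W`, which identifies the sections. -/
noncomputable def homSheafRestrictHom (hV : V ≤ U) (k : W ≤ V) (L : (A.tensor B.op).Mod U)
    (M : A.Mod V) :
    homSheaf (((A.tensor B.op).restrict (k.trans hV)).obj L) ((A.restrict k).obj M) ⟶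
      (B.restrict k).obj (homSheaf (((A.tensor B.op).restrict hV).obj L) M) :=
  homOfSec (fun _ h => (homSheafRestrictEquiv hV k L M h).toLinearMap) (fun _ _ _ _ _ => rfl)

lemma isIso_homSheafRestrictHom (hV : V ≤ U) (k : W ≤ V) (L : (A.tensor B.op).Mod U)
    (M : A.Mod V) : IsIso (homSheafRestrictHom hV k L M) :=
  isIso_of_bijective_sec _ fun _ h => (homSheafRestrictEquiv hV k L M h).bijective

lemma homSheafRestrictHom_naturality (hV : V ≤ U) (k : W ≤ V) (L : (A.tensor B.op).Mod U)
    {M M' : A.Mod V} (g : M ⟶ M') :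
    homSheafMap (((A.tensor B.op).restrict (k.trans hV)).obj L) ((A.restrict k).map g) ≫
        homSheafRestrictHom hV k L M' =
      homSheafRestrictHom hV k L M ≫
        (B.restrict k).map (homSheafMap (((A.tensor B.op).restrict hV).obj L) g) :=
  hom_ext_sec fun _ h _ => (Sec.toRestrict k _ h).symm.injective (homSheaf_ext fun _ _ _ => rfl)

lemma homSheafRestrictHom_comp {T : Opens X} (hV : V ≤ U) (k : W ≤ V) (j : T ≤ W)
    (L : (A.tensor B.op).Mod U) (M : A.Mod V) :
    homSheafMap (((A.tensor B.op).restrict (j.trans (k.trans hV))).obj L)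
        ((A.modPrestack.resComp k j).hom.app M) ≫ homSheafRestrictHom hV (j.trans k) L M =
      homSheafRestrictHom (k.trans hV) j L ((A.restrict k).obj M) ≫
        (B.restrict j).map (homSheafRestrictHom hV k L M) ≫
          (B.modPrestack.resComp k j).hom.app (homSheaf (((A.tensor B.op).restrict hV).obj L) M) :=
  hom_ext_sec fun _ h _ => (Sec.toRestrict (j.trans k) _ h).symm.injective
    (homSheaf_ext fun _ _ _ => rfl)

/-- The functor `Hom_A(L, ·) : Mod(A)|_U → Mod(B)|_U`. -/
noncomputable def homFunctorOn (L : (A.tensor B.op).Mod U) :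
    FunctorOn U A.modPrestack.toPrestack B.modPrestack.toPrestack where
  app _ hV := homFunctor (((A.tensor B.op).restrict hV).obj L)
  iso hV k := NatIso.ofComponents (fun M =>
      @asIso _ _ _ _ (homSheafRestrictHom hV k L M) (isIso_homSheafRestrictHom hV k L M))
    (homSheafRestrictHom_naturality hV k L)
  iso_comp hV k j M := homSheafRestrictHom_comp hV k j L M

lemma curry_res (hV : V ≤ U) (k : W ≤ V) (L : (A.tensor B.op).Mod U) (N : B.Mod V) (M : A.Mod V)
    (f : sheafTensor (((A.tensor B.op).restrict hV).obj L) N ⟶ M) :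
    curry ((tensorRestrictIso hV k L N).hom ≫ (A.restrict k).map f) ≫
        homSheafRestrictHom hV k L M =
      (B.restrict k).map (curry f) :=
  hom_ext_sec fun Z h n => by
    obtain ⟨n, rfl⟩ := (Sec.toRestrict k N h).surjective n
    refine (toHomSheaf (((A.tensor B.op).restrict hV).obj L) M (h.trans k)).symm.injective ?_
    refine localHom.ext fun Y j l => ?_
    exact congrArg (secMap ((A.restrict k).map f) Y (j.trans h))
      (secMap_tensorRestrictIso hV k (j.trans h) L N l (Sec.res N (h.trans k) j n))

/-- The functor `L ⊗_B (·)` admits the right adjoint `Hom_A(L, ·)`. -/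
lemma hasRightAdjoint_tensorFunctorOn (L : (A.tensor B.op).Mod U) :
    (tensorFunctorOn L).HasRightAdjoint :=
  ⟨homFunctorOn L, ⟨{
    adj := fun _ hV => tensorHomAdjunction (((A.tensor B.op).restrict hV).obj L)
    res_homEquiv := fun hV k N M f => curry_res hV k L N M f }⟩⟩

end

end LocalHom

/-! ### Modules with a right action -/

section

open scoped TensorProduct

variable {A : SheafAlgebra O} {V Z Y : Opens X} {h : Z ≤ V}

/-- A right action of `B` on an `A`-module `M`, by `A`-linear endomorphisms, for which the two
actions of `O` agree. -/
structure RightAction (B : SheafAlgebra O) (M : A.Mod V) where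
  /-- The action `m ↦ m b`. -/
  act : ∀ (Z : Opens X) (h : Z ≤ V), B.on Z → Sec M Z h →ₗ[A.on Z] Sec M Z h
  act_one : ∀ (Z : Opens X) (h : Z ≤ V) (m : Sec M Z h), act Z h 1 m = m
  act_mul : ∀ (Z : Opens X) (h : Z ≤ V) (b b' : B.on Z) (m : Sec M Z h),
    act Z h (b * b') m = act Z h b' (act Z h b m)
  act_add : ∀ (Z : Opens X) (h : Z ≤ V) (b b' : B.on Z) (m : Sec M Z h),
    act Z h (b + b') m = act Z h b m + act Z h b' m
  act_unit : ∀ (Z : Opens X) (h : Z ≤ V) (r : O.obj.obj (Opposite.op Z)) (m : Sec M Z h),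
    act Z h (B.unit _ r) m = A.unit _ r • m
  act_res : ∀ (Z Y : Opens X) (h : Z ≤ V) (k : Y ≤ Z) (b : B.on Z) (m : Sec M Z h),
    act Y (k.trans h) (B.ringRes k b) (Sec.res M h k m) = Sec.res M h k (act Z h b m)

namespace RightAction

variable {B : SheafAlgebra O} {M : A.Mod V} (ρ : RightAction B M)

/-- The sections of `M` as a module over `O`. -/
@[reducible]
noncomputable def sectionModule (M : A.Mod V) (Z : Opens X) (h : Z ≤ V) :
    Module (O.obj.obj (Opposite.op Z)) (Sec M Z h) := Module.compHom _ (A.unit (Opposite.op Z))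

/-- The action of `A(Z) ⊗ B(Z)ᵒᵖ` on `M(Z)`. -/
noncomputable def tensorEnd (Z : Opens X) (h : Z ≤ V) :
    A.on Z ⊗[O.obj.obj (Opposite.op Z)] B.op.on Z →+* AddMonoid.End (Sec M Z h) :=
  letI := sectionModule M Z h
  haveI : IsScalarTower (O.obj.obj (Opposite.op Z)) (A.on Z) (Sec M Z h) :=
    ⟨fun r a m => mul_smul (A.unit (Opposite.op Z) r) a m⟩
  (Module.toAddMonoidEnd (Module.End (O.obj.obj (Opposite.op Z)) (Sec M Z h)) (Sec M Z h)).comp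
    (Algebra.TensorProduct.lift
      (Algebra.lsmul (O.obj.obj (Opposite.op Z)) (O.obj.obj (Opposite.op Z)) (Sec M Z h))
      ({ toFun := fun b => (ρ.act Z h (MulOpposite.unop b)).restrictScalars _
         map_one' := LinearMap.ext fun m => ρ.act_one Z h m
         map_mul' := fun b b' => LinearMap.ext fun m => ρ.act_mul Z h _ _ m
         map_zero' := LinearMap.ext fun m => by
          have := ρ.act_add Z h 0 0 m
          rw [add_zero, left_eq_add] at this
          exact this
         map_add' := fun b b' => LinearMap.ext fun m => ρ.act_add Z h _ _ m
         commutes' := fun r => LinearMap.ext fun m => ρ.act_unit Z h r m } :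
        B.op.on Z →ₐ[O.obj.obj (Opposite.op Z)]
          Module.End (O.obj.obj (Opposite.op Z)) (Sec M Z h))
      (fun a b => LinearMap.ext fun m =>
        ((ρ.act Z h (MulOpposite.unop b)).map_smul a m).symm)).toRingHom

lemma tensorEnd_tmul (a : A.on Z) (b : B.op.on Z) (m : Sec M Z h) :
    ρ.tensorEnd Z h (a ⊗ₜ b) m = a • ρ.act Z h (MulOpposite.unop b) m := rfl

variable (A B) in
/-- The restriction `A(Z) ⊗ B(Z)ᵒᵖ → A(Y) ⊗ B(Y)ᵒᵖ`. -/
noncomputable def tensorRes (k : Y ≤ Z) :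
    A.on Z ⊗[O.obj.obj (Opposite.op Z)] B.op.on Z →+*
      A.on Y ⊗[O.obj.obj (Opposite.op Y)] B.op.on Y :=
  ((tensorPresheaf A B.op).map (homOfLE k).op).hom

lemma tensorRes_tmul (k : Y ≤ Z) (a : A.on Z) (b : B.op.on Z) :
    tensorRes A B k (a ⊗ₜ b) = A.ringRes k a ⊗ₜ B.op.ringRes k b :=
  tensorPresheaf_map_tmul A B.op (homOfLE k).op a b

lemma res_tensorEnd (k : Y ≤ Z) (t : A.on Z ⊗[O.obj.obj (Opposite.op Z)] B.op.on Z)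
    (m : Sec M Z h) : Sec.res M h k (ρ.tensorEnd Z h t m) =
      ρ.tensorEnd Y (k.trans h) (tensorRes A B k t) (Sec.res M h k m) := by
  induction t using TensorProduct.induction_on with
  | zero =>
    rw [map_zero, map_zero, map_zero]
    exact map_zero _
  | tmul a b =>
    rw [tensorRes_tmul, tensorEnd_tmul, tensorEnd_tmul, Sec.res_smul, ← ρ.act_res]
    rfl
  | add s t hs ht =>
    rw [map_add, map_add, map_add]
    exact (map_add _ _ _).trans (congrArg₂ (· + ·) hs ht)

/-- The presheaf of `A ⊗ Bᵒᵖ`-modules given by a right action. -/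
noncomputable def presheafModule :
    PresheafOfModules.{u} ((Over.forget V).op ⋙ tensorPresheaf A B.op) :=
  letI : ∀ W, Module (((Over.forget V).op ⋙ tensorPresheaf A B.op).obj W)
      (M.val.presheaf.obj W) := fun W =>
    letI : Module (A.on W.unop.left ⊗[O.obj.obj (Opposite.op W.unop.left)] B.op.on W.unop.left)
      (Sec M W.unop.left (leOfHom W.unop.hom)) :=
      Module.compHom _ (ρ.tensorEnd W.unop.left (leOfHom W.unop.hom))
    this
  PresheafOfModules.ofPresheaf M.val.presheaf (fun W _ i t m =>
    ρ.res_tensorEnd (h := leOfHom W.unop.hom) (leOfHom i.unop.left) t m)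

/-- The morphism from the presheaf `A ⊗ Bᵒᵖ` on `V` to its associated sheaf. -/
noncomputable def tensorUnitOver (A B : SheafAlgebra O) (V : Opens X) :
    (Over.forget V).op ⋙ tensorPresheaf A B.op ⟶ ((A.tensor B.op).ring.over V).obj :=
  Functor.whiskerLeft (Over.forget V).op
    (toSheafify (Opens.grothendieckTopology X) (tensorPresheaf A B.op))

instance : Presheaf.IsLocallyInjective ((Opens.grothendieckTopology X).over V)
    (tensorUnitOver A B V) :=
  Presheaf.isLocallyInjective_whisker _ (Opens.grothendieckTopology X) (Over.forget V)
    (toSheafify (Opens.grothendieckTopology X) (tensorPresheaf A B.op))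

instance : Presheaf.IsLocallySurjective ((Opens.grothendieckTopology X).over V)
    (tensorUnitOver A B V) :=
  Presheaf.isLocallySurjective_whisker _ (Opens.grothendieckTopology X) (Over.forget V)
    (toSheafify (Opens.grothendieckTopology X) (tensorPresheaf A B.op))

/-- The sheaf of abelian groups underlying an `A`-module. -/
noncomputable def underlyingSheaf (M : A.Mod V) :
    Sheaf ((Opens.grothendieckTopology X).over V) AddCommGrpCat.{u} := ⟨M.val.presheaf, M.isSheaf⟩

/-- The identity, from the presheaf underlying `presheafModule` to the sheaf underlying `M`. -/
noncomputable def toUnderlyingSheaf : ρ.presheafModule.presheaf ⟶ (underlyingSheaf M).obj :=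
  𝟙 M.val.presheaf

instance : Presheaf.IsLocallyInjective ((Opens.grothendieckTopology X).over V)
    ρ.toUnderlyingSheaf :=
  inferInstanceAs (Presheaf.IsLocallyInjective _ (𝟙 M.val.presheaf))

instance : Presheaf.IsLocallySurjective ((Opens.grothendieckTopology X).over V)
    ρ.toUnderlyingSheaf :=
  inferInstanceAs (Presheaf.IsLocallySurjective _ (𝟙 M.val.presheaf))

/-- The `A ⊗ Bᵒᵖ`-module given by a right action of `B`. Its underlying sheaf is that of `M`, which
is already a sheaf, so that the sheafification of `presheafModule` only extends the scalars. -/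
noncomputable def toModule : (A.tensor B.op).Mod V :=
  PresheafOfModules.sheafify (tensorUnitOver A B V) ρ.toUnderlyingSheaf

/-- The identification of the sections of `M` and of the `A ⊗ Bᵒᵖ`-module given by a right
action. -/
noncomputable def toSec (Z : Opens X) (h : Z ≤ V) : Sec M Z h ≃+ Sec ρ.toModule Z h :=
  AddEquiv.refl (Sec M Z h)

variable (A B) in
/-- The morphism `A(Z) ⊗ B(Z)ᵒᵖ → (A ⊗ Bᵒᵖ)(Z)`. -/
noncomputable def tensorUnit (Z : Opens X) :
    A.on Z ⊗[O.obj.obj (Opposite.op Z)] B.op.on Z →+* (A.tensor B.op).on Z :=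
  ((toSheafify (Opens.grothendieckTopology X) (tensorPresheaf A B.op)).app (Opposite.op Z)).hom

lemma smul_toSec (t : A.on Z ⊗[O.obj.obj (Opposite.op Z)] B.op.on Z) (m : Sec M Z h) :
    tensorUnit A B Z t • ρ.toSec Z h m = ρ.toSec Z h (ρ.tensorEnd Z h t m) := by
  let W : (Over V)ᵒᵖ := Opposite.op (Over.mk (homOfLE h))
  let α := tensorUnitOver A B V
  have key := PresheafOfModules.Sheafify.map_smul_eq α ρ.toUnderlyingSheaf (X := W) (α.app W t) m
    (𝟙 W) t (ConcreteCategory.congr_hom (((A.tensor B.op).ring.over V).obj.map_id W)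
      (α.app W t)).symm m
    (ConcreteCategory.congr_hom ((underlyingSheaf M).obj.map_id W) m).symm
  refine Eq.trans ?_ key
  exact (ConcreteCategory.congr_hom ((underlyingSheaf M).obj.map_id W)
    (PresheafOfModules.Sheafify.smul α ρ.toUnderlyingSheaf (X := W) (α.app W t) m)).symm

lemma leftRing_smul_toSec (a : A.on Z) (m : Sec M Z h) :
    leftRing A B Z a • ρ.toSec Z h m = ρ.toSec Z h (a • m) := by
  refine (ρ.smul_toSec (a ⊗ₜ (1 : B.op.on Z)) m).trans (congrArg (ρ.toSec Z h) ?_)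
  exact (ρ.tensorEnd_tmul a 1 m).trans (congrArg (a • ·) (ρ.act_one Z h m))

lemma rightRing_smul_toSec (b : B.on Z) (m : Sec M Z h) :
    rightRing A B Z (MulOpposite.op b) • ρ.toSec Z h m = ρ.toSec Z h (ρ.act Z h b m) := by
  refine (ρ.smul_toSec ((1 : A.on Z) ⊗ₜ (MulOpposite.op b : B.op.on Z)) m).trans
    (congrArg (ρ.toSec Z h) ?_)
  exact (ρ.tensorEnd_tmul 1 (MulOpposite.op b) m).trans (one_smul _ _)

end RightAction

end

/-! ### The bimodule of a functor -/

section

variable {A B : SheafAlgebra O} {U V W Z Y : Opens X}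

/-- The morphism `(B|_U)|_Z ⟶ N`, `b ↦ b n`, for a section `n` of `N` on `Z`. -/
noncomputable def restrictFreeHom (h : Z ≤ U) {N : B.Mod Z} (n : Sec N Z le_rfl) :
    (B.restrict h).obj (B.free U) ⟶ N :=
  homOfSec (fun Y k => ((LinearMap.toSpanSingleton (B.on Y) _ (Sec.res N le_rfl k n)).comp
      (toFree (k.trans h)).symm.toLinearMap).comp
        (Sec.toRestrict h (B.free U) k).symm.toLinearMap)
    (fun Y T k j b => by
      obtain ⟨b, rfl⟩ := (Sec.toRestrict h (B.free U) k).surjective b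
      obtain ⟨b, rfl⟩ := (toFree (k.trans h)).surjective b
      change B.ringRes j b • Sec.res N le_rfl (j.trans k) n =
        Sec.res N k j (b • Sec.res N le_rfl k n)
      rw [Sec.res_smul, Sec.res_res])

lemma secMap_restrictFreeHom (h : Z ≤ U) {N : B.Mod Z} (n : Sec N Z le_rfl) (k : Y ≤ Z)
    (b : B.on Y) : secMap (restrictFreeHom h n) Y k
      (Sec.toRestrict h (B.free U) k (toFree (k.trans h) b)) = b • Sec.res N le_rfl k n := rfl

lemma restrictFree_hom_ext {h : Z ≤ U} {N : B.Mod Z} {f g : (B.restrict h).obj (B.free U) ⟶ N}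
    (H : ∀ (Y : Opens X) (k : Y ≤ Z) (b : B.on Y),
      secMap f Y k (Sec.toRestrict h (B.free U) k (toFree (k.trans h) b)) =
        secMap g Y k (Sec.toRestrict h (B.free U) k (toFree (k.trans h) b))) : f = g :=
  hom_ext_sec fun Y k b => by
    obtain ⟨b, rfl⟩ := (Sec.toRestrict h (B.free U) k).surjective b
    obtain ⟨b, rfl⟩ := (toFree (k.trans h)).surjective b
    exact H Y k b

lemma restrictFreeHom_add (h : Z ≤ U) {N : B.Mod Z} (n n' : Sec N Z le_rfl) :
    restrictFreeHom h (n + n') = restrictFreeHom h n + restrictFreeHom h n' :=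
  restrictFree_hom_ext fun Y k b => by
    rw [secMap_add, secMap_restrictFreeHom, secMap_restrictFreeHom, secMap_restrictFreeHom,
      map_add, smul_add]

lemma restrictFreeHom_unit_smul (h : Z ≤ U) {N : B.Mod Z} (r : O.obj.obj (Opposite.op Z))
    (n : Sec N Z le_rfl) :
    restrictFreeHom h (B.unit _ r • n) = r • restrictFreeHom h n :=
  restrictFree_hom_ext fun Y k b => by
    have e : B.ringRes k (B.unit _ r) = B.unit _ (O.obj.map (homOfLE k).op r) :=
      (B.unit_map (homOfLE k).op r).symm
    rw [secMap_smul, secMap_restrictFreeHom, secMap_restrictFreeHom, Sec.res_smul, e, smul_smul,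
      smul_smul, B.unit_comm]

lemma restrictFreeHom_comp (h : Z ≤ U) {N N' : B.Mod Z} (n : Sec N Z le_rfl) (g : N ⟶ N') :
    restrictFreeHom h n ≫ g = restrictFreeHom h (secMap g Z le_rfl n) :=
  restrictFree_hom_ext fun Y k b => by
    rw [secMap_comp, secMap_restrictFreeHom, secMap_restrictFreeHom, map_smul, ← secMap_res]

lemma restrictFreeHom_one (h : Z ≤ U) :
    restrictFreeHom h (Sec.toRestrict h (B.free U) le_rfl (toFree h 1)) =
      𝟙 ((B.restrict h).obj (B.free U)) :=
  restrictFree_hom_ext fun Y k b => by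
    rw [secMap_restrictFreeHom, secMap_id, Sec.res_toRestrict, toFree_res, ← map_smul, ← map_smul,
      map_one (B.ringRes k), smul_eq_mul, mul_one]

/-- The canonical morphism `(M|_V)|_W ⟶ M|_W`. -/
noncomputable def restrictComp {R : SheafAlgebra O} (hV : V ≤ U) (k : W ≤ V) (M : R.Mod U) :
    (R.restrict k).obj ((R.restrict hV).obj M) ⟶ (R.restrict (k.trans hV)).obj M :=
  (R.modPrestack.resComp hV k).hom.app M

lemma restrictComp_comp_restrictFreeHom (h : Z ≤ U) (k : Y ≤ Z) {N : B.Mod Z} (n : Sec N Z le_rfl) :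
    restrictComp h k (B.free U) ≫ restrictFreeHom (k.trans h)
        (Sec.toRestrict k N le_rfl (Sec.res N le_rfl k n)) =
      (B.restrict k).map (restrictFreeHom h n) :=
  hom_ext_sec fun T j b => by
    obtain ⟨b, rfl⟩ := (Sec.toRestrict k ((B.restrict h).obj (B.free U)) j).surjective b
    obtain ⟨b, rfl⟩ := (Sec.toRestrict h (B.free U) (j.trans k)).surjective b
    obtain ⟨b, rfl⟩ := (toFree (j.trans (k.trans h))).surjective b
    refine Eq.trans ?_ (congrArg (Sec.toRestrict k N j)
      (secMap_restrictFreeHom h n (j.trans k) b).symm)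
    refine (secMap_restrictFreeHom (k.trans h) _ j b).trans ?_
    rw [Sec.res_toRestrict, Sec.res_res, map_smul]

end

section

variable {A B : SheafAlgebra O} {U V W Z Y : Opens X}
  (φ : FunctorOn U B.modPrestack.toPrestack A.modPrestack.toPrestack)

/-- The module `φ(N)`. -/
noncomputable def funObj (hV : V ≤ U) (N : B.Mod V) : A.Mod V := (φ.app V hV).obj N

/-- The morphism `φ(f)`. -/
noncomputable def funMap (hV : V ≤ U) {N N' : B.Mod V} (f : N ⟶ N') :
    funObj φ hV N ⟶ funObj φ hV N' :=
  (φ.app V hV).map f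

/-- The morphism `φ(N|_W) ⟶ φ(N)|_W`. -/
noncomputable def funRes (hV : V ≤ U) (k : W ≤ V) (N : B.Mod V) :
    funObj φ (k.trans hV) ((B.restrict k).obj N) ⟶ (A.restrict k).obj (funObj φ hV N) :=
  (φ.iso hV k).hom.app N

lemma funMap_comp (hV : V ≤ U) {N N' N'' : B.Mod V} (f : N ⟶ N') (g : N' ⟶ N'') :
    funMap φ hV (f ≫ g) = funMap φ hV f ≫ funMap φ hV g := (φ.app V hV).map_comp f g

lemma funMap_id (hV : V ≤ U) (N : B.Mod V) : funMap φ hV (𝟙 N) = 𝟙 _ := (φ.app V hV).map_id N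

lemma funRes_naturality (hV : V ≤ U) (k : W ≤ V) {N N' : B.Mod V} (f : N ⟶ N') :
    funMap φ (k.trans hV) ((B.restrict k).map f) ≫ funRes φ hV k N' =
      funRes φ hV k N ≫ (A.restrict k).map (funMap φ hV f) := (φ.iso hV k).hom.naturality f

lemma funRes_comp (hV : V ≤ U) (k : W ≤ V) (j : Y ≤ W) (N : B.Mod V) :
    funMap φ (j.trans (k.trans hV)) (restrictComp k j N) ≫
        funRes φ hV (j.trans k) N =
      funRes φ (k.trans hV) j ((B.restrict k).obj N) ≫ (A.restrict j).map (funRes φ hV k N) ≫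
        restrictComp k j (funObj φ hV N) := φ.iso_comp hV k j N

lemma isIso_funRes (hV : V ≤ U) (k : W ≤ V) (N : B.Mod V) : IsIso (funRes φ hV k N) :=
  ((φ.iso hV k).app N).isIso_hom

/-- The identification of the sections of `φ(N|_W)` and of `φ(N)` over an open subset of `W`. -/
noncomputable def funSec (hV : V ≤ U) (k : W ≤ V) (N : B.Mod V) (h : Z ≤ W) :
    Sec (funObj φ (k.trans hV) ((B.restrict k).obj N)) Z h ≃ₗ[A.on Z]
      Sec (funObj φ hV N) Z (h.trans k) :=
  (LinearEquiv.ofBijective (secMap (funRes φ hV k N) Z h)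
    (@bijective_sec_of_isIso _ _ _ _ _ _ _ (funRes φ hV k N) (isIso_funRes φ hV k N) Z h)).trans
    (Sec.toRestrict k (funObj φ hV N) h).symm

lemma toRestrict_funSec (hV : V ≤ U) (k : W ≤ V) (N : B.Mod V) (h : Z ≤ W)
    (x : Sec (funObj φ (k.trans hV) ((B.restrict k).obj N)) Z h) :
    Sec.toRestrict k (funObj φ hV N) h (funSec φ hV k N h x) = secMap (funRes φ hV k N) Z h x :=
  rfl

lemma res_funSec (hV : V ≤ U) (k : W ≤ V) (N : B.Mod V) (h : Z ≤ W) (j : Y ≤ Z)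
    (x : Sec (funObj φ (k.trans hV) ((B.restrict k).obj N)) Z h) :
    Sec.res _ (h.trans k) j (funSec φ hV k N h x) =
      funSec φ hV k N (j.trans h) (Sec.res _ h j x) := by
  apply (Sec.toRestrict k (funObj φ hV N) (j.trans h)).injective
  rw [← Sec.res_toRestrict, toRestrict_funSec, toRestrict_funSec, secMap_res]

lemma funSec_map (hV : V ≤ U) (k : W ≤ V) {N N' : B.Mod V} (f : N ⟶ N') (h : Z ≤ W)
    (x : Sec (funObj φ (k.trans hV) ((B.restrict k).obj N)) Z h) :
    funSec φ hV k N' h (secMap (funMap φ (k.trans hV) ((B.restrict k).map f)) Z h x) =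
      secMap (funMap φ hV f) Z (h.trans k) (funSec φ hV k N h x) := by
  apply (Sec.toRestrict k (funObj φ hV N') h).injective
  rw [← secMap_toRestrict, toRestrict_funSec, toRestrict_funSec, ← secMap_comp, ← secMap_comp,
    funRes_naturality]

/-- The identifications `funSec` for `Y ⊆ W ⊆ V` compose to the one for `Y ⊆ V`, up to the canonical
morphism `(N|_W)|_Y ⟶ N|_Y`. -/
lemma funSec_funSec (hV : V ≤ U) (k : W ≤ V) (j : Y ≤ W) (N : B.Mod V) (h : Z ≤ Y)
    (x : Sec (funObj φ (j.trans (k.trans hV)) ((B.restrict j).obj ((B.restrict k).obj N))) Z h) :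
    funSec φ hV k N (h.trans j) (funSec φ (k.trans hV) j ((B.restrict k).obj N) h x) =
      funSec φ hV (j.trans k) N h
        (secMap (funMap φ (j.trans (k.trans hV)) (restrictComp k j N)) Z h x) := by
  have e := congrArg (fun f => secMap f Z h x) (funRes_comp φ hV k j N)
  exact (congrArg (Sec.toRestrict (j.trans k) (funObj φ hV N) h).symm e).symm

/-- The module `φ(B|_U)`. -/
noncomputable abbrev funFree : A.Mod U := funObj φ le_rfl (B.free U)

/-- The map `φ(B)(Z) → φ(N)(Z)` given by a section `n` of `N` on `Z`, that is, by the image under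
`φ` of the morphism `B|_Z ⟶ N|_Z`, `b ↦ b n`. -/
noncomputable def funEval (hV : V ≤ U) (hZ : Z ≤ V) {N : B.Mod V} (n : Sec N Z hZ) :
    Sec (funFree φ) Z (hZ.trans hV) →ₗ[A.on Z] Sec (funObj φ hV N) Z hZ :=
  ((funSec φ hV hZ N le_rfl).toLinearMap.comp
    (secMap (funMap φ (hZ.trans hV) (restrictFreeHom (hZ.trans hV) (Sec.toRestrict hZ N le_rfl n)))
      Z le_rfl)).comp (funSec φ le_rfl (hZ.trans hV) (B.free U) le_rfl).symm.toLinearMap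

lemma funEval_funSec (hV : V ≤ U) (hZ : Z ≤ V) {N : B.Mod V} (n : Sec N Z hZ)
    (x : Sec (funObj φ (hZ.trans hV) ((B.restrict (hZ.trans hV)).obj (B.free U))) Z le_rfl) :
    funEval φ hV hZ n (funSec φ le_rfl (hZ.trans hV) (B.free U) le_rfl x) =
      funSec φ hV hZ N le_rfl (secMap (funMap φ (hZ.trans hV)
        (restrictFreeHom (hZ.trans hV) (Sec.toRestrict hZ N le_rfl n))) Z le_rfl x) := by
  change funSec φ hV hZ N le_rfl (secMap _ Z le_rfl
    ((funSec φ le_rfl (hZ.trans hV) (B.free U) le_rfl).symm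
      (funSec φ le_rfl (hZ.trans hV) (B.free U) le_rfl x))) = _
  rw [LinearEquiv.symm_apply_apply]

lemma funEval_map (hV : V ≤ U) (hZ : Z ≤ V) {N N' : B.Mod V} (g : N ⟶ N') (n : Sec N Z hZ)
    (l : Sec (funFree φ) Z (hZ.trans hV)) :
    secMap (funMap φ hV g) Z hZ (funEval φ hV hZ n l) = funEval φ hV hZ (secMap g Z hZ n) l := by
  obtain ⟨x, rfl⟩ := (funSec φ le_rfl (hZ.trans hV) (B.free U) le_rfl).surjective l
  refine (congrArg _ (funEval_funSec φ hV hZ n x)).trans ?_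
  refine Eq.trans ?_ (funEval_funSec φ hV hZ _ x).symm
  refine (funSec_map φ hV hZ g le_rfl _).symm.trans ?_
  rw [← secMap_comp, ← funMap_comp, restrictFreeHom_comp, secMap_toRestrict]

/-- The maps `funEval` compose as the sections of `B` act on those of `N`. -/
lemma funEval_smul (hV : V ≤ U) (hZ : Z ≤ V) {N : B.Mod V} (b : B.on Z) (n : Sec N Z hZ)
    (l : Sec (funFree φ) Z (hZ.trans hV)) :
    funEval φ hV hZ (b • n) l = funEval φ hV hZ n
      (funEval φ le_rfl (hZ.trans hV) (toFree (A := B) (V := U) (hZ.trans hV) b) l) := by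
  obtain ⟨x, rfl⟩ := (funSec φ le_rfl (hZ.trans hV) (B.free U) le_rfl).surjective l
  refine (funEval_funSec φ hV hZ _ x).trans ?_
  refine Eq.trans ?_ (congrArg (funEval φ hV hZ n)
    (funEval_funSec φ le_rfl (hZ.trans hV) (toFree (A := B) (V := U) (hZ.trans hV) b) x)).symm
  refine Eq.trans ?_ (funEval_funSec φ hV hZ n _).symm
  rw [← secMap_comp, ← funMap_comp, restrictFreeHom_comp, secMap_restrictFreeHom, Sec.res_self,
    map_smul]

lemma funEval_one (h : Z ≤ U) (l : Sec (funFree φ) Z h) :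
    funEval φ le_rfl h (toFree (A := B) (V := U) h 1) l = l := by
  obtain ⟨x, rfl⟩ := (funSec φ le_rfl h (B.free U) le_rfl).surjective l
  refine (funEval_funSec φ le_rfl h _ x).trans ?_
  rw [restrictFreeHom_one, funMap_id, secMap_id]

lemma res_funEval (hV : V ≤ U) (hZ : Z ≤ V) (k : Y ≤ Z) {N : B.Mod V} (n : Sec N Z hZ)
    (l : Sec (funFree φ) Z (hZ.trans hV)) :
    Sec.res _ hZ k (funEval φ hV hZ n l) =
      funEval φ hV (k.trans hZ) (Sec.res N hZ k n) (Sec.res _ (hZ.trans hV) k l) := by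
  obtain ⟨x, rfl⟩ := (funSec φ le_rfl (hZ.trans hV) (B.free U) le_rfl).surjective l
  -- The restriction of `x` to `Y` comes from a section `y` of `φ((B|_Z)|_Y)`. The two sides come
  -- from the images of `y` under `φ` of the two composites in `restrictComp_comp_restrictFreeHom`.
  obtain ⟨y, hy⟩ := (funSec φ (hZ.trans hV) k
    ((B.restrict (hZ.trans hV)).obj (B.free U)) le_rfl).surjective (Sec.res _ le_rfl k x)
  refine (congrArg _ (funEval_funSec φ hV hZ n x)).trans ?_
  refine (res_funSec φ hV hZ N le_rfl k _).trans ?_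
  rw [← secMap_res, ← hy, ← funSec_map]
  refine (funSec_funSec φ hV hZ k N le_rfl _).trans ?_
  have h₁ := (res_funSec φ le_rfl (hZ.trans hV) (B.free U) le_rfl k x).trans
    ((congrArg _ hy.symm).trans
      (funSec_funSec φ le_rfl (hZ.trans hV) k (B.free U) le_rfl y))
  refine Eq.trans ?_ (congrArg (funEval φ hV (k.trans hZ) (Sec.res N hZ k n)) h₁).symm
  refine Eq.trans ?_ (funEval_funSec φ hV (k.trans hZ) (Sec.res N hZ k n) _).symm
  rw [← secMap_comp, ← secMap_comp, ← funMap_comp, ← funMap_comp,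
    ← restrictComp_comp_restrictFreeHom (hZ.trans hV) k (Sec.toRestrict hZ N le_rfl n),
    Category.assoc, restrictFreeHom_comp]
  rfl

/-- The maps `funEval` are compatible with the restriction of `φ`. -/
lemma funSec_funEval (hV : V ≤ U) (k : W ≤ V) (h : Z ≤ W) (N : B.Mod V) (n : Sec N Z (h.trans k))
    (l : Sec (funFree φ) Z ((h.trans k).trans hV)) :
    funSec φ hV k N h (funEval φ (k.trans hV) h (Sec.toRestrict k N h n) l) =
      funEval φ hV (h.trans k) n l := by
  obtain ⟨x, rfl⟩ := (funSec φ le_rfl ((h.trans k).trans hV) (B.free U) le_rfl).surjective l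
  refine (congrArg _ (funEval_funSec φ (k.trans hV) h (Sec.toRestrict k N h n) x)).trans ?_
  refine Eq.trans ?_ (funEval_funSec φ hV (h.trans k) n x).symm
  refine (funSec_funSec φ hV k h N le_rfl _).trans ?_
  rw [← secMap_comp, ← funMap_comp, restrictFreeHom_comp]
  rfl

section

variable {φ}

lemma funEval_add (hφ : φ.IsLinear) (hV : V ≤ U) (hZ : Z ≤ V) {N : B.Mod V} (n n' : Sec N Z hZ)
    (l : Sec (funFree φ) Z (hZ.trans hV)) :
    funEval φ hV hZ (n + n') l = funEval φ hV hZ n l + funEval φ hV hZ n' l := by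
  obtain ⟨x, rfl⟩ := (funSec φ le_rfl (hZ.trans hV) (B.free U) le_rfl).surjective l
  have e : ∀ f g : (B.restrict (hZ.trans hV)).obj (B.free U) ⟶ (B.restrict hZ).obj N,
      funMap φ (hZ.trans hV) (f + g) = funMap φ (hZ.trans hV) f + funMap φ (hZ.trans hV) g :=
    hφ.map_add Z (hZ.trans hV)
  refine (funEval_funSec φ hV hZ _ x).trans ?_
  refine Eq.trans ?_ (congrArg₂ (· + ·) (funEval_funSec φ hV hZ n x)
    (funEval_funSec φ hV hZ n' x)).symm
  rw [map_add, restrictFreeHom_add, e, secMap_add, map_add]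

lemma funEval_unit (hφ : φ.IsLinear) (h : Z ≤ U) (r : O.obj.obj (Opposite.op Z))
    (l : Sec (funFree φ) Z h) :
    funEval φ le_rfl h (toFree (A := B) (V := U) h (B.unit _ r)) l = A.unit _ r • l := by
  obtain ⟨x, rfl⟩ := (funSec φ le_rfl h (B.free U) le_rfl).surjective l
  have e : ∀ f : (B.restrict h).obj (B.free U) ⟶ (B.restrict h).obj (B.free U),
      funMap φ h (r • f) = r • funMap φ h f := hφ.map_smul Z h r
  have e₁ : toFree (A := B) (V := U) h (B.unit _ r) = B.unit _ r • toFree h 1 := by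
    rw [← map_smul, smul_eq_mul, mul_one]
  have e₂ : O.obj.map (homOfLE (le_refl Z)).op r = r :=
    ConcreteCategory.congr_hom (O.obj.map_id (Opposite.op Z)) r
  refine (funEval_funSec φ le_rfl h _ x).trans ?_
  rw [e₁, map_smul, restrictFreeHom_unit_smul, e, restrictFreeHom_one, funMap_id, secMap_smul, e₂,
    secMap_id, map_smul]

/-- The right action of `B` on `φ(B)`, induced by the right action of `B` on itself. -/
noncomputable def funRightAction (hφ : φ.IsLinear) : RightAction B (funFree φ) where
  act _ h b := funEval φ le_rfl h (toFree h b)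
  act_one _ h l := funEval_one φ h l
  act_mul _ h b b' l := funEval_smul φ le_rfl h b (toFree h b') l
  act_add _ h b b' l :=
    (congrArg (fun n => funEval φ le_rfl h n l) (map_add (toFree h) b b')).trans
      (funEval_add hφ le_rfl h _ _ l)
  act_unit _ h r l := funEval_unit hφ h r l
  act_res _ _ h k b l := (res_funEval φ le_rfl h k (toFree h b) l).symm

/-- The `A ⊗ Bᵒᵖ`-module `φ(B)`. -/
noncomputable def funModule (hφ : φ.IsLinear) : (A.tensor B.op).Mod U :=
  (funRightAction hφ).toModule

/-- The identification of the sections of `φ(B)` as an `A`-module and as an `A ⊗ Bᵒᵖ`-module. -/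
noncomputable def toFunModule (hφ : φ.IsLinear) (hV : V ≤ U) (hZ : Z ≤ V) :
    Sec (funFree φ) Z (hZ.trans hV) ≃+
      Sec (((A.tensor B.op).restrict hV).obj (funModule hφ)) Z hZ :=
  ((funRightAction hφ).toSec Z (hZ.trans hV)).trans
    (Sec.toRestrict hV (funModule hφ) hZ).toAddEquiv

lemma leftRing_smul_toFunModule (hφ : φ.IsLinear) (hV : V ≤ U) (hZ : Z ≤ V) (a : A.on Z)
    (l : Sec (funFree φ) Z (hZ.trans hV)) :
    leftRing A B Z a • toFunModule hφ hV hZ l = toFunModule hφ hV hZ (a • l) :=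
  congrArg (Sec.toRestrict hV (funModule hφ) hZ) ((funRightAction hφ).leftRing_smul_toSec a l)

lemma rightRing_smul_toFunModule (hφ : φ.IsLinear) (hV : V ≤ U) (hZ : Z ≤ V) (b : B.on Z)
    (l : Sec (funFree φ) Z (hZ.trans hV)) :
    rightRing A B Z (MulOpposite.op b) • toFunModule hφ hV hZ l =
      toFunModule hφ hV hZ (funEval φ le_rfl (hZ.trans hV) (toFree (hZ.trans hV) b) l) :=
  congrArg (Sec.toRestrict hV (funModule hφ) hZ) ((funRightAction hφ).rightRing_smul_toSec b l)

/-! ### The transformation `φ(B) ⊗_B (·) ⇒ φ` -/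

/-- The balanced map `φ(B) × N → φ(N)`. -/
noncomputable def funBalanced (hφ : φ.IsLinear) (hV : V ≤ U) (N : B.Mod V) :
    BalancedMap (((A.tensor B.op).restrict hV).obj (funModule hφ)) N (funObj φ hV N) where
  toHom Z h := AddMonoidHom.mk'
    (fun l => AddMonoidHom.mk' (fun n => funEval φ hV h n ((toFunModule hφ hV h).symm l))
      (fun n n' => funEval_add hφ hV h n n' _))
    (fun l l' => AddMonoidHom.ext fun n =>
      (congrArg (funEval φ hV h n) (map_add (toFunModule hφ hV h).symm l l')).trans
        (map_add (funEval φ hV h n) _ _))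
  balanced Z h l b n := by
    obtain ⟨l, rfl⟩ := (toFunModule hφ hV h).surjective l
    change funEval φ hV h n ((toFunModule hφ hV h).symm
      (rightRing A B Z (MulOpposite.op b) • toFunModule hφ hV h l)) =
        funEval φ hV h (b • n) ((toFunModule hφ hV h).symm (toFunModule hφ hV h l))
    rw [rightRing_smul_toFunModule, AddEquiv.symm_apply_apply, AddEquiv.symm_apply_apply,
      funEval_smul]
  smul Z h a l n := by
    obtain ⟨l, rfl⟩ := (toFunModule hφ hV h).surjective l
    change funEval φ hV h n ((toFunModule hφ hV h).symm
      (leftRing A B Z a • toFunModule hφ hV h l)) =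
        a • funEval φ hV h n ((toFunModule hφ hV h).symm (toFunModule hφ hV h l))
    rw [leftRing_smul_toFunModule, AddEquiv.symm_apply_apply, AddEquiv.symm_apply_apply, map_smul]
  res Z Y h k l n := by
    obtain ⟨l, rfl⟩ := (toFunModule hφ hV h).surjective l
    exact (res_funEval φ hV h k n l).symm

/-- The morphism `φ(B) ⊗_B N ⟶ φ(N)`. -/
noncomputable def funTensor (hφ : φ.IsLinear) (hV : V ≤ U) (N : B.Mod V) :
    sheafTensor (((A.tensor B.op).restrict hV).obj (funModule hφ)) N ⟶ funObj φ hV N :=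
  (funBalanced hφ hV N).lift

lemma secMap_funTensor (hφ : φ.IsLinear) (hV : V ≤ U) (N : B.Mod V) (h : Z ≤ V)
    (l : Sec (funFree φ) Z (h.trans hV)) (n : Sec N Z h) :
    secMap (funTensor hφ hV N) Z h (secTmul (toFunModule hφ hV h l) n) = funEval φ hV h n l :=
  (funBalanced hφ hV N).secMap_lift _ n

lemma funTensor_naturality (hφ : φ.IsLinear) (hV : V ≤ U) {N N' : B.Mod V} (g : N ⟶ N') :
    sheafTensorMap (𝟙 _) g ≫ funTensor hφ hV N' = funTensor hφ hV N ≫ funMap φ hV g :=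
  sheafTensor_hom_ext_sec fun Z h l n => by
    obtain ⟨l, rfl⟩ := (toFunModule hφ hV h).surjective l
    rw [secMap_comp, secMap_comp, secMap_sheafTensorMap, secMap_id, secMap_funTensor,
      secMap_funTensor, funEval_map]

lemma funTensor_restrict (hφ : φ.IsLinear) (hV : V ≤ U) (k : W ≤ V) (N : B.Mod V) :
    funTensor hφ (k.trans hV) ((B.restrict k).obj N) ≫ funRes φ hV k N =
      (tensorRestrictIso hV k (funModule hφ) N).hom ≫ (A.restrict k).map (funTensor hφ hV N) :=
  sheafTensor_hom_ext_sec fun Z h l n => by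
    obtain ⟨l, rfl⟩ := (toFunModule hφ (k.trans hV) h).surjective l
    obtain ⟨n, rfl⟩ := (Sec.toRestrict k N h).surjective n
    refine (congrArg (secMap (funRes φ hV k N) Z h)
      (secMap_funTensor hφ (k.trans hV) _ h l (Sec.toRestrict k N h n))).trans ?_
    refine Eq.trans ?_ (congrArg (secMap ((A.restrict k).map (funTensor hφ hV N)) Z h)
      (secMap_tensorRestrictIso hV k h (funModule hφ) N
        ((funRightAction hφ).toSec Z _ l) n)).symm
    rw [← toRestrict_funSec, funSec_funEval, secMap_toRestrict]
    exact congrArg (Sec.toRestrict k (funObj φ hV N) h)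
      (secMap_funTensor hφ hV N (h.trans k) l n).symm

/-- The transformation `φ(B) ⊗_B (·) ⇒ φ`. -/
noncomputable def funTrans (hφ : φ.IsLinear) : tensorFunctorOn (funModule hφ) ⟶ φ where
  app _ hV :=
    { app := fun N => funTensor hφ hV N
      naturality := fun _ _ g => funTensor_naturality hφ hV g }
  naturality hV k N := funTensor_restrict hφ hV k N

lemma bijective_funEval_one (hY : Y ≤ U) (h : Z ≤ Y) :
    Function.Bijective (funEval φ hY h (toFree (A := B) (V := Y) h 1)) := by
  have h₁ : IsIso (restrictFreeHom (h.trans hY)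
      (Sec.toRestrict h (B.free Y) le_rfl (toFree h 1))) :=
    isIso_of_bijective_sec _ fun T k => by
      have e : ⇑(secMap (restrictFreeHom (h.trans hY)
          (Sec.toRestrict h (B.free Y) le_rfl (toFree h 1))) T k) =
          ((Sec.toRestrict (h.trans hY) (B.free U) k).symm.trans
            ((toFree (k.trans (h.trans hY))).symm.trans
              ((toFree (k.trans h)).trans (Sec.toRestrict h (B.free Y) k)))) := by
        funext b
        obtain ⟨b, rfl⟩ := (Sec.toRestrict (h.trans hY) (B.free U) k).surjective b
        obtain ⟨b, rfl⟩ := (toFree (k.trans (h.trans hY))).surjective b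
        rw [secMap_restrictFreeHom, Sec.res_toRestrict, toFree_res, ← map_smul, ← map_smul,
          map_one (B.ringRes k), smul_eq_mul, mul_one]
        rfl
      rw [e]
      exact LinearEquiv.bijective _
  have h₂ : IsIso (funMap φ (h.trans hY) (restrictFreeHom (h.trans hY)
      (Sec.toRestrict h (B.free Y) le_rfl (toFree h 1)))) :=
    ((φ.app Z (h.trans hY)).mapIso (@asIso _ _ _ _ _ h₁)).isIso_hom
  exact ((funSec φ hY h (B.free Y) le_rfl).bijective.comp (bijective_sec_of_isIso _ Z le_rfl)).comp
    (funSec φ le_rfl (h.trans hY) (B.free U) le_rfl).symm.bijective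

/-- The morphism `φ(B) ⊗_B B|_Y ⟶ φ(B|_Y)` is invertible. -/
lemma isIso_funTensor_free (hφ : φ.IsLinear) (hY : Y ≤ U) :
    IsIso (funTensor hφ hY (B.free Y)) :=
  isIso_of_bijective_sec _ fun Z h => by
    refine (Function.Bijective.of_comp_iff _ ((bijective_secTmul_one
      (((A.tensor B.op).restrict hY).obj (funModule hφ)) Z h).comp
        (toFunModule hφ hY h).bijective)).1 ?_
    have e : ⇑(secMap (funTensor hφ hY (B.free Y)) Z h) ∘ ((fun l => secTmul l (toFree h 1)) ∘
        toFunModule hφ hY h) = funEval φ hY h (toFree h 1) :=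
      funext fun l => secMap_funTensor hφ hY (B.free Y) h l (toFree h 1)
    rw [e]
    exact bijective_funEval_one hY h

/-- An `O`-functor that admits a right adjoint is the tensor product with a bimodule: the two
functors of the transformation `φ(B) ⊗_B (·) ⇒ φ` admit right adjoints, and it is invertible on
the modules `B|_Y`. -/
lemma isIso_funTrans (hφ : φ.IsLinear) (hφ' : φ.HasRightAdjoint) : IsIso (funTrans hφ) :=
  FunctorOn.isIso_of_isIso_app_of_detecting (funTrans hφ) (fun Y _ => B.free Y)
    (fun _ _ _ _ f H => isIso_of_free_bijective f H) hφ'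
    (hasRightAdjoint_tensorFunctorOn (funModule hφ)) (fun _ hY => isIso_funTensor_free hφ hY)

end

lemma isEquivalence_tensorPrestackFunctor (A B : SheafAlgebra O)
    (H : ∀ (U : Opens X) (_ : U ≤ ⊤) (L : (A.tensor B.op).Mod U),
      (tensorFunctorOn L).IsLinear ∧ (tensorFunctorOn L).HasRightAdjoint) :
    ((tensorPrestackFunctor A B).toHomRightAdjoint H).IsEquivalence :=
  FunctorOn.isEquivalence_of_fullyFaithful _ (fun V _ =>
    { preimage := fun α => (fullyFaithfulTensorFunctorOn A B V).preimage α.hom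
      map_preimage := fun α => ObjectProperty.hom_ext _
        ((fullyFaithfulTensorFunctorOn A B V).map_preimage α.hom)
      preimage_map := fun f => (fullyFaithfulTensorFunctorOn A B V).preimage_map f })
    (o := fun _ _ φ => funModule φ.property.1)
    (fun _ _ φ => ObjectProperty.isoMk _ (@asIso _ _ _ _ (funTrans φ.property.1)
      (isIso_funTrans φ.property.1 φ.property.2)))

end

end SheafAlgebra

end LinearStack

theorem mainTheorem2 {X : Type u} [TopologicalSpace X]
    (O : Sheaf (Opens.grothendieckTopology X) CommRingCat.{u})
    (A B : LinearStack.SheafAlgebra O) :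
    ∃ h : ∀ (U : Opens X) (_ : U ≤ ⊤) (L : (A.tensor B.op).Mod U),
        (LinearStack.SheafAlgebra.tensorFunctorOn L).IsLinear ∧
          (LinearStack.SheafAlgebra.tensorFunctorOn L).HasRightAdjoint,
      ((LinearStack.SheafAlgebra.tensorPrestackFunctor A B).toHomRightAdjoint h).IsLinear ∧
        ((LinearStack.SheafAlgebra.tensorPrestackFunctor A B).toHomRightAdjoint h).IsEquivalence :=
  ⟨fun _ _ L => ⟨LinearStack.SheafAlgebra.isLinear_tensorFunctorOn L,
      LinearStack.SheafAlgebra.hasRightAdjoint_tensorFunctorOn L⟩,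
    LinearStack.SheafAlgebra.isLinear_tensorPrestackFunctor A B _,
    LinearStack.SheafAlgebra.isEquivalence_tensorPrestackFunctor A B _⟩
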